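/- **Setting.** Let $H$, $G$ be real separable Hilbert spaces, and $(\Omega,\mathcal F,\mathbb P)$ a complete probability space with a filtration $(\mathcal F_t)_{t\ge 0}$ satisfying the usual conditions (right-continuous, and $\mathcal F_0$ contains all subsets of null sets). Let $\mathcal P_\infty$ be the predictable $\sigma$-algebra on $[0,\infty)\times\Omega$ and $\mathcal P_T$ its restriction to $[0,T]\times\Omega$. For a continuous Hilbertian seminorm $q$ on $H$, with positive symmetric bilinear form $q(\cdot,\cdot)$, let $H_q$ be the Hilbert space completion of $H/\ker q$ and $i_q:H\to H_q$ the canonical map; $\mathcal L_2(E,G)$ denotes the Hilbert–Schmidt operators from a Hilbert space $E$ to $G$. A cylindrical random variable in $H$ is a linear map $H\to L^0(\Omega,\mathcal F,\mathbb P)$. **The integrator.** Let $U$ be a topological space, $\mathcal R$ a ring of Borel sets generating $\mathcal B(U)$, and $M=(M(t,A):t\ge 0,A\in\mathcal R)$ a family of cylindrical random variables in $H$ such that, for all $A,B\in\mathcal R$ and $h,h_1,h_2\in H$: 1. $M(0,A)(h)=0$ a.s.; for all $t\ge0$, $M(t,\emptyset)(h)=0$ a.s. and $M(t,A\cup B)(h)=M(t,A)(h)+M(t,B)(h)$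 a.s. if $A\cap B=\emptyset$; 2. $(M(t,A)(h))_{t\ge0}$ is a mean-zero square integrable $(\mathcal F_t)$-martingale, and for each $t$ the map $M(t,A):H\to L^0$ is continuous; 3. $\mathbb E\big(M(t,A)(h_1)M(s,B)(h_2)\big)=0$ for all $s,t\ge0$ if $A\cap B=\emptyset$; 4. for $0\le s<t$, with $M((s,t],A)=M(t,A)-M(s,A)$, the random vector $\big(M((s,t],A)(h_1),M((s,t],B)(h_2)\big)$ is independent of $\mathcal F_s$; 5. for $0\le s<t$, $\mathbb E|M((s,t],A)(h)|^2=\int_s^t\int_A q_{r,u}(h)^2\,\mu(du)\,dr$, where $\mu$ is a $\sigma$-finite Borel measure on $U$, finite on $\mathcal R$, for which some countable union of sets of $\mathcal R$ has $\mu$-null complement, and $(q_{r,u})_{r\ge0,u\in U}$ are continuous Hilbertian seminorms on $H$ such that $(r,u)\mapsto q_{r,u}(h_1,h_2)$ is measurable, and bounded on $[0,T]\times U$ for each $T>0$. **The stochastic integral.** $\Lambda^2(M,T)$ is the set of families $\Phi(r,\omega,u)\in\mathcal L_2(H_{q_{r,u}},G)$, $(r,\omega,u)\in[0,T]\times\Omega\times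 U$, for which $(r,\omega,u)\mapsto q_{r,u}(\Phi(r,\omega,u)^*g,i_{q_{r,u}}h)$ is $\mathcal P_T\otimes\mathcal B(U)$-measurable for all $g\in G$, $h\in H$, and $\mathbb E\int_0^T\int_U\|\Phi(r,u)\|^2_{\mathcal L_2(H_{q_{r,u}},G)}\,\mu(du)\,dr<\infty$. For a finite sum $\Phi$ of terms $\mathbf 1_{(s,t]}(r)\mathbf 1_{F}(\omega)\mathbf 1_A(u)\,K\circ i_{q_{r,u}}^*$ with $0\le s<t\le T$, $F\in\mathcal F_s$, $A\in\mathcal R$, $K\in\mathcal L_2(H,G)$, the integral $\int_0^T\!\int_U\Phi\,dM$ is the sum of the variables $\mathbf 1_F Y$, with $Y$ the $G$-valued random variable such that $\langle Y,g\rangle=M((s,t],A)(K^*g)$ a.s. for all $g\in G$; it is extended by continuity from $\Lambda^2(M,T)$ to $L^2(\Omega;G)$. **The equation.** Consider $$dX_t=(AX_t+B(t,X_t))\,dt+\int_U F(t,u,X_t)\,M(dt,du),\qquad X_0=\xi,$$ where - $\xi$ is an $\mathcal F_0$-measurable, square integrable $G$-valued random variable; - $A$ generates a $C_0$-semigroup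 $(S(t))_{t\ge0}$ on $G$; - $B:[0,\infty)\times\Omega\times G\to G$ is $\mathcal P_\infty\otimes\mathcal B(G)$-measurable; - $F(r,u,g)\in\mathcal L_2(H_{q_{r,u}},G)$ for all $r\ge0$, $u\in U$, $g\in G$, and $(r,u,g_1)\mapsto q_{r,u}(F(r,u,g_1)^*g_2,i_{q_{r,u}}h)$ is Borel measurable, i.e. $\mathcal B(\mathbb R_+)\otimes\mathcal B(U)\otimes\mathcal B(G)$-measurable, for all $g_2\in G$, $h\in H$; - there are measurable $a,b:[0,\infty)\to[0,\infty)$ with $\int_0^T(a(r)+b(r)^2)\,dr<\infty$ for each $T>0$ such that, for all $r>0$ and $g,g_1,g_2\in G$ (and all $\omega$), $$\|B(r,g)\|\le a(r)(1+\|g\|),\qquad \int_U\|F(r,u,g)\|^2_{\mathcal L_2(H_{q_{r,u}},G)}\,\mu(du)\le b(r)^2(1+\|g\|)^2,$$ $$\|B(r,g_1)-B(r,g_2)\|\le a(r)\|g_1-g_2\|,\qquad \int_U\|F(r,u,g_1)-F(r,u,g_2)\|^2_{\mathcal L_2(H_{q_{r,u}},G)}\,\mu(du)\le b(r)^2\|g_1-g_2\|^2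 .$$ A mild solution is a predictable $G$-valued process $(X_t)_{t\ge0}$ such that, for every $t\ge0$, $r\mapsto S(t-r)B(r,X_r)$ is a.s. Bochner integrable on $[0,t]$, $(r,\omega,u)\mapsto S(t-r)F(r,u,X_r(\omega))$ belongs to $\Lambda^2(M,t)$, and a.s. $$X_t=S(t)\xi+\int_0^tS(t-r)B(r,X_r)\,dr+\int_0^t\int_US(t-r)F(r,u,X_r)\,M(dr,du).$$ **Theorem.** There exists a mild solution $X$ such that $\sup_{t\in[0,T]}\mathbb E\|X_t\|^2<\infty$ for each $T>0$, and it is unique up to modification: if $X'$ is another mild solution with this property, then $X_t=X'_t$ a.s. for every $t\ge0$. -/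

import Mathlib

open MeasureTheory ProbabilityTheory Filter Topology Set
open scoped NNReal ENNReal InnerProductSpace

noncomputable section

namespace CylSPDE

universe uH uG uU uO

/-! ### Hilbert-Schmidt operators -/

section HilbertSchmidt

variable {E : Type*} [NormedAddCommGroup E] [InnerProductSpace ℝ E]
variable {F : Type*} [NormedAddCommGroup F] [InnerProductSpace ℝ F]

/-- The squared Hilbert-Schmidt norm `∑ ‖S eᵢ‖²` (possibly `∞`), computed in some complete
orthonormal system; see `hsNormSq_eq_tsum` for the independence of the system. -/
def hsNormSq [CompleteSpace E] (S : E →L[ℝ] F) : ℝ≥0∞ :=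
  ∑' i, ‖S ((exists_hilbertBasis ℝ E).choose_spec.choose i)‖ₑ ^ 2

/-- `S ∈ L₂(E, F)`. -/
def IsHilbertSchmidt [CompleteSpace E] (S : E →L[ℝ] F) : Prop := hsNormSq S < ∞

theorem enorm_sq_eq_tsum {ι : Type*} (b : HilbertBasis ι ℝ E) (x : E) :
    ‖x‖ₑ ^ 2 = ∑' i, ‖⟪b i, x⟫_ℝ‖ₑ ^ 2 := by
  have h := b.hasSum_inner_mul_inner x x
  have h2 : ∀ i, ⟪x, b i⟫_ℝ * ⟪b i, x⟫_ℝ = ‖⟪b i, x⟫_ℝ‖ ^ 2 := fun i => by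
    rw [real_inner_comm, Real.norm_eq_abs, sq_abs, sq]
  simp_rw [h2, real_inner_self_eq_norm_sq] at h
  have h3 : ∀ i, ‖⟪b i, x⟫_ℝ‖ₑ ^ 2 = ENNReal.ofReal (‖⟪b i, x⟫_ℝ‖ ^ 2) := fun i => by
    rw [ENNReal.ofReal_pow (norm_nonneg _), ofReal_norm]
  simp_rw [h3]
  rw [← ENNReal.ofReal_tsum_of_nonneg (fun _ => by positivity) h.summable, h.tsum_eq,
    ENNReal.ofReal_pow (norm_nonneg _), ofReal_norm]

theorem tsum_enorm_sq_eq_adjoint [CompleteSpace E] [CompleteSpace F] {ι κ : Type*} (b : HilbertBasis ι ℝ E)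
    (f : HilbertBasis κ ℝ F) (S : E →L[ℝ] F) :
    ∑' i, ‖S (b i)‖ₑ ^ 2 = ∑' j, ‖ContinuousLinearMap.adjoint S (f j)‖ₑ ^ 2 := by
  simp_rw [enorm_sq_eq_tsum f, enorm_sq_eq_tsum b]
  rw [ENNReal.tsum_comm]
  refine tsum_congr fun j => tsum_congr fun i => ?_
  rw [ContinuousLinearMap.adjoint_inner_right, real_inner_comm]

theorem hsNormSq_eq_tsum [CompleteSpace E] [CompleteSpace F] {ι : Type*}
    (b : HilbertBasis ι ℝ E) (S : E →L[ℝ] F) :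
    hsNormSq S = ∑' i, ‖S (b i)‖ₑ ^ 2 := by
  obtain ⟨w, f, -⟩ := exists_hilbertBasis ℝ F
  rw [hsNormSq, tsum_enorm_sq_eq_adjoint _ f, tsum_enorm_sq_eq_adjoint b f]

end HilbertSchmidt

/-! ### Continuous Hilbertian seminorms and the spaces `H_q` -/

section Seminorm

/-- A continuous Hilbertian seminorm `q` on `H`, given by its positive symmetric bilinear form
`q(·,·)`; the seminorm is `q(h) = q(h,h)^{1/2}`. -/
structure HilbertianSeminorm (H : Type uH) [NormedAddCommGroup H] [InnerProductSpace ℝ H] where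
  form : H →ₗ[ℝ] H →ₗ[ℝ] ℝ
  form_symm : ∀ x y, form x y = form y x
  form_nonneg : ∀ x, 0 ≤ form x x
  continuous_seminorm : Continuous fun x => √(form x x)

variable {H : Type uH} [NormedAddCommGroup H] [InnerProductSpace ℝ H]

namespace HilbertianSeminorm

/-- The vector space `H`, to be endowed with the semi-inner product `q(·,·)`. -/
def Pre (_q : HilbertianSeminorm H) : Type uH := H

instance (q : HilbertianSeminorm H) : AddCommGroup q.Pre := inferInstanceAs (AddCommGroup H)
instance (q : HilbertianSeminorm H) : Module ℝ q.Pre := inferInstanceAs (Module ℝ H)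

/-- The identity map from `H` to `H` endowed with `q`. -/
def toPre (q : HilbertianSeminorm H) : H ≃ₗ[ℝ] q.Pre := LinearEquiv.refl ℝ H

/-- The semi-inner product `q(·,·)`. -/
abbrev preCore (q : HilbertianSeminorm H) : PreInnerProductSpace.Core ℝ q.Pre where
  inner x y := q.form (q.toPre.symm x) (q.toPre.symm y)
  conj_inner_symm x y := by simpa using q.form_symm _ _
  re_inner_nonneg x := by simpa using q.form_nonneg _
  add_left x y z := by simp
  smul_left x y r := by simp

instance (q : HilbertianSeminorm H) : SeminormedAddCommGroup q.Pre :=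
  InnerProductSpace.Core.toSeminormedAddCommGroup (c := q.preCore)
instance (q : HilbertianSeminorm H) : InnerProductSpace ℝ q.Pre :=
  InnerProductSpace.ofCore q.preCore

/-- The Hilbert space `H_q`: the (Hausdorff) completion of `H` for the seminorm `q`, that is, the
completion of `H / ker q`. -/
abbrev Space (q : HilbertianSeminorm H) : Type uH := UniformSpace.Completion q.Pre

theorem norm_toPre (q : HilbertianSeminorm H) (x : H) : ‖q.toPre x‖ = √(q.form x x) := rfl

/-- The canonical map `i_q : H → H_q`. -/
def incl (q : HilbertianSeminorm H) : H →L[ℝ] q.Space where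
  toLinearMap := (UniformSpace.Completion.toComplL (𝕜 := ℝ) (E := q.Pre)).toLinearMap ∘ₗ
    q.toPre.toLinearMap
  cont := by
    refine (UniformSpace.Completion.toComplL (𝕜 := ℝ) (E := q.Pre)).continuous.comp ?_
    refine continuous_of_continuousAt_zero q.toPre.toAddMonoidHom ?_
    rw [ContinuousAt, map_zero, tendsto_zero_iff_norm_tendsto_zero]
    have h := q.continuous_seminorm.tendsto 0
    have h0 : √(q.form 0 0) = 0 := by simp
    rw [h0] at h
    exact h

theorem inner_incl (q : HilbertianSeminorm H) (x y : H) :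
    ⟪q.incl x, q.incl y⟫_ℝ = q.form x y :=
  UniformSpace.Completion.inner_coe (𝕜 := ℝ) (q.toPre x) (q.toPre y)

end HilbertianSeminorm

end Seminorm

/-- Lebesgue measure on `[0, ∞)`. -/
def leb : Measure ℝ≥0 := Measure.comap (fun r : ℝ≥0 => (r : ℝ)) volume

/-! ### Filtrations and semigroups -/

/-- The usual conditions: right continuity, and `ℱ 0` contains all subsets of null sets. -/
def UsualConditions {Ω : Type uO} {m : MeasurableSpace Ω} (ℱ : Filtration ℝ≥0 m)
    (P : Measure Ω) : Prop :=
  ℱ.IsRightContinuous ∧ ∀ N : Set Ω, P N = 0 → MeasurableSet[ℱ 0] N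

section Semigroup

variable {G : Type uG} [NormedAddCommGroup G] [InnerProductSpace ℝ G]

/-- A `C₀`-semigroup of bounded linear operators. -/
structure IsC0Semigroup (S : ℝ≥0 → G →L[ℝ] G) : Prop where
  zero : S 0 = ContinuousLinearMap.id ℝ G
  add : ∀ s t, S (s + t) = S s ∘L S t
  continuous : ∀ g, Continuous fun t => S t g

/-- `A : Dom(A) ⊆ G → G` is the infinitesimal generator of `S`: `g ∈ Dom(A)` and `A g = y` iff
`(S(t)g - g)/t → y` as `t ↓ 0`. -/
def IsGenerator (A : G →ₗ.[ℝ] G) (S : ℝ≥0 → G →L[ℝ] G) : Prop :=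
  ∀ g y, (g, y) ∈ A.graph ↔
    Tendsto (fun t : ℝ≥0 => (t : ℝ)⁻¹ • (S t g - g)) (𝓝[>] 0) (𝓝 y)

end Semigroup

/-! ### Cylindrical martingale-valued measures and the stochastic integral -/

section Integral

variable {H : Type uH} [NormedAddCommGroup H] [InnerProductSpace ℝ H] [CompleteSpace H]
variable {G : Type uG} [NormedAddCommGroup G] [InnerProductSpace ℝ G] [CompleteSpace G]
variable {U : Type uU} [MeasurableSpace U]
variable {Ω : Type uO} {m : MeasurableSpace Ω}

/-- The increment `M((s,t],A)(h) = M(t,A)(h) - M(s,A)(h)`. -/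
def incr {P : Measure Ω} (M : ℝ≥0 → Set U → H →ₗ[ℝ] (Ω →ₘ[P] ℝ)) (s t : ℝ≥0) (A : Set U)
    (h : H) : Ω →ₘ[P] ℝ :=
  M t A h - M s A h

/-- `M = (M(t,A) : t ≥ 0, A ∈ R)` is a cylindrical martingale-valued measure in `H` with covariance
`E|M((s,t],A)(h)|² = ∫_s^t ∫_A q_{r,u}(h)² μ(du) dr`. A cylindrical random variable is a linear map
from `H` to the classes of real random variables. Values `M(t,A)` for `A ∉ R` are irrelevant. -/
structure IsCylMartingaleMeasure (P : Measure Ω) (ℱ : Filtration ℝ≥0 m) (R : Set (Set U))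
    (μ : Measure U) (q : ℝ≥0 → U → HilbertianSeminorm H)
    (M : ℝ≥0 → Set U → H →ₗ[ℝ] (Ω →ₘ[P] ℝ)) : Prop where
  isSetRing : IsSetRing R
  generate : (inferInstance : MeasurableSpace U) = MeasurableSpace.generateFrom R
  initial : ∀ A ∈ R, ∀ h, M 0 A h = 0
  empty : ∀ t h, M t ∅ h = 0
  additive : ∀ t, ∀ A ∈ R, ∀ B ∈ R, Disjoint A B → ∀ h, M t (A ∪ B) h = M t A h + M t B h
  martingale : ∀ A ∈ R, ∀ h, Martingale (fun t => (M t A h : Ω → ℝ)) ℱ P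
  memLp : ∀ A ∈ R, ∀ t h, MemLp (M t A h) 2 P
  mean_zero : ∀ A ∈ R, ∀ t h, ∫ ω, M t A h ω ∂P = 0
  /-- Continuity of `M(t,A) : H → L⁰` (convergence in probability). -/
  continuous : ∀ A ∈ R, ∀ t, ∀ (h : ℕ → H) (h₀ : H), Tendsto h atTop (𝓝 h₀) →
    TendstoInMeasure P (fun n => (M t A (h n) : Ω → ℝ)) atTop (M t A h₀)
  orthogonal : ∀ A ∈ R, ∀ B ∈ R, Disjoint A B → ∀ s t h₁ h₂,
    ∫ ω, M t A h₁ ω * M s B h₂ ω ∂P = 0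
  /-- Increments after time `s` are independent of the past (jointly in two sets and vectors). -/
  indep : ∀ s t, s < t → ∀ A ∈ R, ∀ B ∈ R, ∀ h₁ h₂,
    Indep (MeasurableSpace.comap (fun ω => (incr M s t A h₁ ω, incr M s t B h₂ ω)) inferInstance)
      (ℱ s) P
  measure_lt_top : ∀ A ∈ R, μ A < ∞
  /-- `μ` is `σ`-finite along the ring `R`. -/
  exhaust : ∃ K : ℕ → Set U, (∀ n, K n ∈ R) ∧ μ (⋃ n, K n)ᶜ = 0
  form_measurable : ∀ h₁ h₂, Measurable fun p : ℝ≥0 × U => (q p.1 p.2).form h₁ h₂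
  form_bounded : ∀ T : ℝ≥0, ∀ h₁ h₂, ∃ C : ℝ, ∀ r ≤ T, ∀ u, |(q r u).form h₁ h₂| ≤ C
  covariance : ∀ A ∈ R, ∀ s t, s < t → ∀ h,
    ∫⁻ ω, ‖incr M s t A h ω‖ₑ ^ 2 ∂P =
      ∫⁻ r in Ioc s t, ∫⁻ u in A, ENNReal.ofReal ((q r u).form h h) ∂μ ∂leb

/-- `‖Φ‖²` in `Λ²(M,T)`, i.e. `E ∫_0^T ∫_U ‖Φ(r,u)‖²_{L₂(H_{q_{r,u}},G)} μ(du) dr`. -/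
def lambdaNormSq (P : Measure Ω) (μ : Measure U) (q : ℝ≥0 → U → HilbertianSeminorm H) (T : ℝ≥0)
    (Φ : (r : ℝ≥0) → Ω → (u : U) → (q r u).Space →L[ℝ] G) : ℝ≥0∞ :=
  ∫⁻ ω, ∫⁻ r in Iic T, ∫⁻ u, hsNormSq (Φ r ω u) ∂μ ∂leb ∂P

/-- `Φ ∈ Λ²(M,T;H,G)`; only the values `Φ(r,ω,u)` with `r ≤ T` matter. -/
structure MemLambda (P : Measure Ω) (ℱ : Filtration ℝ≥0 m) (μ : Measure U)
    (q : ℝ≥0 → U → HilbertianSeminorm H) (T : ℝ≥0)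
    (Φ : (r : ℝ≥0) → Ω → (u : U) → (q r u).Space →L[ℝ] G) : Prop where
  hilbertSchmidt : ∀ r ≤ T, ∀ ω u, IsHilbertSchmidt (Φ r ω u)
  /-- `(r,ω,u) ↦ q_{r,u}(Φ(r,ω,u)^* g, i_{q_{r,u}} h)` on `[0,T] × Ω × U` (extended by zero) is
  measurable for the predictable `σ`-algebra times that of `U`. -/
  predictable : ∀ (h : H) (g : G), Measurable[ℱ.predictable.prod inferInstance]
    fun p : (ℝ≥0 × Ω) × U => (Iic T).indicator (fun r =>
      ⟪ContinuousLinearMap.adjoint (Φ r p.1.2 p.2) g, (q r p.2).incl h⟫_ℝ) p.1.1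
  norm_lt_top : lambdaNormSq P μ q T Φ < ∞

/-- The data of an elementary integrand `1_{(s,t]}(r) 1_F(ω) 1_A(u) S ∘ i_{q_{r,u}}^*` on `[0,T]`,
with `F ∈ ℱ s`, `A ∈ R` and `S ∈ L₂(H,G)`. Simple integrands are finite sums of these. -/
structure Elementary (H : Type uH) [NormedAddCommGroup H] [InnerProductSpace ℝ H] [CompleteSpace H]
    (G : Type uG) [NormedAddCommGroup G] [InnerProductSpace ℝ G] {Ω : Type uO}
    {m : MeasurableSpace Ω} (ℱ : Filtration ℝ≥0 m) {U : Type uU} (R : Set (Set U))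
    (T : ℝ≥0) where
  s : ℝ≥0
  t : ℝ≥0
  s_lt : s < t
  t_le : t ≤ T
  F : Set Ω
  measurable_F : MeasurableSet[ℱ s] F
  A : Set U
  mem_A : A ∈ R
  S : H →L[ℝ] G
  hilbertSchmidt : IsHilbertSchmidt S

open Classical in
/-- The integrand given by an elementary datum. -/
def Elementary.integrand {ℱ : Filtration ℝ≥0 m} {R : Set (Set U)} {T : ℝ≥0}
    (e : Elementary H G ℱ R T) (q : ℝ≥0 → U → HilbertianSeminorm H) (r : ℝ≥0) (ω : Ω) (u : U) :
    (q r u).Space →L[ℝ] G :=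
  if r ∈ Ioc e.s e.t ∧ ω ∈ e.F ∧ u ∈ e.A then e.S ∘L ContinuousLinearMap.adjoint (q r u).incl
  else 0

/-- `Y` is the radonification of `M((s,t],A)` by `S`, i.e. a `G`-valued random variable with
`⟨Y, g⟩ = M((s,t],A)(S^* g)` a.s. for all `g`. -/
def IsRadonification {P : Measure Ω} (M : ℝ≥0 → Set U → H →ₗ[ℝ] (Ω →ₘ[P] ℝ)) (s t : ℝ≥0)
    (A : Set U) (S : H →L[ℝ] G) (Y : Ω → G) : Prop :=
  AEStronglyMeasurable Y P ∧
    ∀ g : G, ∀ᵐ ω ∂P, ⟪Y ω, g⟫_ℝ = incr M s t A (ContinuousLinearMap.adjoint S g) ω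

/-- `Z` is the value at time `T` of the stochastic integral `∑ᵢ 1_{Fᵢ} Yᵢ` of a simple integrand on
`[0,T]`. -/
def IsSimpleIntegral {P : Measure Ω} {ℱ : Filtration ℝ≥0 m} {R : Set (Set U)} {T : ℝ≥0}
    (M : ℝ≥0 → Set U → H →ₗ[ℝ] (Ω →ₘ[P] ℝ)) {n : ℕ} (Ψ : Fin n → Elementary H G ℱ R T)
    (Z : Ω → G) : Prop :=
  ∃ Y : Fin n → Ω → G,
    (∀ i, IsRadonification M (Ψ i).s (Ψ i).t (Ψ i).A (Ψ i).S (Y i)) ∧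
    ∀ᵐ ω ∂P, Z ω = ∑ i, (Ψ i).F.indicator (Y i) ω

/-- `Φ ∈ Λ²(M,T)` and `Y` is (a version of) `∫_0^T ∫_U Φ(r,u) M(dr,du)`: the continuous extension
of the integral of simple integrands, from `Λ²(M,T)` to `L²(Ω;G)`. -/
def HasStochIntegral (P : Measure Ω) (ℱ : Filtration ℝ≥0 m) (R : Set (Set U)) (μ : Measure U)
    (q : ℝ≥0 → U → HilbertianSeminorm H) (M : ℝ≥0 → Set U → H →ₗ[ℝ] (Ω →ₘ[P] ℝ)) (T : ℝ≥0)
    (Φ : (r : ℝ≥0) → Ω → (u : U) → (q r u).Space →L[ℝ] G) (Y : Ω → G) : Prop :=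
  MemLambda P ℱ μ q T Φ ∧ MemLp Y 2 P ∧
    ∃ (n : ℕ → ℕ) (Ψ : (k : ℕ) → Fin (n k) → Elementary H G ℱ R T) (Z : ℕ → Ω → G),
      (∀ k, IsSimpleIntegral M (Ψ k) (Z k)) ∧
      Tendsto (fun k => lambdaNormSq P μ q T
        (fun r ω u => (∑ i, (Ψ k i).integrand q r ω u) - Φ r ω u)) atTop (𝓝 0) ∧
      Tendsto (fun k => eLpNorm (fun ω => Z k ω - Y ω) 2 P) atTop (𝓝 0)

/-- `X` is a (predictable) mild solution of
`dX = (A X + B(t,X)) dt + ∫_U F(t,u,X) M(dt,du)`, `X₀ = ξ`, where `S` is the semigroup of `A`. -/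
def IsMildSolution (P : Measure Ω) (ℱ : Filtration ℝ≥0 m) (R : Set (Set U)) (μ : Measure U)
    (q : ℝ≥0 → U → HilbertianSeminorm H) (M : ℝ≥0 → Set U → H →ₗ[ℝ] (Ω →ₘ[P] ℝ))
    (S : ℝ≥0 → G →L[ℝ] G) (B : ℝ≥0 → Ω → G → G)
    (F : (r : ℝ≥0) → (u : U) → G → (q r u).Space →L[ℝ] G) (ξ : Ω → G) (X : ℝ≥0 → Ω → G) : Prop :=
  IsStronglyPredictable ℱ X ∧
  ∀ t, (∀ᵐ ω ∂P, IntegrableOn (fun r => S (t - r) (B r ω (X r ω))) (Iic t) leb) ∧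
    ∃ Y : Ω → G, HasStochIntegral P ℱ R μ q M t (fun r ω u => S (t - r) ∘L F r u (X r ω)) Y ∧
      ∀ᵐ ω ∂P, X t ω = S t (ξ ω) + (∫ r in Iic t, S (t - r) (B r ω (X r ω)) ∂leb) + Y ω

/-- `sup_{t ≤ T} E‖X_t‖² < ∞` for each `T`. -/
def LocallyBoundedSecondMoment (P : Measure Ω) (X : ℝ≥0 → Ω → G) : Prop :=
  ∀ T : ℝ≥0, (⨆ t ∈ Iic T, ∫⁻ ω, ‖X t ω‖ₑ ^ 2 ∂P) < ∞

end Integral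

end CylSPDE

end

open MeasureTheory ProbabilityTheory Filter Topology Set
open scoped NNReal ENNReal InnerProductSpace

noncomputable section

namespace CylSPDE

universe uH uG uU uO

/-! The right-hand side of the mild equation defines a map `X ↦ Z` on predictable processes with
locally bounded second moments. For an exponentially weighted second moment this map is a
contraction. The solution is the limit of its Picard iterates, and uniqueness is the same
contraction applied to two solutions.

The noise is controlled by the Itô isometry. Polarising the covariance, splitting sets inside the
ring, and using that increments are independent of the past give the covariance of two elementary
integrals (`integral_indicator_mul_indicator`); Parseval in `G` turns this into the isometry for
simple integrands (`lintegral_sq_simpleIntegral`). Simple integrands built on rank one operators are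
dense in Λ² (`MemLambda.simplyApproximable`). The spaces `H_q` vary with the point, but one
countable family of finite sums of `g ⊗ i_q h` is Hilbert–Schmidt dense over all of them at once, so
an almost best member can be selected measurably; a π-λ argument then replaces predictable sets by
rectangles. Hence every element of Λ² has an integral, continuous with constant 4
(`HasStochIntegral.lintegral_sq_sub_le`).

For two processes with the same initial value, Cauchy–Schwarz for the drift and the previous bound
for the noise give `E‖Z_t - Z'_t‖² ≤ ∫_0^t k(r) E‖X_r - X'_r‖² dr` with `k` a combination of `a` and
`b²` (`exists_kernel`). Since `k` is only integrable, it is split into a bounded part and a part of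
small integral; a weight `e^{cr}` with `c` large then gives the factor 1/4 (`exists_exp_weight`,
`exists_contraction`).

The iteration must not leave the class of predictable processes. The image is adapted and
mean-square continuous (`exists_mildImage`), hence has a predictable version, a limit of processes
frozen on finer and finer grids (`exists_predictable_version`). As curves in L² the iterates
converge locally uniformly; the limit is again continuous and adapted, and its predictable version
is a fixed point up to modification. -/

theorem enorm_add_sq_le {F : Type*} [SeminormedAddCommGroup F] (x y : F) :
    ‖x + y‖ₑ ^ 2 ≤ 2 * ‖x‖ₑ ^ 2 + 2 * ‖y‖ₑ ^ 2 := by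
  have h : ‖x + y‖₊ ^ 2 ≤ 2 * ‖x‖₊ ^ 2 + 2 * ‖y‖₊ ^ 2 := by
    have h1 : ‖x + y‖ ≤ ‖x‖ + ‖y‖ := norm_add_le x y
    have : ‖x + y‖ ^ 2 ≤ 2 * ‖x‖ ^ 2 + 2 * ‖y‖ ^ 2 := by
      nlinarith [sq_nonneg (‖x‖ - ‖y‖), norm_nonneg (x + y)]
    exact_mod_cast this
  simp only [enorm_eq_nnnorm]
  exact_mod_cast h

/-- Serves every two-step approximation below: squared norms satisfy the triangle inequality only
with factors 2, so each error is taken below `ε / 4`. -/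
theorem two_mul_add_two_mul_lt {x y ε : ℝ≥0∞} (hx : x < ε / 4) (hy : y < ε / 4) :
    2 * x + 2 * y < ε := by
  calc 2 * x + 2 * y < 2 * (ε / 4) + 2 * (ε / 4) := by
        refine ENNReal.add_lt_add ?_ ?_ <;>
        exact (ENNReal.mul_lt_mul_iff_right (by simp) (by simp)).2 ‹_›
    _ = ε := by
      rw [← add_mul, ← mul_div_assoc]
      norm_num
      rw [mul_comm, ENNReal.mul_div_cancel_right (by simp) (by simp)]

/-! ### Hilbert–Schmidt norms. -/

section HilbertSchmidtLemmas

open InnerProductSpace ContinuousLinearMap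

variable {E : Type*} [NormedAddCommGroup E] [InnerProductSpace ℝ E] [CompleteSpace E]
variable {F : Type*} [NormedAddCommGroup F] [InnerProductSpace ℝ F]

theorem hsNormSq_eq_tsum_adjoint [CompleteSpace F] {κ : Type*} (f : HilbertBasis κ ℝ F)
    (S : E →L[ℝ] F) : hsNormSq S = ∑' j, ‖adjoint S (f j)‖ₑ ^ 2 :=
  tsum_enorm_sq_eq_adjoint _ f S

@[simp] theorem hsNormSq_zero : hsNormSq (0 : E →L[ℝ] F) = 0 := by simp [hsNormSq]

@[simp] theorem hsNormSq_neg (S : E →L[ℝ] F) : hsNormSq (-S) = hsNormSq S := by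
  simp [hsNormSq]

theorem hsNormSq_add_le (S T : E →L[ℝ] F) :
    hsNormSq (S + T) ≤ 2 * hsNormSq S + 2 * hsNormSq T := by
  simp only [hsNormSq, ← ENNReal.tsum_mul_left, ← ENNReal.tsum_add]
  exact ENNReal.tsum_le_tsum fun i => enorm_add_sq_le _ _

theorem hsNormSq_sub_le (S T : E →L[ℝ] F) :
    hsNormSq (S - T) ≤ 2 * hsNormSq S + 2 * hsNormSq T := by
  simpa [sub_eq_add_neg] using hsNormSq_add_le S (-T)

theorem hsNormSq_sub_comm (S T : E →L[ℝ] F) : hsNormSq (S - T) = hsNormSq (T - S) := by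
  rw [← neg_sub, hsNormSq_neg]

theorem hsNormSq_comp_le {F' : Type*} [NormedAddCommGroup F'] [InnerProductSpace ℝ F']
    (L : F →L[ℝ] F') (S : E →L[ℝ] F) : hsNormSq (L ∘L S) ≤ ‖L‖ₑ ^ 2 * hsNormSq S := by
  simp only [hsNormSq, ← ENNReal.tsum_mul_left]
  refine ENNReal.tsum_le_tsum fun i => ?_
  rw [← mul_pow]
  gcongr
  exact L.le_opENorm _

theorem hsNormSq_rankOne [CompleteSpace F] (g : F) (x : E) :
    hsNormSq (rankOne ℝ g x) = ‖g‖ₑ ^ 2 * ‖x‖ₑ ^ 2 := by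
  obtain ⟨w, b, -⟩ := exists_hilbertBasis ℝ E
  rw [hsNormSq_eq_tsum b, enorm_sq_eq_tsum b x, ← ENNReal.tsum_mul_left]
  refine tsum_congr fun i => ?_
  rw [rankOne_apply, enorm_smul, mul_pow, mul_comm, real_inner_comm]

/-- Dominated convergence over an orthonormal basis, with summable bound `C² ‖S b_k‖²`, turns strong
convergence of `L i` into Hilbert–Schmidt convergence of `L i ∘L S`. This is how the merely strong
continuity of the semigroup suffices for the stochastic convolution. -/
theorem tendsto_hsNormSq_comp {F' : Type*} [NormedAddCommGroup F'] [InnerProductSpace ℝ F']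
    {ι : Type*} {l : Filter ι} [l.IsCountablyGenerated] (L : ι → F →L[ℝ] F') (S : E →L[ℝ] F)
    (hS : hsNormSq S ≠ ∞) (hL : ∀ x, Tendsto (fun i => L i x) l (𝓝 0)) {C : ℝ≥0∞} (hC' : C ≠ ∞)
    (hC : ∀ᶠ i in l, ‖L i‖ₑ ≤ C) : Tendsto (fun i => hsNormSq (L i ∘L S)) l (𝓝 0) := by
  let κ := (exists_hilbertBasis ℝ E).choose
  let b : HilbertBasis κ ℝ E := (exists_hilbertBasis ℝ E).choose_spec.choose
  let _ : MeasurableSpace κ := ⊤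
  have key : Tendsto (fun i => ∫⁻ k, ‖L i (S (b k))‖ₑ ^ 2 ∂Measure.count) l
      (𝓝 (∫⁻ _, 0 ∂(Measure.count : Measure κ))) := by
    refine tendsto_lintegral_filter_of_dominated_convergence
      (fun k => C ^ 2 * ‖S (b k)‖ₑ ^ 2) (.of_forall fun _ => measurable_from_top) ?_ ?_ ?_
    · filter_upwards [hC] with i hi
      refine .of_forall fun k => ?_
      rw [← mul_pow]
      gcongr
      exact ((L i).le_opENorm _).trans (by gcongr)
    · rw [lintegral_count, ENNReal.tsum_mul_left]
      exact ENNReal.mul_ne_top (by finiteness) hS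
    · refine .of_forall fun k => ?_
      have := ENNReal.Tendsto.pow (n := 2) (hL (S (b k))).enorm
      simpa using this
  simp only [lintegral_count, tsum_zero] at key
  exact key

end HilbertSchmidtLemmas

/-! ### Measurability of operator fields whose domain varies with the point. -/

section Fields

open InnerProductSpace ContinuousLinearMap

variable {H : Type uH} [NormedAddCommGroup H] [InnerProductSpace ℝ H]
variable {G : Type uG} [NormedAddCommGroup G] [InnerProductSpace ℝ G]

theorem HilbertianSeminorm.denseRange_incl (Q : HilbertianSeminorm H) : DenseRange Q.incl := by
  have h := (UniformSpace.Completion.denseRange_coe (α := Q.Pre))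
  exact h

/-- Orthonormal vectors are at mutual distance √2, so the balls of radius 1/2 around them are
disjoint, and a separable space has only countably many disjoint nonempty open sets. -/
theorem exists_countable_hilbertBasis (G : Type uG) [NormedAddCommGroup G] [InnerProductSpace ℝ G]
    [CompleteSpace G] [TopologicalSpace.SeparableSpace G] :
    ∃ (w : Set G) (_ : HilbertBasis w ℝ G), w.Countable := by
  obtain ⟨w, b, hb⟩ := exists_hilbertBasis ℝ G
  refine ⟨w, b, ?_⟩
  have hsep : Pairwise fun i j : w => Disjoint (Metric.ball (i : G) (1/2)) (Metric.ball (j : G) (1/2)) := by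
    intro i j hij
    refine Metric.ball_disjoint_ball ?_
    have ho := b.orthonormal
    have h2 : ‖b i - b j‖ ^ 2 = 2 := by
      rw [@norm_sub_sq_real, ho.1 i, ho.1 j, ho.2 hij]; norm_num
    rw [dist_eq_norm, ← hb]
    nlinarith [norm_nonneg (b i - b j)]
  have := Pairwise.countable_of_isOpen_disjoint hsep (fun _ => Metric.isOpen_ball)
    (fun i => ⟨i, by simp⟩)
  exact this

/-- `‖x‖² = sup_h (2 ⟨x, i h⟩ - q(h,h))` over a dense sequence. -/
theorem enorm_sq_eq_iSup_dense {ι : Type*} (Q : HilbertianSeminorm H) {d : ι → H}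
    (hd : DenseRange d) (x : Q.Space) :
    ‖x‖ₑ ^ 2 = ⨆ n, ENNReal.ofReal (2 * ⟪x, Q.incl (d n)⟫_ℝ - Q.form (d n) (d n)) := by
  have hx : ‖x‖ₑ ^ 2 = ENNReal.ofReal (‖x‖ ^ 2) := by
    rw [ENNReal.ofReal_pow (norm_nonneg _), ofReal_norm]
  -- Completing the square: the supremum is reached by letting `Q.incl (d n)` approach `x`.
  have hid : ∀ n, 2 * ⟪x, Q.incl (d n)⟫_ℝ - Q.form (d n) (d n)
      = ‖x‖ ^ 2 - ‖x - Q.incl (d n)‖ ^ 2 := fun n => by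
    rw [@norm_sub_sq_real, ← Q.inner_incl, real_inner_self_eq_norm_sq]; ring
  rw [hx]
  refine le_antisymm ?_ (iSup_le fun n => ENNReal.ofReal_le_ofReal ?_)
  · have hdd : DenseRange fun n => Q.incl (d n) := Q.denseRange_incl.comp hd Q.incl.continuous
    refine le_of_forall_lt fun c hc => ?_
    have hcont : Continuous fun y : Q.Space => ENNReal.ofReal (‖x‖ ^ 2 - ‖x - y‖ ^ 2) :=
      ENNReal.continuous_ofReal.comp (by fun_prop)
    have hopen : IsOpen {y : Q.Space | c < ENNReal.ofReal (‖x‖ ^ 2 - ‖x - y‖ ^ 2)} :=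
      isOpen_lt continuous_const hcont
    obtain ⟨n, hn⟩ := hdd.exists_mem_open hopen ⟨x, by simpa using hc⟩
    refine lt_of_lt_of_le hn ?_
    rw [← hid]
    exact le_iSup (fun n => ENNReal.ofReal (2 * ⟪x, Q.incl (d n)⟫_ℝ - Q.form (d n) (d n))) n
  · rw [hid]; nlinarith [sq_nonneg ‖x - Q.incl (d n)‖]

variable [CompleteSpace G] [TopologicalSpace.SeparableSpace G]

/-- The spaces `(Q x).Space` differ from point to point, so only scalar functions can be tested. The
adjoint moves the norm onto a countable basis of the fixed space `G`, and each `‖Φ* g‖²` is a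
countable supremum of measurable scalar functions. -/
theorem measurable_hsNormSq [TopologicalSpace.SeparableSpace H] {X : Type*} {mX : MeasurableSpace X} (Q : X → HilbertianSeminorm H)
    (hQ : ∀ h₁ h₂, Measurable fun x => (Q x).form h₁ h₂) (Φ : (x : X) → (Q x).Space →L[ℝ] G)
    (hΦ : ∀ h g, Measurable fun x => ⟪adjoint (Φ x) g, (Q x).incl h⟫_ℝ) :
    Measurable fun x => hsNormSq (Φ x) := by
  obtain ⟨w, b, hw⟩ := exists_countable_hilbertBasis G
  have : Countable w := hw
  simp_rw [hsNormSq_eq_tsum_adjoint b,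
    enorm_sq_eq_iSup_dense _ (TopologicalSpace.denseRange_denseSeq H)]
  refine Measurable.tsum fun j => Measurable.iSup fun n => ?_
  exact (((hΦ _ _).const_mul 2).sub (hQ _ _)).ennreal_ofReal

/-- Parseval in `G` writes the pairing `⟪L* g, Φ (i h)⟫` as a countable sum of products of
measurable coefficients. -/
theorem measurable_comp_field {X : Type*} {mX : MeasurableSpace X} (Q : X → HilbertianSeminorm H)
    (Φ : (x : X) → (Q x).Space →L[ℝ] G)
    (hΦ : ∀ h g, Measurable fun x => ⟪adjoint (Φ x) g, (Q x).incl h⟫_ℝ)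
    (L : X → G →L[ℝ] G) (hL : ∀ g g', Measurable fun x => ⟪L x g, g'⟫_ℝ) (h : H) (g : G) :
    Measurable fun x => ⟪adjoint (L x ∘L Φ x) g, (Q x).incl h⟫_ℝ := by
  obtain ⟨w, b, hw⟩ := exists_countable_hilbertBasis G
  have : Countable w := hw
  have key : ∀ x, HasSum (fun k => ⟪L x (b k), g⟫_ℝ * ⟪adjoint (Φ x) (b k), (Q x).incl h⟫_ℝ)
      ⟪adjoint (L x ∘L Φ x) g, (Q x).incl h⟫_ℝ := fun x => by
    have := b.hasSum_inner_mul_inner (adjoint (L x) g) (Φ x ((Q x).incl h))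
    have e : ⟪adjoint (L x ∘L Φ x) g, (Q x).incl h⟫_ℝ
        = ⟪adjoint (L x) g, Φ x ((Q x).incl h)⟫_ℝ := by
      rw [adjoint_inner_left, adjoint_inner_left, ContinuousLinearMap.comp_apply]
    rw [e]
    have hk : (fun k => ⟪L x (b k), g⟫_ℝ * ⟪adjoint (Φ x) (b k), (Q x).incl h⟫_ℝ) = fun k =>
        ⟪adjoint (L x) g, b k⟫_ℝ * ⟪b k, Φ x ((Q x).incl h)⟫_ℝ := funext fun k => by
      rw [adjoint_inner_left, adjoint_inner_left, real_inner_comm]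
    rw [hk]
    exact this
  simp_rw [← (key _).tsum_eq]
  exact Measurable.tsum fun k => (hL _ _).mul (hΦ _ _)

end Fields

/-! ### A countable family of finite rank operators, dense for every seminorm. -/

section Density

open InnerProductSpace ContinuousLinearMap

variable {H : Type uH} [NormedAddCommGroup H] [InnerProductSpace ℝ H]
variable {G : Type uG} [NormedAddCommGroup G] [InnerProductSpace ℝ G]

/-- A finite sum of rank one operators `g ⊗ i_q h`, with `g` and `h` from given sequences. -/
def rankOneSum (d : ℕ → G) (d' : ℕ → H) (Q : HilbertianSeminorm H) (l : List (ℕ × ℕ)) :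
    Q.Space →L[ℝ] G :=
  (l.map fun p => rankOne ℝ (d p.1) (Q.incl (d' p.2))).sum

@[simp] theorem rankOneSum_nil (d : ℕ → G) (d' : ℕ → H) (Q : HilbertianSeminorm H) :
    rankOneSum d d' Q [] = 0 := by simp [rankOneSum]

@[simp] theorem rankOneSum_cons (d : ℕ → G) (d' : ℕ → H) (Q : HilbertianSeminorm H) (p : ℕ × ℕ)
    (l : List (ℕ × ℕ)) : rankOneSum d d' Q (p :: l) =
      rankOne ℝ (d p.1) (Q.incl (d' p.2)) + rankOneSum d d' Q l := by simp [rankOneSum]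

theorem rankOneSum_append (d : ℕ → G) (d' : ℕ → H) (Q : HilbertianSeminorm H)
    (l l' : List (ℕ × ℕ)) : rankOneSum d d' Q (l ++ l') =
      rankOneSum d d' Q l + rankOneSum d d' Q l' := by simp [rankOneSum]

variable [CompleteSpace G] {d : ℕ → G} {d' : ℕ → H}

/-- Uses `g ⊗ x - g' ⊗ x' = (g - g') ⊗ x + g' ⊗ (x - x')`, whose norm bound is continuous in `(g',
x')` and vanishes at `(g, x)`. -/
theorem exists_rankOneSum_near_rankOne (hd : DenseRange d) (hd' : DenseRange d')
    (Q : HilbertianSeminorm H) (g : G) (x : Q.Space) {ε : ℝ≥0∞} (hε : 0 < ε) :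
    ∃ l, hsNormSq (rankOne ℝ g x - rankOneSum d d' Q l) < ε := by
  have hdd : DenseRange fun n => Q.incl (d' n) := Q.denseRange_incl.comp hd' Q.incl.continuous
  have hprod : DenseRange (Prod.map d fun n => Q.incl (d' n)) := hd.prodMap hdd
  let f : G × Q.Space → ℝ≥0∞ := fun p =>
    2 * (‖g - p.1‖ₑ ^ 2 * ‖x‖ₑ ^ 2) + 2 * (‖p.1‖ₑ ^ 2 * ‖x - p.2‖ₑ ^ 2)
  have hf : f = fun p => (((2 * (‖g - p.1‖₊ ^ 2 * ‖x‖₊ ^ 2)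
      + 2 * (‖p.1‖₊ ^ 2 * ‖x - p.2‖₊ ^ 2) : ℝ≥0)) : ℝ≥0∞) := by
    funext p; simp [f, enorm_eq_nnnorm]
  have hcont : Continuous f := by
    rw [hf]; exact ENNReal.continuous_coe.comp (by fun_prop)
  obtain ⟨⟨n, m⟩, hnm⟩ := hprod.exists_mem_open (isOpen_lt hcont continuous_const)
    ⟨(g, x), show f (g, x) < ε by simpa [f] using hε⟩
  refine ⟨[(n, m)], lt_of_le_of_lt ?_ hnm⟩
  have e : rankOne ℝ g x - rankOneSum d d' Q [(n, m)] =
      rankOne ℝ (g - d n) x + rankOne ℝ (d n) (x - Q.incl (d' m)) := by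
    simp
  rw [e]
  refine (hsNormSq_add_le _ _).trans ?_
  rw [hsNormSq_rankOne, hsNormSq_rankOne]
  rfl

/-- Truncate the expansion of `S` along a basis of `H_q`, then perturb each rank one term. The
approximants are indexed by `List (ℕ × ℕ)` independently of `Q`; this uniform countable index set is
what later allows a measurable choice. -/
theorem exists_rankOneSum_near (hd : DenseRange d) (hd' : DenseRange d')
    (Q : HilbertianSeminorm H) (S : Q.Space →L[ℝ] G) (hS : IsHilbertSchmidt S) {ε : ℝ≥0∞}
    (hε : 0 < ε) : ∃ l, hsNormSq (S - rankOneSum d d' Q l) < ε := by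
  classical
  obtain ⟨w, b, -⟩ := exists_hilbertBasis ℝ Q.Space
  have hsum : ∀ (s : Finset w) (ε : ℝ≥0∞), 0 < ε →
      ∃ l, hsNormSq ((∑ i ∈ s, rankOne ℝ (S (b i)) (b i)) - rankOneSum d d' Q l) < ε := by
    intro s
    induction s using Finset.induction_on with
    | empty => exact fun ε hε => ⟨[], by simpa using hε⟩
    | insert i s hi ih =>
      intro ε hε
      have hε' : 0 < ε / 4 := ENNReal.div_pos hε.ne' (by simp)
      obtain ⟨l, hl⟩ := ih (ε / 4) hε'
      obtain ⟨l', hl'⟩ := exists_rankOneSum_near_rankOne hd hd' Q (S (b i)) (b i) hε'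
      refine ⟨l' ++ l, ?_⟩
      rw [Finset.sum_insert hi, rankOneSum_append, add_sub_add_comm]
      exact (hsNormSq_add_le _ _).trans_lt (two_mul_add_two_mul_lt hl' hl)
  have htail := ENNReal.tendsto_tsum_compl_atTop_zero (f := fun i => ‖S (b i)‖ₑ ^ 2)
    (by rw [← hsNormSq_eq_tsum b]; exact hS.ne)
  have hε' : 0 < ε / 4 := ENNReal.div_pos hε.ne' (by simp)
  obtain ⟨s, hs⟩ := (htail.eventually_lt_const hε').exists
  have hs' : hsNormSq (S - ∑ i ∈ s, rankOne ℝ (S (b i)) (b i)) < ε / 4 := by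
    refine lt_of_eq_of_lt ?_ hs
    rw [hsNormSq_eq_tsum b]
    refine Eq.trans ?_ (tsum_subtype {i | i ∉ s} (fun i => ‖S (b i)‖ₑ ^ 2)).symm
    refine tsum_congr fun j => ?_
    have hb : ∀ i, ⟪b i, b j⟫_ℝ = if i = j then 1 else 0 :=
      fun i => (orthonormal_iff_ite.1 b.orthonormal i j)
    simp [Set.indicator, hb]
    split_ifs <;> simp
  obtain ⟨l, hl⟩ := hsum s (ε / 4) hε'
  refine ⟨l, ?_⟩
  rw [← sub_add_sub_cancel _ (∑ i ∈ s, rankOne ℝ (S (b i)) (b i))]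
  exact (hsNormSq_add_le _ _).trans_lt (two_mul_add_two_mul_lt hs' hl)

end Density

/-! ### Lebesgue measure on the half-line. -/

section Lebesgue

theorem measurableEmbedding_nnreal_coe : MeasurableEmbedding ((↑) : ℝ≥0 → ℝ) :=
  MeasurableEmbedding.subtype_coe measurableSet_Ici

theorem leb_apply (s : Set ℝ≥0) : leb s = volume (((↑) : ℝ≥0 → ℝ) '' s) :=
  measurableEmbedding_nnreal_coe.comap_apply _ _

theorem lintegral_leb (f : ℝ → ℝ≥0∞) (s : Set ℝ≥0) :
    ∫⁻ r in s, f r ∂leb = ∫⁻ r in ((↑) : ℝ≥0 → ℝ) '' s, f r := by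
  have h := measurableEmbedding_nnreal_coe
  have e : leb.restrict s = (volume.restrict (((↑) : ℝ≥0 → ℝ) '' s)).comap (↑) := by
    rw [h.comap_restrict, preimage_image_eq _ h.injective]; rfl
  rw [e, ← h.lintegral_map, h.map_comap,
    Measure.restrict_restrict h.measurableSet_range, inter_eq_right.2 (image_subset_range _ _)]

instance : NullSingletonClass leb where
  measure_singleton x := by rw [leb_apply]; simp

theorem leb_Iic_lt_top (T : ℝ≥0) : leb (Iic T) < ∞ := by
  rw [leb_apply]
  refine (measure_mono ?_).trans_lt (measure_Icc_lt_top (a := (0 : ℝ)) (b := T))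
  rintro _ ⟨x, hx, rfl⟩
  exact ⟨x.2, hx⟩

instance (T : ℝ≥0) : IsFiniteMeasure (leb.restrict (Iic T)) :=
  ⟨by rw [Measure.restrict_apply_univ]; exact leb_Iic_lt_top T⟩

instance : SigmaFinite leb :=
  ⟨⟨⟨fun n : ℕ => Iic (n : ℝ≥0), fun _ => trivial, fun n => leb_Iic_lt_top n, by
    ext x; simpa using exists_nat_ge x⟩⟩⟩

end Lebesgue

/-! ### Covariance of increments and their independence of the past. -/

section Increments

variable {H : Type uH} [NormedAddCommGroup H] [InnerProductSpace ℝ H]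
variable {U : Type uU} [MeasurableSpace U]
variable {Ω : Type uO} {m : MeasurableSpace Ω} {P : Measure Ω} {ℱ : Filtration ℝ≥0 m}
  {R : Set (Set U)} {μ : Measure U} {q : ℝ≥0 → U → HilbertianSeminorm H}
  {M : ℝ≥0 → Set U → H →ₗ[ℝ] (Ω →ₘ[P] ℝ)}

omit [MeasurableSpace U] in
theorem incr_concat (s t u : ℝ≥0) (A : Set U) (h : H) :
    incr M s u A h = incr M s t A h + incr M t u A h := by
  simp [incr]

omit [MeasurableSpace U] in
theorem incr_add (s t : ℝ≥0) (A : Set U) (h k : H) :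
    incr M s t A (h + k) = incr M s t A h + incr M s t A k := by
  simp [incr]; abel

omit [MeasurableSpace U] in
theorem incr_sub (s t : ℝ≥0) (A : Set U) (h k : H) :
    incr M s t A (h - k) = incr M s t A h - incr M s t A k := by
  simp [incr]; abel

omit [MeasurableSpace U] in
theorem incr_smul (s t : ℝ≥0) (A : Set U) (c : ℝ) (h : H) :
    incr M s t A (c • h) = c • incr M s t A h := by
  simp [incr, smul_sub]

namespace IsCylMartingaleMeasure

variable (hM : IsCylMartingaleMeasure P ℱ R μ q M)
include hM

theorem measurableSet {A : Set U} (hA : A ∈ R) : MeasurableSet A := by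
  have h := hM.generate.ge A (MeasurableSpace.measurableSet_generateFrom hA)
  exact h

theorem memLp_incr {A : Set U} (hA : A ∈ R) (s t : ℝ≥0) (h : H) :
    MemLp (incr M s t A h) 2 P :=
  ((hM.memLp A hA t h).sub (hM.memLp A hA s h)).ae_eq (AEEqFun.coeFn_sub _ _).symm

theorem integral_incr [IsFiniteMeasure P] {A : Set U} (hA : A ∈ R) (s t : ℝ≥0) (h : H) :
    ∫ ω, incr M s t A h ω ∂P = 0 := by
  refine (integral_congr_ae (AEEqFun.coeFn_sub (M t A h) (M s A h))).trans ?_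
  simp only [Pi.sub_apply]
  rw [integral_sub ((hM.memLp A hA t h).integrable (by simp))
    ((hM.memLp A hA s h).integrable (by simp)), hM.mean_zero A hA, hM.mean_zero A hA, sub_zero]

theorem aestronglyMeasurable_incr {A : Set U} (hA : A ∈ R) {s t : ℝ≥0} (hst : s ≤ t) (h : H) :
    AEStronglyMeasurable[ℱ t] (incr M s t A h : Ω → ℝ) P := by
  have h1 := (hM.martingale A hA h).stronglyAdapted t
  have h2 := ((hM.martingale A hA h).stronglyAdapted s).mono (ℱ.mono hst)
  exact ⟨_, h1.sub h2, AEEqFun.coeFn_sub _ _⟩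

theorem incr_union {A B : Set U} (hA : A ∈ R) (hB : B ∈ R) (hAB : Disjoint A B) (s t : ℝ≥0)
    (h : H) : incr M s t (A ∪ B) h = incr M s t A h + incr M s t B h := by
  simp only [incr, hM.additive _ A hA B hB hAB]; abel

theorem integrable_incr_mul {A B : Set U} (hA : A ∈ R) (hB : B ∈ R) (s t s' t' : ℝ≥0) (h k : H) :
    Integrable (fun ω => incr M s t A h ω * incr M s' t' B k ω) P :=
  (hM.memLp_incr hA s t h).integrable_mul (hM.memLp_incr hB s' t' k)

theorem integral_incr_mul_of_disjoint {A B : Set U} (hA : A ∈ R) (hB : B ∈ R)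
    (hAB : Disjoint A B) (s t s' t' : ℝ≥0) (h k : H) :
    ∫ ω, incr M s t A h ω * incr M s' t' B k ω ∂P = 0 := by
  have e : (fun ω => incr M s t A h ω * incr M s' t' B k ω) =ᵐ[P] fun ω =>
      (M t A h ω * M t' B k ω - M t A h ω * M s' B k ω)
        - (M s A h ω * M t' B k ω - M s A h ω * M s' B k ω) := by
    filter_upwards [AEEqFun.coeFn_sub (M t A h) (M s A h),
      AEEqFun.coeFn_sub (M t' B k) (M s' B k)] with ω h1 h2
    simp only [incr, h1, h2, Pi.sub_apply]; ring
  have hi : ∀ a b, Integrable (fun ω => M a A h ω * M b B k ω) P := fun a b =>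
    (hM.memLp A hA a h).integrable_mul (hM.memLp B hB b k)
  have hi2 : ∀ a b c d, Integrable (fun ω => M a A h ω * M b B k ω - M c A h ω * M d B k ω) P :=
    fun a b c d => (hi a b).sub (hi c d)
  rw [integral_congr_ae e, integral_sub (hi2 _ _ _ _) (hi2 _ _ _ _),
    integral_sub (hi _ _) (hi _ _), integral_sub (hi _ _) (hi _ _)]
  simp [hM.orthogonal A hA B hB hAB]

theorem integrableOn_form [SigmaFinite μ] {A : Set U} (hA : A ∈ R) (s t : ℝ≥0) (h k : H) :
    IntegrableOn (fun p : ℝ≥0 × U => (q p.1 p.2).form h k) (Ioc s t ×ˢ A) (leb.prod μ) := by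
  obtain ⟨C, hC⟩ := hM.form_bounded t h k
  have hfin : (leb.prod μ) (Ioc s t ×ˢ A) < ∞ := by
    rw [Measure.prod_prod]
    exact ENNReal.mul_lt_top ((measure_mono Ioc_subset_Iic_self).trans_lt (leb_Iic_lt_top t))
      (hM.measure_lt_top A hA)
  refine Measure.integrableOn_of_bounded (M := C) hfin.ne
    (hM.form_measurable h k).aestronglyMeasurable ?_
  refine (ae_restrict_iff' (measurableSet_Ioc.prod (hM.measurableSet hA))).2 (.of_forall ?_)
  rintro ⟨r, u⟩ ⟨hr, -⟩
  exact hC r hr.2 u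

theorem integral_incr_sq [SigmaFinite μ] {A : Set U} (hA : A ∈ R) {s t : ℝ≥0} (hst : s < t)
    (h : H) : ∫ ω, incr M s t A h ω * incr M s t A h ω ∂P =
      ∫ p in Ioc s t ×ˢ A, (q p.1 p.2).form h h ∂(leb.prod μ) := by
  have h1 := hM.covariance A hA s t hst h
  have hm : Measurable fun p : ℝ≥0 × U => ENNReal.ofReal ((q p.1 p.2).form h h) :=
    (hM.form_measurable h h).ennreal_ofReal
  have h2 : ENNReal.ofReal (∫ ω, incr M s t A h ω * incr M s t A h ω ∂P) =
      ENNReal.ofReal (∫ p in Ioc s t ×ˢ A, (q p.1 p.2).form h h ∂(leb.prod μ)) := by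
    rw [ofReal_integral_eq_lintegral_ofReal (hM.integrable_incr_mul hA hA _ _ _ _ _ _)
      (.of_forall fun ω => mul_self_nonneg _),
      ofReal_integral_eq_lintegral_ofReal (hM.integrableOn_form hA s t h h)
      (.of_forall fun p => (q p.1 p.2).form_nonneg h), ← Measure.prod_restrict,
      lintegral_prod _ hm.aemeasurable, ← h1]
    refine lintegral_congr fun ω => ?_
    rw [← sq, ← sq_abs, ← Real.norm_eq_abs, ENNReal.ofReal_pow (norm_nonneg _), ofReal_norm]
  refine (ENNReal.ofReal_eq_ofReal_iff ?_ ?_).1 h2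
  · exact integral_nonneg fun ω => mul_self_nonneg _
  · exact integral_nonneg fun p => (q p.1 p.2).form_nonneg h

/-- Polarisation: both sides are symmetric bilinear in `(h, k)` and agree on the diagonal. -/
theorem integral_incr_mul_self [SigmaFinite μ] {A : Set U} (hA : A ∈ R) {s t : ℝ≥0} (hst : s < t)
    (h k : H) : ∫ ω, incr M s t A h ω * incr M s t A k ω ∂P =
      ∫ p in Ioc s t ×ˢ A, (q p.1 p.2).form h k ∂(leb.prod μ) := by
  have h1 := hM.integral_incr_sq hA hst (h + k)
  have h2 := hM.integral_incr_sq hA hst (h - k)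
  have e1 : ∫ ω, incr M s t A h ω * incr M s t A k ω ∂P =
      4⁻¹ * (∫ ω, incr M s t A (h + k) ω * incr M s t A (h + k) ω ∂P
        - ∫ ω, incr M s t A (h - k) ω * incr M s t A (h - k) ω ∂P) := by
    rw [← integral_sub (hM.integrable_incr_mul hA hA _ _ _ _ _ _)
      (hM.integrable_incr_mul hA hA _ _ _ _ _ _), ← integral_const_mul]
    refine integral_congr_ae ?_
    rw [incr_add, incr_sub]
    filter_upwards [AEEqFun.coeFn_add (incr M s t A h) (incr M s t A k),
      AEEqFun.coeFn_sub (incr M s t A h) (incr M s t A k)] with ω h3 h4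
    simp only [h3, h4, Pi.add_apply, Pi.sub_apply]; ring
  have e2 : ∫ p in Ioc s t ×ˢ A, (q p.1 p.2).form h k ∂(leb.prod μ) =
      4⁻¹ * (∫ p in Ioc s t ×ˢ A, (q p.1 p.2).form (h + k) (h + k) ∂(leb.prod μ)
        - ∫ p in Ioc s t ×ˢ A, (q p.1 p.2).form (h - k) (h - k) ∂(leb.prod μ)) := by
    rw [← integral_sub (hM.integrableOn_form hA _ _ _ _) (hM.integrableOn_form hA _ _ _ _),
      ← integral_const_mul]
    refine integral_congr_ae (.of_forall fun p => ?_)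
    simp only [map_add, map_sub, LinearMap.add_apply, LinearMap.sub_apply]
    rw [(q p.1 p.2).form_symm k h]; ring
  rw [e1, e2, h1, h2]

/-- Split `A` and `B` along `A ∩ B`, which stays inside the ring; orthogonality on disjoint sets
kills every term except the one on `A ∩ B`. -/
theorem integral_incr_mul [SigmaFinite μ] {A B : Set U} (hA : A ∈ R) (hB : B ∈ R) {s t : ℝ≥0}
    (hst : s < t) (h k : H) : ∫ ω, incr M s t A h ω * incr M s t B k ω ∂P =
      ∫ p in Ioc s t ×ˢ (A ∩ B), (q p.1 p.2).form h k ∂(leb.prod μ) := by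
  have hR := hM.isSetRing
  have hAB := hR.inter_mem hA hB
  have hA' := hR.sdiff_mem hA hB
  have hB' := hR.sdiff_mem hB hA
  have eA : incr M s t A h = incr M s t (A ∩ B) h + incr M s t (A \ B) h := by
    rw [← hM.incr_union hAB hA' disjoint_sdiff_inter.symm, inter_union_sdiff]
  have eB : incr M s t B k = incr M s t (A ∩ B) k + incr M s t (B \ A) k := by
    rw [inter_comm] at hAB ⊢
    rw [← hM.incr_union hAB hB' disjoint_sdiff_inter.symm, inter_union_sdiff]
  have hi := fun {C D : Set U} (hC : C ∈ R) (hD : D ∈ R) =>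
    hM.integrable_incr_mul hC hD s t s t h k
  have e : (fun ω => incr M s t A h ω * incr M s t B k ω) =ᵐ[P] fun ω =>
      incr M s t (A ∩ B) h ω * incr M s t (A ∩ B) k ω
      + incr M s t (A ∩ B) h ω * incr M s t (B \ A) k ω
      + incr M s t (A \ B) h ω * incr M s t B k ω := by
    filter_upwards [AEEqFun.coeFn_add (incr M s t (A ∩ B) h) (incr M s t (A \ B) h),
      AEEqFun.coeFn_add (incr M s t (A ∩ B) k) (incr M s t (B \ A) k)] with ω h3 h4
    rw [← eA] at h3
    rw [← eB] at h4
    simp only [h3, h4, Pi.add_apply]; ring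
  have hi2 : Integrable (fun ω => incr M s t (A ∩ B) h ω * incr M s t (A ∩ B) k ω
      + incr M s t (A ∩ B) h ω * incr M s t (B \ A) k ω) P := (hi hAB hAB).add (hi hAB hB')
  rw [integral_congr_ae e, integral_add hi2 (hi hA' hB),
    integral_add (hi hAB hAB) (hi hAB hB'), hM.integral_incr_mul_self hAB hst,
    hM.integral_incr_mul_of_disjoint hAB hB' (disjoint_sdiff_right.mono_left inter_subset_left),
    hM.integral_incr_mul_of_disjoint hA' hB disjoint_sdiff_left, add_zero, add_zero]

/-- An increment after time `s` is orthogonal to the past of `s`. -/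
theorem integral_past_mul_incr [IsFiniteMeasure P] {A : Set U} (hA : A ∈ R) {s t : ℝ≥0}
    (hst : s < t) (k : H)
    {W : Ω → ℝ} (hW : AEStronglyMeasurable[ℱ s] W P) : ∫ ω, W ω * incr M s t A k ω ∂P = 0 := by
  obtain ⟨W', hW', hWW'⟩ := hW
  have h1 := (indep_of_indep_of_le_right (hM.indep s t hst A hA A hA k k)
    (measurable_iff_comap_le.1 hW'.measurable))
  have h2 := ((IndepFun_iff_Indep _ _ _).2 h1).comp (φ := Prod.fst) (ψ := id)
    measurable_fst measurable_id
  -- No integrability of `W` is needed: the product formula holds for independent variables in any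
  -- case, and the factor coming from the increment is zero.
  have h3 := h2.symm.integral_mul_eq_mul_integral (𝕜 := ℝ)
    (hW'.mono (ℱ.le s)).aestronglyMeasurable (hM.memLp_incr hA s t k).1
  have h4 : ∫ ω, W ω * incr M s t A k ω ∂P = ∫ ω, W' ω * incr M s t A k ω ∂P :=
    integral_congr_ae (hWW'.mono fun ω h => by simp only [h])
  rw [h4]
  refine h3.trans ?_
  have : ∫ ω, (Prod.fst ∘ fun ω => (incr M s t A k ω, incr M s t A k ω)) ω ∂P = 0 :=
    hM.integral_incr hA s t k
  rw [this, mul_zero]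

/-- The product of two increments is a function of the pair, so the joint independence of `(incr A
h, incr B k)` from the past is what lets the expectation factor. -/
theorem integral_indicator_incr_mul [SigmaFinite μ] {A B : Set U} (hA : A ∈ R)
    (hB : B ∈ R) {s t : ℝ≥0} (hst : s < t) (h k : H) {E : Set Ω} (hE : MeasurableSet[ℱ s] E) :
    ∫ ω, E.indicator 1 ω * (incr M s t A h ω * incr M s t B k ω) ∂P =
      P.real E * ∫ p in Ioc s t ×ˢ (A ∩ B), (q p.1 p.2).form h k ∂(leb.prod μ) := by
  have hE1 : StronglyMeasurable[ℱ s] (E.indicator (1 : Ω → ℝ)) :=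
    stronglyMeasurable_one.indicator hE
  have h1 := (indep_of_indep_of_le_right (hM.indep s t hst A hA B hB h k)
    (measurable_iff_comap_le.1 hE1.measurable))
  have h2 := ((IndepFun_iff_Indep _ _ _).2 h1).comp (φ := fun p : ℝ × ℝ => p.1 * p.2) (ψ := id)
    (measurable_fst.mul measurable_snd) measurable_id
  have h3 := h2.symm.integral_mul_eq_mul_integral (𝕜 := ℝ)
    (hE1.mono (ℱ.le s)).aestronglyMeasurable
    (hM.integrable_incr_mul hA hB s t s t h k).1
  refine h3.trans ?_
  rw [← hM.integral_incr_mul hA hB hst h k]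
  congr 1
  exact integral_indicator_one (ℱ.le s _ hE)

end IsCylMartingaleMeasure

end Increments

/-- The measure `P ⊗ dr ⊗ μ` on `Ω × [0,T] × U`. -/
def lambdaMeasure {Ω : Type uO} {m : MeasurableSpace Ω} {U : Type uU} [MeasurableSpace U]
    (P : Measure Ω) (μ : Measure U) (T : ℝ≥0) : Measure (Ω × ℝ≥0 × U) :=
  P.prod ((leb.restrict (Iic T)).prod μ)

/-! ### Covariance of two elementary integrals. -/

section PairIsometry

variable {H : Type uH} [NormedAddCommGroup H] [InnerProductSpace ℝ H]
variable {U : Type uU} [MeasurableSpace U]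
variable {Ω : Type uO} {m : MeasurableSpace Ω} {P : Measure Ω} {ℱ : Filtration ℝ≥0 m}
  {R : Set (Set U)} {μ : Measure U} {q : ℝ≥0 → U → HilbertianSeminorm H}
  {M : ℝ≥0 → Set U → H →ₗ[ℝ] (Ω →ₘ[P] ℝ)}

namespace IsCylMartingaleMeasure

variable (hM : IsCylMartingaleMeasure P ℱ R μ q M)
include hM

theorem integrable_indicator_incr_mul {A B : Set U} (hA : A ∈ R) (hB : B ∈ R)
    (s t s' t' : ℝ≥0) (h k : H) {E : Set Ω} (hE : MeasurableSet E) :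
    Integrable (fun ω => E.indicator 1 ω * (incr M s t A h ω * incr M s' t' B k ω)) P := by
  have := (hM.integrable_incr_mul hA hB s t s' t' h k).indicator hE
  refine this.congr (.of_forall fun ω => ?_)
  by_cases hω : ω ∈ E <;> simp [hω]

variable [IsFiniteMeasure P] [SigmaFinite μ]

/-- The part of the longer increment beyond `t` is orthogonal to the past of `t`, which contains
`1_E` and the shorter increment. Only the common interval remains. -/
theorem integral_indicator_incr_mul_of_le {A B : Set U} (hA : A ∈ R) (hB : B ∈ R)
    {s t t' : ℝ≥0} (hst : s < t) (htt : t ≤ t') (h k : H) {E : Set Ω}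
    (hE : MeasurableSet[ℱ s] E) :
    ∫ ω, E.indicator 1 ω * (incr M s t A h ω * incr M s t' B k ω) ∂P =
      P.real E * ∫ p in Ioc s t ×ˢ (A ∩ B), (q p.1 p.2).form h k ∂(leb.prod μ) := by
  rcases htt.eq_or_lt with rfl | htt
  · exact hM.integral_indicator_incr_mul hA hB hst h k hE
  have hE' := ℱ.le s _ hE
  have e : (fun ω => E.indicator 1 ω * (incr M s t A h ω * incr M s t' B k ω)) =ᵐ[P] fun ω =>
      E.indicator 1 ω * (incr M s t A h ω * incr M s t B k ω)
      + E.indicator 1 ω * (incr M s t A h ω * incr M t t' B k ω) := by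
    filter_upwards [AEEqFun.coeFn_add (incr M s t B k) (incr M t t' B k)] with ω h3
    rw [← incr_concat] at h3
    simp only [h3, Pi.add_apply]; ring
  rw [integral_congr_ae e, integral_add (hM.integrable_indicator_incr_mul hA hB _ _ _ _ _ _ hE')
    (hM.integrable_indicator_incr_mul hA hB _ _ _ _ _ _ hE'),
    hM.integral_indicator_incr_mul hA hB hst h k hE]
  simp_rw [← mul_assoc]
  rw [hM.integral_past_mul_incr hB htt k, add_zero]
  have h1 : StronglyMeasurable[ℱ t] (E.indicator (1 : Ω → ℝ)) :=
    stronglyMeasurable_one.indicator (ℱ.mono hst.le _ hE)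
  exact h1.aestronglyMeasurable.mul (hM.aestronglyMeasurable_incr hA hst.le h)

/-- Since `s ≤ s'`, both events are known at time `s'`. Cutting the first increment at `s'` leaves a
past piece, orthogonal to the second increment, and a piece that starts together with it. -/
theorem integral_indicator_mul_indicator_of_le {A B : Set U} (hA : A ∈ R) (hB : B ∈ R)
    {s t s' t' : ℝ≥0} (hst : s < t) (hst' : s' < t') (hss : s ≤ s') (h k : H) {E E' : Set Ω}
    (hE : MeasurableSet[ℱ s] E) (hE' : MeasurableSet[ℱ s'] E') :
    ∫ ω, E.indicator (incr M s t A h) ω * E'.indicator (incr M s' t' B k) ω ∂P =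
      P.real (E ∩ E') * ∫ p in (Ioc s t ∩ Ioc s' t') ×ˢ (A ∩ B),
        (q p.1 p.2).form h k ∂(leb.prod μ) := by
  have hEs := ℱ.mono hss _ hE
  have hEE : MeasurableSet[ℱ s'] (E ∩ E') := MeasurableSet.inter hEs hE'
  have h1 : StronglyMeasurable[ℱ s'] ((E ∩ E').indicator (1 : Ω → ℝ)) :=
    stronglyMeasurable_one.indicator hEE
  have hEE' := ℱ.le s' _ hEE
  have e0 : (fun ω => E.indicator (incr M s t A h) ω * E'.indicator (incr M s' t' B k) ω) =
      fun ω => (E ∩ E').indicator 1 ω * (incr M s t A h ω * incr M s' t' B k ω) := by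
    funext ω
    by_cases h1 : ω ∈ E <;> by_cases h2 : ω ∈ E' <;> simp [h1, h2]
  rw [e0]
  rcases le_or_gt t s' with hts | hts
  -- Disjoint intervals: the whole first factor belongs to the past of `s'`, and both sides vanish.
  · have e1 : Ioc s t ∩ Ioc s' t' = ∅ := by
      ext r; simp only [mem_inter_iff, mem_Ioc, mem_empty_iff_false, iff_false]
      rintro ⟨⟨-, h2⟩, h3, -⟩
      exact absurd (h2.trans hts) (not_le.2 h3)
    simp_rw [e1, empty_prod, setIntegral_empty, mul_zero, ← mul_assoc]
    exact hM.integral_past_mul_incr hB hst' k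
      (h1.aestronglyMeasurable.mul ((hM.aestronglyMeasurable_incr hA hst.le h).mono (ℱ.mono hts)))
  · have e : (fun ω => (E ∩ E').indicator 1 ω * (incr M s t A h ω * incr M s' t' B k ω)) =ᵐ[P]
        fun ω => (E ∩ E').indicator 1 ω * (incr M s s' A h ω * incr M s' t' B k ω)
        + (E ∩ E').indicator 1 ω * (incr M s' t A h ω * incr M s' t' B k ω) := by
      filter_upwards [AEEqFun.coeFn_add (incr M s s' A h) (incr M s' t A h)] with ω h3
      rw [← incr_concat] at h3
      simp only [h3, Pi.add_apply]; ring
    rw [integral_congr_ae e, integral_add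
      (hM.integrable_indicator_incr_mul hA hB _ _ _ _ _ _ hEE')
      (hM.integrable_indicator_incr_mul hA hB _ _ _ _ _ _ hEE')]
    have e2 : ∫ ω, (E ∩ E').indicator 1 ω * (incr M s s' A h ω * incr M s' t' B k ω) ∂P = 0 := by
      simp_rw [← mul_assoc]
      exact hM.integral_past_mul_incr hB hst' k
        (h1.aestronglyMeasurable.mul (hM.aestronglyMeasurable_incr hA hss h))
    have e3 : Ioc s t ∩ Ioc s' t' = Ioc s' (min t t') := by
      rw [Ioc_inter_Ioc, sup_eq_right.2 hss]
    rw [e2, zero_add, e3]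
    rcases le_total t t' with htt | htt
    · rw [min_eq_left htt, hM.integral_indicator_incr_mul_of_le hA hB hts htt h k hEE]
    -- Here the second increment is the shorter one, so the two exchange roles and symmetry of the
    -- form restores the order.
    · rw [min_eq_right htt, inter_comm A B]
      simp_rw [mul_comm (incr M s' t A h _)]
      rw [hM.integral_indicator_incr_mul_of_le hB hA hst' htt k h hEE]
      simp_rw [fun p : ℝ≥0 × U => (q p.1 p.2).form_symm k h]

theorem integral_indicator_mul_indicator {A B : Set U} (hA : A ∈ R) (hB : B ∈ R)
    {s t s' t' : ℝ≥0} (hst : s < t) (hst' : s' < t') (h k : H) {E E' : Set Ω}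
    (hE : MeasurableSet[ℱ s] E) (hE' : MeasurableSet[ℱ s'] E') :
    ∫ ω, E.indicator (incr M s t A h) ω * E'.indicator (incr M s' t' B k) ω ∂P =
      P.real (E ∩ E') * ∫ p in (Ioc s t ∩ Ioc s' t') ×ˢ (A ∩ B),
        (q p.1 p.2).form h k ∂(leb.prod μ) := by
  rcases le_total s s' with hss | hss
  · exact hM.integral_indicator_mul_indicator_of_le hA hB hst hst' hss h k hE hE'
  · have := hM.integral_indicator_mul_indicator_of_le hB hA hst' hst hss k h hE' hE
    rw [inter_comm E, inter_comm (Ioc s t), inter_comm A]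
    simp_rw [mul_comm (E.indicator _ _), this, fun p : ℝ≥0 × U => (q p.1 p.2).form_symm k h]

end IsCylMartingaleMeasure

end PairIsometry

/-! ### The scalar isometry for finite sums. -/

section SimpleIsometry

variable {H : Type uH} [NormedAddCommGroup H] [InnerProductSpace ℝ H] [CompleteSpace H]
variable {G : Type uG} [NormedAddCommGroup G] [InnerProductSpace ℝ G]
variable {U : Type uU} [MeasurableSpace U]
variable {Ω : Type uO} {m : MeasurableSpace Ω} {P : Measure Ω} {ℱ : Filtration ℝ≥0 m}
  {R : Set (Set U)} {μ : Measure U} {q : ℝ≥0 → U → HilbertianSeminorm H}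
  {M : ℝ≥0 → Set U → H →ₗ[ℝ] (Ω →ₘ[P] ℝ)}

/-- The scalar weight `1_F(ω) 1_{(s,t]}(r) 1_A(u)` of an elementary integrand. -/
def Elementary.weight {T : ℝ≥0} (e : Elementary H G ℱ R T) (p : Ω × ℝ≥0 × U) : ℝ :=
  e.F.indicator 1 p.1 * (Ioc e.s e.t ×ˢ e.A).indicator 1 p.2

variable (hM : IsCylMartingaleMeasure P ℱ R μ q M) {T : ℝ≥0}
include hM

theorem Elementary.measurable_weight (e : Elementary H G ℱ R T) :
    Measurable[ℱ.predictable.prod inferInstance]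
      fun p : (ℝ≥0 × Ω) × U => e.weight (p.1.2, p.1.1, p.2) := by
  have hs : MeasurableSet[ℱ.predictable.prod inferInstance] ((Ioc e.s e.t ×ˢ e.F) ×ˢ e.A) :=
    @MeasurableSet.prod _ _ ℱ.predictable _ _ _
      (measurableSet_predictable_Ioc_prod _ _ e.measurable_F) (hM.measurableSet e.mem_A)
  have h1 : Measurable[ℱ.predictable.prod inferInstance]
      (((Ioc e.s e.t ×ˢ e.F) ×ˢ e.A).indicator (1 : (ℝ≥0 × Ω) × U → ℝ)) :=
    measurable_const.indicator hs
  convert h1 using 1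
  funext p
  by_cases h1 : p.1.1 ∈ Ioc e.s e.t <;> by_cases h2 : p.1.2 ∈ e.F <;> by_cases h3 : p.2 ∈ e.A <;>
    simp [Elementary.weight, Set.indicator, Set.mem_prod, h1, h2, h3]

variable [IsFiniteMeasure P] [SigmaFinite μ]

/-- The product of the weights is the indicator of a rectangle, so its integral factors into the
probability of `F ∩ F'` times a space-time integral, which is exactly the covariance of the two
elementary integrals. -/
theorem Elementary.integrable_weight_mul (e e' : Elementary H G ℱ R T) (h k : H) :
    Integrable (fun p => e.weight p * e'.weight p * (q p.2.1 p.2.2).form h k)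
      (lambdaMeasure P μ T) ∧
    ∫ p, e.weight p * e'.weight p * (q p.2.1 p.2.2).form h k ∂(lambdaMeasure P μ T) =
      ∫ ω, e.F.indicator (incr M e.s e.t e.A h) ω * e'.F.indicator (incr M e'.s e'.t e'.A k) ω ∂P := by
  set D := (Ioc e.s e.t ∩ Ioc e'.s e'.t) ×ˢ (e.A ∩ e'.A) with hD
  have hDm : MeasurableSet D := (measurableSet_Ioc.inter measurableSet_Ioc).prod
    ((hM.measurableSet e.mem_A).inter (hM.measurableSet e'.mem_A))
  have hE : MeasurableSet (e.F ∩ e'.F) :=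
    (ℱ.le _ _ e.measurable_F).inter (ℱ.le _ _ e'.measurable_F)
  -- Elementary data live on `[0,T]`, so restricting time to `Iic T` changes nothing on `D`.
  have hDT : D ⊆ Iic T ×ˢ univ := fun p hp => ⟨hp.1.1.2.trans e.t_le, trivial⟩
  have er : ((leb.restrict (Iic T)).prod μ).restrict D = (leb.prod μ).restrict D := by
    have : (leb.restrict (Iic T)).prod μ = (leb.prod μ).restrict (Iic T ×ˢ univ) := by
      rw [← Measure.prod_restrict, Measure.restrict_univ]
    rw [this, Measure.restrict_restrict hDm, inter_eq_left.2 hDT]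
  have ew : (fun p : Ω × ℝ≥0 × U => e.weight p * e'.weight p * (q p.2.1 p.2.2).form h k) = fun p =>
      (e.F ∩ e'.F).indicator 1 p.1 *
        D.indicator (fun p : ℝ≥0 × U => (q p.1 p.2).form h k) p.2 := by
    funext ⟨ω, r, u⟩
    by_cases h1 : ω ∈ e.F <;> by_cases h2 : ω ∈ e'.F <;> by_cases h3 : r ∈ Ioc e.s e.t <;>
    by_cases h4 : r ∈ Ioc e'.s e'.t <;> by_cases h5 : u ∈ e.A <;> by_cases h6 : u ∈ e'.A <;>
    simp only [Elementary.weight, Set.indicator, hD, Set.mem_prod, mem_inter_iff, h1, h2, h3, h4,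
      h5, h6] <;> simp
  have hint : IntegrableOn (fun p : ℝ≥0 × U => (q p.1 p.2).form h k) D (leb.prod μ) :=
    (hM.integrableOn_form e.mem_A e.s e.t h k).mono_set
      (prod_mono inter_subset_left inter_subset_left)
  rw [ew]
  constructor
  · refine Integrable.mul_prod (integrable_const (1 : ℝ) |>.indicator hE) ?_
    rw [integrable_indicator_iff hDm, IntegrableOn, er]
    exact hint
  · rw [lambdaMeasure, integral_prod_mul, integral_indicator_one hE, integral_indicator hDm, er,
      hM.integral_indicator_mul_indicator e.mem_A e'.mem_A e.s_lt e'.s_lt h k e.measurable_F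
        e'.measurable_F]

theorem integral_sq_sum_elementary {n : ℕ} (Ψ : Fin n → Elementary H G ℱ R T) (h : Fin n → H) :
    Integrable (fun p => (q p.2.1 p.2.2).form (∑ i, (Ψ i).weight p • h i)
      (∑ i, (Ψ i).weight p • h i)) (lambdaMeasure P μ T) ∧
    ∫ p, (q p.2.1 p.2.2).form (∑ i, (Ψ i).weight p • h i)
      (∑ i, (Ψ i).weight p • h i) ∂(lambdaMeasure P μ T) =
    ∫ ω, (∑ i, (Ψ i).F.indicator (incr M (Ψ i).s (Ψ i).t (Ψ i).A (h i)) ω) ^ 2 ∂P := by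
  have e1 : (fun p : Ω × ℝ≥0 × U => (q p.2.1 p.2.2).form (∑ i, (Ψ i).weight p • h i)
      (∑ i, (Ψ i).weight p • h i)) = fun p =>
      ∑ i, ∑ j, (Ψ i).weight p * (Ψ j).weight p * (q p.2.1 p.2.2).form (h i) (h j) := by
    funext p
    simp only [map_sum, LinearMap.sum_apply, map_smul, LinearMap.smul_apply, smul_eq_mul,
      Finset.mul_sum, mul_assoc]
    rw [Finset.sum_comm]
    refine Finset.sum_congr rfl fun i _ => Finset.sum_congr rfl fun j _ => ?_
    ring
  have hi := fun i j => (Elementary.integrable_weight_mul hM (Ψ i) (Ψ j) (h i) (h j))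
  rw [e1]
  refine ⟨integrable_finsetSum _ fun i _ => integrable_finsetSum _ fun j _ => (hi i j).1, ?_⟩
  rw [integral_finsetSum _ fun i _ => integrable_finsetSum _ fun j _ => (hi i j).1]
  simp_rw [integral_finsetSum _ fun j _ => (hi _ j).1, (hi _ _).2, sq, Finset.sum_mul_sum]
  have hI : ∀ i j, Integrable (fun ω =>
      (Ψ i).F.indicator (incr M (Ψ i).s (Ψ i).t (Ψ i).A (h i)) ω *
      (Ψ j).F.indicator (incr M (Ψ j).s (Ψ j).t (Ψ j).A (h j)) ω) P := fun i j =>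
    ((hM.memLp_incr (Ψ i).mem_A _ _ _).indicator (ℱ.le _ _ (Ψ i).measurable_F)).integrable_mul
    ((hM.memLp_incr (Ψ j).mem_A _ _ _).indicator (ℱ.le _ _ (Ψ j).measurable_F))
  rw [integral_finsetSum _ fun i _ => integrable_finsetSum _ fun j _ => hI i j]
  simp_rw [integral_finsetSum _ fun j _ => hI _ j]

end SimpleIsometry

/-! ### Predictable operator fields and the norm of Λ² as one integral over the product measure. -/

section PredictableFields

variable {H : Type uH} [NormedAddCommGroup H] [InnerProductSpace ℝ H]
variable {G : Type uG} [NormedAddCommGroup G] [InnerProductSpace ℝ G] [CompleteSpace G]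
variable {U : Type uU} [MeasurableSpace U]
variable {Ω : Type uO} {m : MeasurableSpace Ω} {P : Measure Ω} {ℱ : Filtration ℝ≥0 m}
  {R : Set (Set U)} {μ : Measure U} {q : ℝ≥0 → U → HilbertianSeminorm H}

theorem measurable_fst_predictable (ℱ : Filtration ℝ≥0 m) :
    Measurable[ℱ.predictable] (Prod.fst : ℝ≥0 × Ω → ℝ≥0) := by
  refine measurable_of_Ioi fun a => ?_
  have := measurableSet_predictable_Ioi_prod (𝓕 := ℱ) (i := a) MeasurableSet.univ
  rwa [prod_univ] at this

theorem predictable_le (ℱ : Filtration ℝ≥0 m) : ℱ.predictable ≤ Prod.instMeasurableSpace := by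
  refine measurableSpace_le_predictable_of_measurableSet (fun A hA => ?_) fun i A hA => ?_
  · exact (measurableSet_singleton _).prod (ℱ.le _ _ hA)
  · exact measurableSet_Ioi.prod (ℱ.le _ _ hA)

theorem measurable_time_space (ℱ : Filtration ℝ≥0 m) :
    Measurable[ℱ.predictable.prod inferInstance] fun p : (ℝ≥0 × Ω) × U => (p.1.1, p.2) :=
  ((measurable_fst_predictable ℱ).comp (@measurable_fst _ _ ℱ.predictable _)).prodMk
    (@measurable_snd _ _ ℱ.predictable _)

/-- Predictability is stated on `(time × Ω) × U`, whereas `lambdaMeasure` lives on `Ω × time × U`.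
-/
theorem measurable_reorder (ℱ : Filtration ℝ≥0 m) :
    @Measurable (Ω × ℝ≥0 × U) ((ℝ≥0 × Ω) × U) _ (ℱ.predictable.prod inferInstance)
      fun p => ((p.2.1, p.1), p.2.2) := by
  have h : Measurable fun p : Ω × ℝ≥0 × U => ((p.2.1, p.1), p.2.2) := by fun_prop
  exact h.mono le_rfl (sup_le_sup (MeasurableSpace.comap_mono (predictable_le ℱ)) le_rfl)

/-- Predictability of an operator field on `[0,T] × Ω × U`. -/
def PredField (ℱ : Filtration ℝ≥0 m) (q : ℝ≥0 → U → HilbertianSeminorm H) (T : ℝ≥0)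
    (Φ : (r : ℝ≥0) → Ω → (u : U) → (q r u).Space →L[ℝ] G) : Prop :=
  ∀ (h : H) (g : G), Measurable[ℱ.predictable.prod inferInstance]
    fun p : (ℝ≥0 × Ω) × U => (Iic T).indicator (fun r =>
      ⟪ContinuousLinearMap.adjoint (Φ r p.1.2 p.2) g, (q r p.2).incl h⟫_ℝ) p.1.1

namespace PredField

variable {T : ℝ≥0} {Φ Ψ : (r : ℝ≥0) → Ω → (u : U) → (q r u).Space →L[ℝ] G}

theorem add (hΦ : PredField ℱ q T Φ) (hΨ : PredField ℱ q T Ψ) :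
    PredField ℱ q T fun r ω u => Φ r ω u + Ψ r ω u := fun h g => by
  have := Measurable.add (hΦ h g) (hΨ h g)
  convert this using 1
  funext p
  by_cases hp : p.1.1 ≤ T <;> simp [Set.indicator, hp, inner_add_left]

theorem neg (hΦ : PredField ℱ q T Φ) : PredField ℱ q T fun r ω u => -Φ r ω u := fun h g => by
  have := Measurable.neg (hΦ h g)
  convert this using 1
  funext p
  by_cases hp : p.1.1 ≤ T <;> simp [Set.indicator, hp, inner_neg_left]

theorem sub (hΦ : PredField ℱ q T Φ) (hΨ : PredField ℱ q T Ψ) :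
    PredField ℱ q T fun r ω u => Φ r ω u - Ψ r ω u := by
  simpa only [sub_eq_add_neg] using hΦ.add hΨ.neg

open Classical in
theorem restrict (hΦ : PredField ℱ q T Φ) {C : Set ((ℝ≥0 × Ω) × U)}
    (hC : MeasurableSet[ℱ.predictable.prod inferInstance] C) :
    PredField ℱ q T fun r ω u => if ((r, ω), u) ∈ C then Φ r ω u else 0 := fun h g => by
  have := (hΦ h g).indicator hC
  convert this using 1
  funext p
  by_cases hp : p.1.1 ≤ T <;> by_cases hpC : p ∈ C <;> simp [Set.indicator, hp, hpC]

variable [TopologicalSpace.SeparableSpace H] [TopologicalSpace.SeparableSpace G]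

theorem measurable_hsNormSq (hq : ∀ h₁ h₂, Measurable fun p : ℝ≥0 × U => (q p.1 p.2).form h₁ h₂)
    (hΦ : PredField ℱ q T Φ) : Measurable[ℱ.predictable.prod inferInstance]
      fun p : (ℝ≥0 × Ω) × U => (Iic T).indicator (fun r => hsNormSq (Φ r p.1.2 p.2)) p.1.1 := by
  classical
  have := CylSPDE.measurable_hsNormSq (mX := ℱ.predictable.prod inferInstance)
    (fun p : (ℝ≥0 × Ω) × U => q p.1.1 p.2)
    (fun h₁ h₂ => (hq h₁ h₂).comp (measurable_time_space ℱ))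
    (fun p => if p.1.1 ≤ T then Φ p.1.1 p.1.2 p.2 else 0) (fun h g => by
      convert hΦ h g using 1
      funext p
      by_cases hp : p.1.1 ≤ T <;> simp [Set.indicator, hp])
  convert this using 1
  funext p
  by_cases hp : p.1.1 ≤ T <;> simp [Set.indicator, hp]

theorem aemeasurable_lambda [SFinite P] [SigmaFinite μ]
    (hq : ∀ h₁ h₂, Measurable fun p : ℝ≥0 × U => (q p.1 p.2).form h₁ h₂)
    (hΦ : PredField ℱ q T Φ) :
    AEMeasurable (fun p => hsNormSq (Φ p.2.1 p.1 p.2.2)) (lambdaMeasure P μ T) := by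
  have h := ((hΦ.measurable_hsNormSq hq).comp (measurable_reorder ℱ))
  refine ⟨_, h, ?_⟩
  have h1 : ∀ᵐ p ∂(leb.restrict (Iic T)).prod μ, p.1 ≤ T :=
    Measure.quasiMeasurePreserving_fst.ae (ae_restrict_mem measurableSet_Iic)
  have h2 : ∀ᵐ p ∂lambdaMeasure P μ T, p.2.1 ≤ T :=
    Measure.quasiMeasurePreserving_snd.ae h1
  filter_upwards [h2] with p hp
  simp [Set.indicator, hp]

theorem lambdaNormSq_eq [SFinite P] [SigmaFinite μ]
    (hq : ∀ h₁ h₂, Measurable fun p : ℝ≥0 × U => (q p.1 p.2).form h₁ h₂)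
    (hΦ : PredField ℱ q T Φ) :
    lambdaNormSq P μ q T Φ = ∫⁻ p, hsNormSq (Φ p.2.1 p.1 p.2.2) ∂(lambdaMeasure P μ T) := by
  have h : Measurable fun p : Ω × ℝ≥0 × U =>
      (Iic T).indicator (fun r => hsNormSq (Φ r p.1 p.2.2)) p.2.1 :=
    (hΦ.measurable_hsNormSq hq).comp (measurable_reorder ℱ)
  have h1 : ∀ᵐ p ∂(leb.restrict (Iic T)).prod μ, p.1 ≤ T :=
    Measure.quasiMeasurePreserving_fst.ae (ae_restrict_mem measurableSet_Iic)
  have h2 : ∀ᵐ p ∂lambdaMeasure P μ T, p.2.1 ≤ T :=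
    Measure.quasiMeasurePreserving_snd.ae h1
  have e : (fun p => hsNormSq (Φ p.2.1 p.1 p.2.2)) =ᵐ[lambdaMeasure P μ T]
      fun p : Ω × ℝ≥0 × U => (Iic T).indicator (fun r => hsNormSq (Φ r p.1 p.2.2)) p.2.1 := by
    filter_upwards [h2] with p hp
    simp [Set.indicator, hp]
  rw [lintegral_congr_ae e, lambdaMeasure, lintegral_prod _ h.aemeasurable, lambdaNormSq]
  refine lintegral_congr fun ω => ?_
  have hω : Measurable fun p : ℝ≥0 × U =>
      (Iic T).indicator (fun r => hsNormSq (Φ r ω p.2)) p.1 := h.comp measurable_prodMk_left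
  rw [lintegral_prod _ hω.aemeasurable]
  refine setLIntegral_congr_fun measurableSet_Iic fun r hr => ?_
  simp only [mem_Iic] at hr
  simp [Set.indicator, hr]

theorem lambdaNormSq_add_le [SFinite P] [SigmaFinite μ]
    (hq : ∀ h₁ h₂, Measurable fun p : ℝ≥0 × U => (q p.1 p.2).form h₁ h₂)
    (hΦ : PredField ℱ q T Φ) (hΨ : PredField ℱ q T Ψ) :
    lambdaNormSq P μ q T (fun r ω u => Φ r ω u + Ψ r ω u) ≤
      2 * lambdaNormSq P μ q T Φ + 2 * lambdaNormSq P μ q T Ψ := by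
  rw [(hΦ.add hΨ).lambdaNormSq_eq hq, hΦ.lambdaNormSq_eq hq, hΨ.lambdaNormSq_eq hq,
    ← lintegral_const_mul' _ _ (by simp), ← lintegral_const_mul' _ _ (by simp),
    ← lintegral_add_left' ((hΦ.aemeasurable_lambda hq).const_mul _)]
  exact lintegral_mono fun p => hsNormSq_add_le _ _

end PredField

omit [CompleteSpace G] in
theorem lambdaNormSq_neg {T : ℝ≥0} (Φ : (r : ℝ≥0) → Ω → (u : U) → (q r u).Space →L[ℝ] G) :
    lambdaNormSq P μ q T (fun r ω u => -Φ r ω u) = lambdaNormSq P μ q T Φ := by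
  simp [lambdaNormSq]

omit [CompleteSpace G] in
theorem lambdaNormSq_sub_comm {T : ℝ≥0}
    (Φ Ψ : (r : ℝ≥0) → Ω → (u : U) → (q r u).Space →L[ℝ] G) :
    lambdaNormSq P μ q T (fun r ω u => Φ r ω u - Ψ r ω u) =
      lambdaNormSq P μ q T (fun r ω u => Ψ r ω u - Φ r ω u) := by
  simp only [lambdaNormSq, hsNormSq_sub_comm (Φ _ _ _)]

end PredictableFields

/-! ### The Itô isometry for simple integrands with values in `G`. -/

section SimpleIntegrals

open ContinuousLinearMap

variable {H : Type uH} [NormedAddCommGroup H] [InnerProductSpace ℝ H] [CompleteSpace H]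
variable {G : Type uG} [NormedAddCommGroup G] [InnerProductSpace ℝ G] [CompleteSpace G]
variable {U : Type uU} [MeasurableSpace U]
variable {Ω : Type uO} {m : MeasurableSpace Ω} {P : Measure Ω} {ℱ : Filtration ℝ≥0 m}
  {R : Set (Set U)} {μ : Measure U} {q : ℝ≥0 → U → HilbertianSeminorm H}
  {M : ℝ≥0 → Set U → H →ₗ[ℝ] (Ω →ₘ[P] ℝ)} {T : ℝ≥0}

omit [CompleteSpace G] [MeasurableSpace U] in
theorem Elementary.integrand_eq (e : Elementary H G ℱ R T) (r : ℝ≥0) (ω : Ω) (u : U) :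
    e.integrand q r ω u = e.weight (ω, r, u) • (e.S ∘L adjoint (q r u).incl) := by
  classical
  by_cases h1 : r ∈ Ioc e.s e.t <;> by_cases h2 : ω ∈ e.F <;> by_cases h3 : u ∈ e.A <;>
    simp [Elementary.weight, Elementary.integrand, Set.indicator, Set.mem_prod, h1, h2, h3]

omit [MeasurableSpace U] in
theorem adjoint_sum_integrand {n : ℕ} (Ψ : Fin n → Elementary H G ℱ R T) (r : ℝ≥0) (ω : Ω) (u : U)
    (g : G) : adjoint (∑ i, (Ψ i).integrand q r ω u) g =
      (q r u).incl (∑ i, (Ψ i).weight (ω, r, u) • adjoint (Ψ i).S g) := by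
  simp [Elementary.integrand_eq, map_sum, adjoint_comp]

variable (hM : IsCylMartingaleMeasure P ℱ R μ q M)
include hM

theorem predField_simple {n : ℕ} (Ψ : Fin n → Elementary H G ℱ R T) :
    PredField ℱ q T fun r ω u => ∑ i, (Ψ i).integrand q r ω u := fun h g => by
  have h1 : Measurable[ℱ.predictable.prod inferInstance] fun p : (ℝ≥0 × Ω) × U =>
      ∑ i, (Ψ i).weight (p.1.2, p.1.1, p.2) * (q p.1.1 p.2).form (adjoint (Ψ i).S g) h :=
    Finset.measurable_sum _ fun i _ => (Elementary.measurable_weight hM (Ψ i)).mul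
      ((hM.form_measurable _ _).comp (measurable_time_space ℱ))
  have hs : MeasurableSet[ℱ.predictable.prod inferInstance] {p : (ℝ≥0 × Ω) × U | p.1.1 ≤ T} :=
    (measurable_fst.comp (measurable_time_space ℱ)) measurableSet_Iic
  convert h1.indicator hs using 1
  funext p
  by_cases hp : p.1.1 ≤ T
  · simp only [Set.indicator, mem_Iic, hp, mem_ofPred_eq, if_true, adjoint_sum_integrand,
      HilbertianSeminorm.inner_incl]
    simp
  · simp [Set.indicator, hp]

variable [IsFiniteMeasure P] [SigmaFinite μ]
  [TopologicalSpace.SeparableSpace H] [TopologicalSpace.SeparableSpace G]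

/-- The Itô isometry for simple integrands. -/
theorem lintegral_sq_simpleIntegral {n : ℕ} {Ψ : Fin n → Elementary H G ℱ R T} {Z : Ω → G}
    (hZ : IsSimpleIntegral M Ψ Z) :
    ∫⁻ ω, ‖Z ω‖ₑ ^ 2 ∂P =
      lambdaNormSq P μ q T fun r ω u => ∑ i, (Ψ i).integrand q r ω u := by
  obtain ⟨w, b, hw⟩ := exists_countable_hilbertBasis G
  have : Countable w := hw
  obtain ⟨Y, hY, hZY⟩ := hZ
  have hinner : ∀ l, ∀ᵐ ω ∂P, ⟪b l, Z ω⟫_ℝ = ∑ i, (Ψ i).F.indicator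
      (incr M (Ψ i).s (Ψ i).t (Ψ i).A (adjoint (Ψ i).S (b l))) ω := fun l => by
    have h1 : ∀ᵐ ω ∂P, ∀ i, ⟪Y i ω, b l⟫_ℝ =
        incr M (Ψ i).s (Ψ i).t (Ψ i).A (adjoint (Ψ i).S (b l)) ω :=
      ae_all_iff.2 fun i => (hY i).2 (b l)
    filter_upwards [hZY, h1] with ω h2 h3
    rw [h2, inner_sum]
    refine Finset.sum_congr rfl fun i _ => ?_
    by_cases hω : ω ∈ (Ψ i).F
    · simp only [Set.indicator_of_mem hω, ← h3, real_inner_comm]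
    · simp [hω]
  have hZm : AEStronglyMeasurable Z P := by
    refine AEStronglyMeasurable.congr ?_ (EventuallyEq.symm hZY)
    refine Finset.aestronglyMeasurable_fun_sum _ fun i _ => ?_
    exact (hY i).1.indicator (ℱ.le _ _ (Ψ i).measurable_F)
  -- Parseval in `G` on both sides: the coordinate of `Z` along `b l` is a scalar simple integral
  -- with vectors `Sᵢ* (b l)`, and summing `‖Φ* (b l)‖²` over `l` rebuilds the Hilbert–Schmidt norm.
  calc ∫⁻ ω, ‖Z ω‖ₑ ^ 2 ∂P = ∑' l, ∫⁻ ω, ‖⟪b l, Z ω⟫_ℝ‖ₑ ^ 2 ∂P := by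
        simp_rw [enorm_sq_eq_tsum b]
        rw [lintegral_tsum]
        exact fun l => ((hZm.const_inner).enorm).pow_const 2
    _ = ∑' l, ENNReal.ofReal (∫ ω, (∑ i, (Ψ i).F.indicator
          (incr M (Ψ i).s (Ψ i).t (Ψ i).A (adjoint (Ψ i).S (b l))) ω) ^ 2 ∂P) := by
        refine tsum_congr fun l => ?_
        rw [ofReal_integral_eq_lintegral_ofReal _ (.of_forall fun _ => sq_nonneg _)]
        · refine lintegral_congr_ae ?_
          filter_upwards [hinner l] with ω hω
          rw [hω, ← sq_abs, ← Real.norm_eq_abs, ENNReal.ofReal_pow (norm_nonneg _), ofReal_norm]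
        · exact (memLp_finsetSum _ fun i _ => (hM.memLp_incr (Ψ i).mem_A _ _ _).indicator
            (ℱ.le _ _ (Ψ i).measurable_F)).integrable_sq
    _ = ∑' l, ∫⁻ p, ‖adjoint (∑ i, (Ψ i).integrand q p.2.1 p.1 p.2.2) (b l)‖ₑ ^ 2
          ∂(lambdaMeasure P μ T) := by
        refine tsum_congr fun l => ?_
        obtain ⟨h1, h2⟩ := integral_sq_sum_elementary hM Ψ fun i => adjoint (Ψ i).S (b l)
        rw [← h2, ofReal_integral_eq_lintegral_ofReal h1
          (.of_forall fun p => (q p.2.1 p.2.2).form_nonneg _)]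
        refine lintegral_congr fun p => ?_
        rw [adjoint_sum_integrand, ← HilbertianSeminorm.inner_incl, real_inner_self_eq_norm_sq,
          ENNReal.ofReal_pow (norm_nonneg _), ofReal_norm]
    _ = ∫⁻ p, hsNormSq (∑ i, (Ψ i).integrand q p.2.1 p.1 p.2.2) ∂(lambdaMeasure P μ T) := by
        simp_rw [hsNormSq_eq_tsum_adjoint b]
        rw [lintegral_tsum]
        intro l
        obtain ⟨h1, -⟩ := integral_sq_sum_elementary hM Ψ fun i => adjoint (Ψ i).S (b l)
        refine h1.1.aemeasurable.ennreal_ofReal.congr (.of_forall fun p => ?_)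
        simp only
        rw [adjoint_sum_integrand, ← HilbertianSeminorm.inner_incl, real_inner_self_eq_norm_sq,
          ENNReal.ofReal_pow (norm_nonneg _), ofReal_norm]
    _ = _ := ((predField_simple hM Ψ).lambdaNormSq_eq hM.form_measurable).symm

end SimpleIntegrals

/-! ### Measurable selection of a minimising index. -/

section Argmin

/-- The first index at which the minimum of `e 0, …, e N` is attained. -/
def argmin (e : ℕ → ℝ≥0∞) : ℕ → ℕ
  | 0 => 0
  | N + 1 => if e (N + 1) < e (argmin e N) then N + 1 else argmin e N

theorem argmin_le (e : ℕ → ℝ≥0∞) (N : ℕ) : argmin e N ≤ N := by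
  induction N with
  | zero => simp [argmin]
  | succ N ih => rw [argmin]; split_ifs <;> omega

theorem apply_argmin_succ (e : ℕ → ℝ≥0∞) (N : ℕ) :
    e (argmin e (N + 1)) = min (e (N + 1)) (e (argmin e N)) := by
  rw [argmin]
  split_ifs with h
  · rw [min_eq_left h.le]
  · rw [min_eq_right (not_lt.1 h)]

theorem apply_argmin_le (e : ℕ → ℝ≥0∞) {n N : ℕ} (hn : n ≤ N) : e (argmin e N) ≤ e n := by
  induction N with
  | zero => simp [argmin, Nat.le_zero.1 hn]
  | succ N ih =>
    refine (apply_argmin_succ e N).trans_le ?_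
    rcases Nat.le_succ_iff.1 hn with h | rfl
    · exact (min_le_right _ _).trans (ih h)
    · exact min_le_left _ _

theorem measurable_apply_argmin {X : Type*} {mX : MeasurableSpace X} {e : X → ℕ → ℝ≥0∞}
    (he : ∀ n, Measurable fun x => e x n) (N : ℕ) : Measurable fun x => e x (argmin (e x) N) := by
  induction N with
  | zero => exact he 0
  | succ N ih => simp_rw [apply_argmin_succ]; exact (he _).min ih

theorem measurable_argmin {X : Type*} {mX : MeasurableSpace X} {e : X → ℕ → ℝ≥0∞}
    (he : ∀ n, Measurable fun x => e x n) (N : ℕ) : Measurable fun x => argmin (e x) N := by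
  induction N with
  | zero => exact measurable_const
  | succ N ih =>
    exact Measurable.ite (measurableSet_lt (he _) (measurable_apply_argmin he N))
      measurable_const ih

end Argmin

/-! ### Closure properties of the fields approximable by simple integrands. -/

section Approximation

open ContinuousLinearMap InnerProductSpace

variable {H : Type uH} [NormedAddCommGroup H] [InnerProductSpace ℝ H] [CompleteSpace H]
variable {G : Type uG} [NormedAddCommGroup G] [InnerProductSpace ℝ G] [CompleteSpace G]
variable {U : Type uU} [MeasurableSpace U]
variable {Ω : Type uO} {m : MeasurableSpace Ω} {P : Measure Ω} {ℱ : Filtration ℝ≥0 m}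
  {R : Set (Set U)} {μ : Measure U} {q : ℝ≥0 → U → HilbertianSeminorm H}
  {M : ℝ≥0 → Set U → H →ₗ[ℝ] (Ω →ₘ[P] ℝ)} {T : ℝ≥0}

/-- The elementary datum with the opposite operator. -/
def Elementary.neg (e : Elementary H G ℱ R T) : Elementary H G ℱ R T :=
  { e with
    S := -e.S
    hilbertSchmidt := by simpa [IsHilbertSchmidt] using e.hilbertSchmidt }

omit [CompleteSpace G] [MeasurableSpace U] in
theorem Elementary.integrand_neg (e : Elementary H G ℱ R T) (r : ℝ≥0) (ω : Ω) (u : U) :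
    e.neg.integrand q r ω u = -e.integrand q r ω u := by
  by_cases h : r ∈ Ioc e.s e.t ∧ ω ∈ e.F ∧ u ∈ e.A
  · rw [Elementary.integrand, Elementary.integrand, if_pos h, if_pos (by exact h)]
    exact ContinuousLinearMap.neg_comp _ _
  · rw [Elementary.integrand, Elementary.integrand, if_neg h, if_neg (by exact h), neg_zero]

/-- Fields on `[0,T]` that are limits in `Λ²` of simple integrands built on rank one operators. -/
def SimplyApproximable (P : Measure Ω) (ℱ : Filtration ℝ≥0 m) (R : Set (Set U)) (μ : Measure U)
    (q : ℝ≥0 → U → HilbertianSeminorm H) (T : ℝ≥0)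
    (Φ : (r : ℝ≥0) → Ω → (u : U) → (q r u).Space →L[ℝ] G) : Prop :=
  ∀ ε : ℝ≥0∞, 0 < ε → ∃ (n : ℕ) (Ψ : Fin n → Elementary H G ℱ R T),
    (∀ i, ∃ g h, (Ψ i).S = rankOne ℝ g h) ∧
    lambdaNormSq P μ q T (fun r ω u => (∑ i, (Ψ i).integrand q r ω u) - Φ r ω u) < ε

namespace SimplyApproximable

variable {Φ Φ' : (r : ℝ≥0) → Ω → (u : U) → (q r u).Space →L[ℝ] G}

omit [CompleteSpace G] in
theorem zero : SimplyApproximable P ℱ R μ q T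
    (fun _ _ _ => 0 : (r : ℝ≥0) → Ω → (u : U) → (q r u).Space →L[ℝ] G) := fun ε hε =>
  ⟨0, Fin.elim0, fun i => i.elim0, by simpa [lambdaNormSq] using hε⟩

omit [CompleteSpace G] in
theorem of_elementary (e : Elementary H G ℱ R T) (he : ∃ g h, e.S = rankOne ℝ g h) :
    SimplyApproximable P ℱ R μ q T (e.integrand q) := fun ε hε =>
  ⟨1, fun _ => e, fun _ => he, by simpa [lambdaNormSq] using hε⟩

omit [CompleteSpace G] in
theorem neg (hΦ : SimplyApproximable P ℱ R μ q T Φ) :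
    SimplyApproximable P ℱ R μ q T (fun r ω u => -Φ r ω u) := fun ε hε => by
  obtain ⟨n, Ψ, hΨ, h⟩ := hΦ ε hε
  refine ⟨n, fun i => (Ψ i).neg, fun i => ?_, ?_⟩
  · obtain ⟨g, k, hS⟩ := hΨ i
    exact ⟨-g, k, by simp [Elementary.neg, hS]⟩
  · refine lt_of_eq_of_lt ?_ h
    rw [← lambdaNormSq_neg]
    congr 1
    funext r ω u
    simp_rw [Elementary.integrand_neg, Finset.sum_neg_distrib]
    abel

variable (hM : IsCylMartingaleMeasure P ℱ R μ q M)
include hM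

variable [TopologicalSpace.SeparableSpace H] [TopologicalSpace.SeparableSpace G]
  [IsFiniteMeasure P] [SigmaFinite μ]

/-- Approximability is a closed condition, so it may be proved through intermediate fields. -/
theorem of_near (hΦm : PredField ℱ q T Φ)
    (h : ∀ ε : ℝ≥0∞, 0 < ε → ∃ Φ' : (r : ℝ≥0) → Ω → (u : U) → (q r u).Space →L[ℝ] G,
      PredField ℱ q T Φ' ∧ SimplyApproximable P ℱ R μ q T Φ' ∧
      lambdaNormSq P μ q T (fun r ω u => Φ' r ω u - Φ r ω u) < ε) :
    SimplyApproximable P ℱ R μ q T Φ := fun ε hε => by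
  have hε' : 0 < ε / 4 := ENNReal.div_pos hε.ne' (by simp)
  obtain ⟨Φ', hΦ'm, hΦ', hlt⟩ := h (ε / 4) hε'
  obtain ⟨n, Ψ, hΨ, hlt'⟩ := hΦ' (ε / 4) hε'
  refine ⟨n, Ψ, hΨ, ?_⟩
  have := ((predField_simple hM Ψ).sub hΦ'm).lambdaNormSq_add_le (P := P) (μ := μ)
    hM.form_measurable (hΦ'm.sub hΦm)
  simp only [sub_add_sub_cancel] at this
  exact this.trans_lt (two_mul_add_two_mul_lt hlt' hlt)

theorem add (hΦm : PredField ℱ q T Φ) (hΦ'm : PredField ℱ q T Φ')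
    (hΦ : SimplyApproximable P ℱ R μ q T Φ) (hΦ' : SimplyApproximable P ℱ R μ q T Φ') :
    SimplyApproximable P ℱ R μ q T (fun r ω u => Φ r ω u + Φ' r ω u) := fun ε hε => by
  have hε' : 0 < ε / 4 := ENNReal.div_pos hε.ne' (by simp)
  obtain ⟨n, Ψ, hΨ, hlt⟩ := hΦ (ε / 4) hε'
  obtain ⟨n', Ψ', hΨ', hlt'⟩ := hΦ' (ε / 4) hε'
  -- The sum of two simple integrands is simple: concatenate their data.
  refine ⟨n + n', Fin.append Ψ Ψ', fun i => ?_, ?_⟩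
  · refine Fin.addCases (fun i => ?_) (fun i => ?_) i
    · simpa using hΨ i
    · simpa using hΨ' i
  · have := ((predField_simple hM Ψ).sub hΦm).lambdaNormSq_add_le (P := P) (μ := μ)
      hM.form_measurable ((predField_simple hM Ψ').sub hΦ'm)
    simp only [Fin.sum_univ_add, Fin.append_left, Fin.append_right, add_sub_add_comm]
    exact this.trans_lt (two_mul_add_two_mul_lt hlt hlt')

theorem finset_sum {ι : Type*} (s : Finset ι)
    {Θ : ι → (r : ℝ≥0) → Ω → (u : U) → (q r u).Space →L[ℝ] G}
    (hm : ∀ i, PredField ℱ q T (Θ i)) (hΘ : ∀ i, SimplyApproximable P ℱ R μ q T (Θ i)) :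
    PredField ℱ q T (fun r ω u => ∑ i ∈ s, Θ i r ω u) ∧
      SimplyApproximable P ℱ R μ q T (fun r ω u => ∑ i ∈ s, Θ i r ω u) := by
  classical
  induction s using Finset.induction_on with
  | empty =>
    simp only [Finset.sum_empty]
    refine ⟨fun h g => ?_, zero⟩
    simp
  | insert i s hi ih =>
    simp only [Finset.sum_insert hi]
    exact ⟨(hm i).add ih.1, add hM (hm i) ih.1 (hΘ i) ih.2⟩

/-- Closedness in the form used below: pointwise Hilbert–Schmidt convergence with an integrable
bound on the squared distance implies convergence in Λ². -/
theorem of_tendsto {Θ : ℕ → (r : ℝ≥0) → Ω → (u : U) → (q r u).Space →L[ℝ] G}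
    (hΦm : PredField ℱ q T Φ) (hm : ∀ n, PredField ℱ q T (Θ n))
    (hΘ : ∀ n, SimplyApproximable P ℱ R μ q T (Θ n)) (bound : Ω × ℝ≥0 × U → ℝ≥0∞)
    (hbound : ∫⁻ p, bound p ∂(lambdaMeasure P μ T) ≠ ∞)
    (hle : ∀ n, ∀ᵐ p ∂(lambdaMeasure P μ T),
      hsNormSq (Θ n p.2.1 p.1 p.2.2 - Φ p.2.1 p.1 p.2.2) ≤ bound p)
    (hlim : ∀ᵐ p ∂(lambdaMeasure P μ T),
      Tendsto (fun n => hsNormSq (Θ n p.2.1 p.1 p.2.2 - Φ p.2.1 p.1 p.2.2)) atTop (𝓝 0)) :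
    SimplyApproximable P ℱ R μ q T Φ := by
  refine of_near hM hΦm fun ε hε => ?_
  have hmeas : ∀ n, AEMeasurable (fun p => hsNormSq (Θ n p.2.1 p.1 p.2.2 - Φ p.2.1 p.1 p.2.2))
      (lambdaMeasure P μ T) := fun n => by
    have h0 : PredField ℱ q T (fun r ω u => Θ n r ω u - Φ r ω u) := (hm n).sub hΦm
    have h1 := h0.aemeasurable_lambda (P := P) (μ := μ) hM.form_measurable
    exact h1
  have h1 := tendsto_lintegral_of_dominated_convergence' bound hmeas hle hbound hlim
  rw [lintegral_zero] at h1
  obtain ⟨n, hn⟩ := (h1.eventually_lt_const hε).exists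
  refine ⟨Θ n, hm n, hΘ n, ?_⟩
  have h0 : PredField ℱ q T (fun r ω u => Θ n r ω u - Φ r ω u) := (hm n).sub hΦm
  rw [h0.lambdaNormSq_eq hM.form_measurable]
  exact hn

end SimplyApproximable

omit [CompleteSpace H] in
theorem predField_rankOne (hM : IsCylMartingaleMeasure P ℱ R μ q M) (g : G) (h : H) :
    PredField ℱ q T fun r (_ : Ω) u => rankOne ℝ g ((q r u).incl h) := fun h' g' => by
  have h1 : Measurable[ℱ.predictable.prod inferInstance] fun p : (ℝ≥0 × Ω) × U =>
      ⟪g, g'⟫_ℝ * (q p.1.1 p.2).form h h' :=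
    ((hM.form_measurable _ _).comp (measurable_time_space ℱ)).const_mul _
  have hs : MeasurableSet[ℱ.predictable.prod inferInstance] {p : (ℝ≥0 × Ω) × U | p.1.1 ≤ T} :=
    (measurable_fst.comp (measurable_time_space ℱ)) measurableSet_Iic
  convert h1.indicator hs using 1
  funext p
  by_cases hp : p.1.1 ≤ T
  · simp [Set.indicator, hp, real_inner_smul_left, HilbertianSeminorm.inner_incl]
  · simp [Set.indicator, hp]

omit [CompleteSpace H] in
theorem predField_rankOneSum (hM : IsCylMartingaleMeasure P ℱ R μ q M) (d : ℕ → G) (d' : ℕ → H)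
    (l : List (ℕ × ℕ)) :
    PredField ℱ q T fun r (_ : Ω) u => rankOneSum d d' (q r u) l := by
  induction l with
  | nil => intro h g; simp
  | cons p l ih =>
    simp only [rankOneSum_cons]
    exact (predField_rankOne hM _ _).add ih

end Approximation

/-! ### A π-system generating the predictable σ-algebra times that of `U`. -/

section PredictableGenerators

variable {U : Type uU} [MeasurableSpace U] {Ω : Type uO} {m : MeasurableSpace Ω}

/-- The sets generating the predictable `σ`-algebra. -/
def predictableGenerators (ℱ : Filtration ℝ≥0 m) : Set (Set (ℝ≥0 × Ω)) :=
  {s | ∃ A, MeasurableSet[ℱ ⊥] A ∧ s = {⊥} ×ˢ A} ∪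
    {s | ∃ i A, MeasurableSet[ℱ i] A ∧ s = Ioi i ×ˢ A}

theorem isPiSystem_predictableGenerators (ℱ : Filtration ℝ≥0 m) :
    IsPiSystem (predictableGenerators ℱ) := by
  rintro _ (⟨A, hA, rfl⟩ | ⟨i, A, hA, rfl⟩) _ (⟨A', hA', rfl⟩ | ⟨i', A', hA', rfl⟩) hne
  · exact Or.inl ⟨A ∩ A', MeasurableSet.inter hA hA', by rw [prod_inter_prod, inter_self]⟩
  · obtain ⟨x, hx, hx'⟩ := hne
    have h1 : x.1 = ⊥ := hx.1
    have h2 : i' < x.1 := hx'.1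
    rw [h1] at h2
    exact absurd h2 not_lt_bot
  · obtain ⟨x, hx, hx'⟩ := hne
    have h1 : x.1 = ⊥ := hx'.1
    have h2 : i < x.1 := hx.1
    rw [h1] at h2
    exact absurd h2 not_lt_bot
  · refine Or.inr ⟨i ⊔ i', A ∩ A', MeasurableSet.inter (ℱ.mono le_sup_left _ hA)
      (ℱ.mono le_sup_right _ hA'), ?_⟩
    rw [prod_inter_prod, Ioi_inter_Ioi]

omit [MeasurableSpace U] in
theorem isPiSystem_insert_univ {R : Set (Set U)} (hR : IsSetRing R) : IsPiSystem (insert univ R) :=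
  hR.isSetSemiring.isPiSystem.insert_univ

/-- `univ` is added to `R` because countably many ring sets need not cover `U` (they do so only up
to a `μ`-null set), while generating a product σ-algebra from rectangles needs countable covers. -/
theorem predictable_prod_eq_generateFrom (ℱ : Filtration ℝ≥0 m) {R : Set (Set U)}
    (hR : (inferInstance : MeasurableSpace U) = MeasurableSpace.generateFrom R) :
    ℱ.predictable.prod (inferInstance : MeasurableSpace U) =
      MeasurableSpace.generateFrom (image2 (· ×ˢ ·) (predictableGenerators ℱ) (insert univ R)) := by
  have h1 : IsCountablySpanning (predictableGenerators ℱ) := by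
    refine ⟨fun n => if n = 0 then {⊥} ×ˢ univ else Ioi 0 ×ˢ univ, fun n => ?_, ?_⟩
    · dsimp only
      split_ifs
      · exact Or.inl ⟨univ, MeasurableSet.univ, rfl⟩
      · exact Or.inr ⟨0, univ, MeasurableSet.univ, rfl⟩
    · refine eq_univ_of_forall fun p => mem_iUnion.2 ?_
      rcases eq_or_ne p.1 0 with h | h
      · exact ⟨0, by simp [h]⟩
      · exact ⟨1, by simp [pos_iff_ne_zero, h]⟩
  have h2 : IsCountablySpanning (insert univ R) :=
    ⟨fun _ => univ, fun _ => mem_insert _ _, by simp [iUnion_const]⟩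
  rw [← generateFrom_prod_eq h1 h2]
  have h3 : (inferInstance : MeasurableSpace U) =
      MeasurableSpace.generateFrom (insert univ R) := by
    rw [hR]
    refine le_antisymm (MeasurableSpace.generateFrom_mono (subset_insert _ _)) ?_
    refine MeasurableSpace.generateFrom_le ?_
    rintro s (rfl | hs)
    · exact MeasurableSet.univ
    · exact MeasurableSpace.measurableSet_generateFrom hs
  rw [← h3]
  rfl

end PredictableGenerators

/-! ### Approximating rank one fields restricted to predictable sets. -/

section Density

open ContinuousLinearMap InnerProductSpace

variable {H : Type uH} [NormedAddCommGroup H] [InnerProductSpace ℝ H] [CompleteSpace H]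
variable {G : Type uG} [NormedAddCommGroup G] [InnerProductSpace ℝ G] [CompleteSpace G]
variable {U : Type uU} [MeasurableSpace U]
variable {Ω : Type uO} {m : MeasurableSpace Ω} {P : Measure Ω} {ℱ : Filtration ℝ≥0 m}
  {R : Set (Set U)} {μ : Measure U} {q : ℝ≥0 → U → HilbertianSeminorm H}
  {M : ℝ≥0 → Set U → H →ₗ[ℝ] (Ω →ₘ[P] ℝ)} {T : ℝ≥0}

open Classical in
/-- The operator field `1_C Φ`. -/
def restrictField (C : Set ((ℝ≥0 × Ω) × U))
    (Φ : (r : ℝ≥0) → Ω → (u : U) → (q r u).Space →L[ℝ] G) :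
    (r : ℝ≥0) → Ω → (u : U) → (q r u).Space →L[ℝ] G :=
  fun r ω u => if ((r, ω), u) ∈ C then Φ r ω u else 0

/-- The set `(0,T] × Ω × V`. -/
def timeBox (Ω : Type uO) (T : ℝ≥0) (V : Set U) : Set ((ℝ≥0 × Ω) × U) :=
  (Ioc 0 T ×ˢ univ) ×ˢ V

theorem measurableSet_timeBox (ℱ : Filtration ℝ≥0 m) {V : Set U} (hV : MeasurableSet V) :
    MeasurableSet[ℱ.predictable.prod inferInstance] (timeBox Ω T V) :=
  @MeasurableSet.prod _ _ ℱ.predictable _ _ _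
    (measurableSet_predictable_Ioc_prod _ _ MeasurableSet.univ) hV

variable {Φ : (r : ℝ≥0) → Ω → (u : U) → (q r u).Space →L[ℝ] G}

omit [CompleteSpace H] in
theorem PredField.restrictField (hΦ : PredField ℱ q T Φ) {C : Set ((ℝ≥0 × Ω) × U)}
    (hC : MeasurableSet[ℱ.predictable.prod inferInstance] C) :
    PredField ℱ q T (restrictField C Φ) := hΦ.restrict hC

omit [CompleteSpace H] [CompleteSpace G] [MeasurableSpace U] in
theorem restrictField_of_mem {C : Set ((ℝ≥0 × Ω) × U)} {r : ℝ≥0} {ω : Ω} {u : U}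
    (h : ((r, ω), u) ∈ C) : restrictField C Φ r ω u = Φ r ω u := if_pos h

omit [CompleteSpace H] [CompleteSpace G] [MeasurableSpace U] in
theorem restrictField_of_notMem {C : Set ((ℝ≥0 × Ω) × U)} {r : ℝ≥0} {ω : Ω} {u : U}
    (h : ((r, ω), u) ∉ C) : restrictField C Φ r ω u = 0 := if_neg h

omit [CompleteSpace H] [CompleteSpace G] [MeasurableSpace U] in
theorem restrictField_congr {C C' : Set ((ℝ≥0 × Ω) × U)} {r : ℝ≥0} {ω : Ω} {u : U}
    (h : ((r, ω), u) ∈ C ↔ ((r, ω), u) ∈ C') :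
    restrictField C Φ r ω u = restrictField C' Φ r ω u := by
  by_cases hC : ((r, ω), u) ∈ C
  · rw [restrictField_of_mem hC, restrictField_of_mem (h.1 hC)]
  · rw [restrictField_of_notMem hC, restrictField_of_notMem (h.not.1 hC)]

omit [CompleteSpace H] [CompleteSpace G] [MeasurableSpace U] in
theorem restrictField_union {C C' : Set ((ℝ≥0 × Ω) × U)} (h : Disjoint C C') :
    restrictField (C ∪ C') Φ = fun r ω u => restrictField C Φ r ω u + restrictField C' Φ r ω u := by
  funext r ω u
  by_cases h1 : ((r, ω), u) ∈ C
  · have h2 : ((r, ω), u) ∉ C' := disjoint_left.1 h h1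
    simp [restrictField, h1, h2]
  · by_cases h2 : ((r, ω), u) ∈ C' <;> simp [restrictField, h1, h2]

omit [CompleteSpace H] [CompleteSpace G] [MeasurableSpace U] in
theorem restrictField_sdiff {C C' : Set ((ℝ≥0 × Ω) × U)} (h : C' ⊆ C) :
    restrictField (C \ C') Φ =
      fun r ω u => restrictField C Φ r ω u + -restrictField C' Φ r ω u := by
  funext r ω u
  by_cases h2 : ((r, ω), u) ∈ C'
  · simp [restrictField, h h2, h2]
  · by_cases h1 : ((r, ω), u) ∈ C <;> simp [restrictField, h1, h2]

omit [CompleteSpace H] [CompleteSpace G] [MeasurableSpace U] in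
theorem restrictField_empty : restrictField ∅ Φ = fun _ _ _ => 0 := by
  funext r ω u; simp [restrictField]

variable (hM : IsCylMartingaleMeasure P ℱ R μ q M)
include hM

/-- Inside the time box a generator is empty or an elementary rectangle, because `(g ⊗ h) ∘ i_q* = g
⊗ i_q h`. Intersecting with `V` brings the space factor into `R` even when it is `univ`. -/
theorem simplyApproximable_rankOne_generator {V : Set U} (hV : V ∈ R) (g : G) (h : H)
    {C : Set ((ℝ≥0 × Ω) × U)}
    (hC : C ∈ image2 (· ×ˢ ·) (predictableGenerators ℱ) (insert univ R)) :
    SimplyApproximable P ℱ R μ q T (restrictField (C ∩ timeBox Ω T V)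
      fun r _ u => rankOne ℝ g ((q r u).incl h)) := by
  obtain ⟨E, hE, A, hA, rfl⟩ := hC
  have hAV : A ∩ V ∈ R := by
    rcases hA with rfl | hA
    · rwa [univ_inter]
    · exact hM.isSetRing.inter_mem hA hV
  rcases hE with ⟨F, hF, rfl⟩ | ⟨i, F, hF, rfl⟩
  -- Generators at time zero disappear because the box is open at `0`.
  · have e : (({⊥} ×ˢ F) ×ˢ A) ∩ timeBox Ω T V = ∅ := by
      refine eq_empty_of_forall_notMem ?_
      rintro ⟨⟨r, ω⟩, u⟩ ⟨⟨⟨h1, -⟩, -⟩, ⟨h2, -⟩, -⟩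
      have h1 : r = 0 := h1
      exact h2.1.ne' h1
    simp only [e, restrictField_empty]
    exact SimplyApproximable.zero
  · rcases lt_or_ge i T with hi | hi
    · let e : Elementary H G ℱ R T :=
        -- The box cuts the unbounded interval `(i, ∞)` to `(i, T]`.
        { s := i, t := T, s_lt := hi, t_le := le_rfl, F := F, measurable_F := hF, A := A ∩ V,
          mem_A := hAV, S := rankOne ℝ g h
          hilbertSchmidt := by
            rw [IsHilbertSchmidt, hsNormSq_rankOne]
            exact ENNReal.mul_lt_top (by simp) (by simp) }
      convert SimplyApproximable.of_elementary (P := P) (μ := μ) (q := q) e ⟨g, h, rfl⟩ using 1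
      funext r ω u
      have hiff : ((r, ω), u) ∈ ((Ioi i ×ˢ F) ×ˢ A) ∩ timeBox Ω T V ↔
          r ∈ Ioc e.s e.t ∧ ω ∈ e.F ∧ u ∈ e.A := by
        simp only [timeBox, mem_inter_iff, mem_prod, mem_Ioi, mem_Ioc, mem_univ, and_true, e]
        constructor
        · rintro ⟨⟨⟨h1, h2⟩, h3⟩, ⟨h4, h5⟩, h6⟩
          exact ⟨⟨h1, h5⟩, h2, h3, h6⟩
        · rintro ⟨⟨h1, h5⟩, h2, h3, h6⟩
          exact ⟨⟨⟨h1, h2⟩, h3⟩, ⟨(zero_le (a := i)).trans_lt h1, h5⟩, h6⟩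
      by_cases hx : ((r, ω), u) ∈ ((Ioi i ×ˢ F) ×ˢ A) ∩ timeBox Ω T V
      · rw [Elementary.integrand, if_pos (hiff.1 hx), rankOne_comp, adjoint_adjoint]
        exact restrictField_of_mem hx
      · rw [Elementary.integrand, if_neg (hiff.not.1 hx)]
        exact restrictField_of_notMem hx
    · have e : ((Ioi i ×ˢ F) ×ˢ A) ∩ timeBox Ω T V = ∅ := by
        refine eq_empty_of_forall_notMem ?_
        rintro ⟨⟨r, ω⟩, u⟩ ⟨⟨⟨h1, -⟩, -⟩, ⟨h2, -⟩, -⟩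
        exact absurd (lt_of_lt_of_le h1 h2.2) (not_lt.2 hi)
      simp only [e, restrictField_empty]
      exact SimplyApproximable.zero

variable [TopologicalSpace.SeparableSpace H] [TopologicalSpace.SeparableSpace G]
  [IsFiniteMeasure P] [SigmaFinite μ]

/-- A π-λ argument in `C`. Intersecting with the box over `V ∈ R` keeps all norms finite; there
complements are differences of fields and countable disjoint unions are dominated limits. -/
theorem simplyApproximable_rankOne {V : Set U} (hV : V ∈ R) (g : G) (h : H)
    {C : Set ((ℝ≥0 × Ω) × U)} (hC : MeasurableSet[ℱ.predictable.prod inferInstance] C) :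
    SimplyApproximable P ℱ R μ q T (restrictField (C ∩ timeBox Ω T V)
      fun r _ u => rankOne ℝ g ((q r u).incl h)) := by
  have hD := measurableSet_timeBox (T := T) ℱ (hM.measurableSet hV)
  have hpred := fun {C : Set ((ℝ≥0 × Ω) × U)}
    (hC : MeasurableSet[ℱ.predictable.prod inferInstance] C) =>
    (predField_rankOne (T := T) hM g h).restrictField
      (@MeasurableSet.inter _ (ℱ.predictable.prod inferInstance) _ _ hC hD)
  have huniv : SimplyApproximable P ℱ R μ q T (restrictField (timeBox Ω T V)
      fun r _ u => rankOne ℝ g ((q r u).incl h)) := by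
    have h1 := simplyApproximable_rankOne_generator (T := T) hM hV g h
      (mem_image2_of_mem (f := (· ×ˢ ·)) (Or.inr ⟨0, univ, MeasurableSet.univ, rfl⟩)
        (mem_insert univ R))
    rwa [inter_eq_right.2] at h1
    rintro ⟨⟨r, ω⟩, u⟩ ⟨⟨h1, -⟩, -⟩
    exact ⟨⟨h1.1, trivial⟩, trivial⟩
  induction C, hC using MeasurableSpace.induction_on_inter
    (predictable_prod_eq_generateFrom ℱ hM.generate)
    ((isPiSystem_predictableGenerators ℱ).prod (isPiSystem_insert_univ hM.isSetRing)) with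
  | empty => rw [empty_inter, restrictField_empty]; exact SimplyApproximable.zero
  | basic C hC => exact simplyApproximable_rankOne_generator hM hV g h hC
  | compl C hC ih =>
    have e : Cᶜ ∩ timeBox Ω T V = timeBox Ω T V \ (C ∩ timeBox Ω T V) := by
      ext x; simp only [mem_inter_iff, mem_compl_iff, Set.mem_sdiff]; tauto
    rw [e, restrictField_sdiff inter_subset_right]
    exact SimplyApproximable.add hM ((predField_rankOne hM g h).restrictField hD) (hpred hC).neg
      huniv ih.neg
  | iUnion f hd hf ih =>
    have hacc : ∀ N, MeasurableSet[ℱ.predictable.prod inferInstance]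
        (⋃ i ∈ Finset.range N, f i) := fun N =>
      Finset.measurableSet_biUnion _ fun i _ => hf i
    have hN : ∀ N, SimplyApproximable P ℱ R μ q T
        (restrictField ((⋃ i ∈ Finset.range N, f i) ∩ timeBox Ω T V)
        fun r _ u => rankOne ℝ g ((q r u).incl h)) := fun N => by
      induction N with
      | zero =>
        simp only [Finset.range_zero, Finset.notMem_empty, iUnion_of_empty, iUnion_empty,
          empty_inter, restrictField_empty]
        exact SimplyApproximable.zero
      | succ N ihN =>
        have hdis : Disjoint (f N ∩ timeBox Ω T V)
            ((⋃ i ∈ Finset.range N, f i) ∩ timeBox Ω T V) := by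
          refine (disjoint_iUnion₂_right.2 fun i hi => hd ?_).mono inter_subset_left
            inter_subset_left
          exact (Finset.mem_range.1 hi).ne'
        rw [Finset.range_add_one, Finset.set_biUnion_insert, union_inter_distrib_right,
          restrictField_union hdis]
        exact SimplyApproximable.add hM (hpred (hf N)) (hpred (hacc N)) (ih N) ihN
    obtain ⟨c, hc⟩ := hM.form_bounded T h h
    refine SimplyApproximable.of_tendsto hM (hpred (MeasurableSet.iUnion hf))
      (fun N => hpred (hacc N)) hN
      -- `c` bounds `q(h,h)` up to time `T`, so each field has squared norm at most `‖g‖² c`; the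
      -- difference of two such fields costs `2 + 2 = 4`.
      ((univ ×ˢ (Ioc 0 T ×ˢ V)).indicator fun _ => 4 * (‖g‖ₑ ^ 2 * ENNReal.ofReal c)) ?_ ?_ ?_
    · rw [lintegral_indicator_const (MeasurableSet.univ.prod
        (measurableSet_Ioc.prod (hM.measurableSet hV))), lambdaMeasure, Measure.prod_prod,
        Measure.prod_prod]
      have h1 : (leb.restrict (Iic T)) (Ioc 0 T) < ∞ := measure_lt_top _ _
      have h2 := hM.measure_lt_top V hV
      finiteness
    · refine fun N => .of_forall fun p => ?_
      by_cases hp : p ∈ (univ : Set Ω) ×ˢ (Ioc 0 T ×ˢ V)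
      · rw [indicator_of_mem hp]
        have hb : hsNormSq (rankOne ℝ g ((q p.2.1 p.2.2).incl h)) ≤
            ‖g‖ₑ ^ 2 * ENNReal.ofReal c := by
          rw [hsNormSq_rankOne, ← ofReal_norm ((q p.2.1 p.2.2).incl h),
            ← ENNReal.ofReal_pow (norm_nonneg _), ← real_inner_self_eq_norm_sq,
            HilbertianSeminorm.inner_incl]
          gcongr
          exact (le_abs_self _).trans (hc _ hp.2.1.2 _)
        have hb' : ∀ C : Set ((ℝ≥0 × Ω) × U), hsNormSq (restrictField C
            (fun r _ u => rankOne ℝ g ((q r u).incl h)) p.2.1 p.1 p.2.2) ≤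
            ‖g‖ₑ ^ 2 * ENNReal.ofReal c := fun C => by
          unfold restrictField
          split_ifs
          · exact hb
          · simp
        refine (hsNormSq_sub_le _ _).trans ((add_le_add (mul_le_mul_right (hb' _) _)
          (mul_le_mul_right (hb' _) _)).trans_eq ?_)
        rw [← add_mul]; norm_num
      · have hp' : ((p.2.1, p.1), p.2.2) ∉ timeBox Ω T V := fun h' => hp ⟨trivial, h'.1.1, h'.2⟩
        simp [restrictField, hp']
    · refine .of_forall fun p => ?_
      refine tendsto_const_nhds.congr' ?_
      by_cases hp : ((p.2.1, p.1), p.2.2) ∈ ⋃ i, f i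
      · obtain ⟨i, hi⟩ := mem_iUnion.1 hp
        filter_upwards [eventually_gt_atTop i] with N hN'
        have h1 : ((p.2.1, p.1), p.2.2) ∈ ⋃ i ∈ Finset.range N, f i :=
          mem_iUnion₂.2 ⟨i, Finset.mem_range.2 hN', hi⟩
        rw [restrictField_congr (C' := (⋃ i, f i) ∩ timeBox Ω T V) (and_congr_left' (iff_of_true h1 hp)),
          sub_self, hsNormSq_zero]
      · refine .of_forall fun N => ?_
        have h1 : ((p.2.1, p.1), p.2.2) ∉ ⋃ i ∈ Finset.range N, f i := fun h' => by
          obtain ⟨i, -, hi⟩ := mem_iUnion₂.1 h'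
          exact hp (mem_iUnion.2 ⟨i, hi⟩)
        dsimp only
        rw [restrictField_congr (C' := (⋃ i, f i) ∩ timeBox Ω T V) (and_congr_left' (iff_of_false h1 hp)),
          sub_self, hsNormSq_zero]

end Density

/-! ### Density of simple integrands in Λ². -/

section DensityTheorem

open ContinuousLinearMap InnerProductSpace

variable {H : Type uH} [NormedAddCommGroup H] [InnerProductSpace ℝ H] [CompleteSpace H]
variable {G : Type uG} [NormedAddCommGroup G] [InnerProductSpace ℝ G] [CompleteSpace G]
variable {U : Type uU} [MeasurableSpace U]
variable {Ω : Type uO} {m : MeasurableSpace Ω} {P : Measure Ω} {ℱ : Filtration ℝ≥0 m}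
  {R : Set (Set U)} {μ : Measure U} {q : ℝ≥0 → U → HilbertianSeminorm H}
  {M : ℝ≥0 → Set U → H →ₗ[ℝ] (Ω →ₘ[P] ℝ)} {T : ℝ≥0}
  {Φ : (r : ℝ≥0) → Ω → (u : U) → (q r u).Space →L[ℝ] G}

variable (hM : IsCylMartingaleMeasure P ℱ R μ q M)
variable [TopologicalSpace.SeparableSpace H] [TopologicalSpace.SeparableSpace G]
  [IsFiniteMeasure P] [SigmaFinite μ]
include hM

theorem simplyApproximable_rankOneSum {V : Set U} (hV : V ∈ R) (d : ℕ → G) (d' : ℕ → H)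
    (l : List (ℕ × ℕ))
    {C : Set ((ℝ≥0 × Ω) × U)} (hC : MeasurableSet[ℱ.predictable.prod inferInstance] C) :
    SimplyApproximable P ℱ R μ q T (restrictField (C ∩ timeBox Ω T V)
      fun r _ u => rankOneSum d d' (q r u) l) := by
  have hCD := @MeasurableSet.inter _ (ℱ.predictable.prod inferInstance) _ _ hC
    (measurableSet_timeBox (T := T) ℱ (hM.measurableSet hV))
  induction l with
  | nil =>
    have e : restrictField (q := q) (C ∩ timeBox Ω T V)
        (fun r _ u => rankOneSum d d' (q r u) []) = fun _ _ _ => 0 := by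
      funext r ω u
      simp [restrictField]
    rw [e]
    exact SimplyApproximable.zero
  | cons p l ih =>
    have e : restrictField (q := q) (C ∩ timeBox Ω T V)
        (fun r _ u => rankOneSum d d' (q r u) (p :: l)) =
        fun r ω u => restrictField (C ∩ timeBox Ω T V)
          (fun r _ u => rankOne ℝ (d p.1) ((q r u).incl (d' p.2))) r ω u +
          restrictField (C ∩ timeBox Ω T V) (fun r _ u => rankOneSum d d' (q r u) l) r ω u := by
      funext r ω u
      by_cases h : ((r, ω), u) ∈ C ∩ timeBox Ω T V
      · simp only [restrictField_of_mem h, rankOneSum_cons]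
      · simp only [restrictField_of_notMem h, add_zero]
    rw [e]
    exact SimplyApproximable.add hM ((predField_rankOne hM _ _).restrictField hCD)
      ((predField_rankOneSum hM _ _ _).restrictField hCD)
      (simplyApproximable_rankOne hM hV _ _ hC) ih

/-- Choosing at each point the best of the first `N + 1` operators of a sequence of rank one sums. -/
theorem exists_nearest_rankOneSum {V : Set U} (hV : V ∈ R) (d : ℕ → G) (d' : ℕ → H)
    (L : ℕ → List (ℕ × ℕ)) (hΦm : PredField ℱ q T Φ) (N : ℕ) :
    ∃ Θ : (r : ℝ≥0) → Ω → (u : U) → (q r u).Space →L[ℝ] G,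
      PredField ℱ q T Θ ∧ SimplyApproximable P ℱ R μ q T Θ ∧
      (∀ r ω u, ((r, ω), u) ∉ timeBox Ω T V → Θ r ω u = 0) ∧
      ∀ r ω u, ((r, ω), u) ∈ timeBox Ω T V → ∀ n ≤ N, hsNormSq (Θ r ω u - Φ r ω u) ≤
        hsNormSq (Φ r ω u - rankOneSum d d' (q r u) (L n)) := by
  -- The cutoff at `T` is needed because measurability of the field is known only on `[0,T]`.
  let err : (ℝ≥0 × Ω) × U → ℕ → ℝ≥0∞ := fun p n => (Iic T).indicator
    (fun r => hsNormSq (Φ r p.1.2 p.2 - rankOneSum d d' (q r p.2) (L n))) p.1.1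
  have herr : ∀ n, Measurable[ℱ.predictable.prod inferInstance] fun p => err p n := fun n => by
    have h0 : PredField ℱ q T (fun r ω u => Φ r ω u - rankOneSum d d' (q r u) (L n)) :=
      PredField.sub hΦm (predField_rankOneSum hM d d' (L n))
    have h1 := h0.measurable_hsNormSq hM.form_measurable
    exact h1
  have hsel := measurable_argmin (mX := ℱ.predictable.prod inferInstance) herr N
  -- The regions where the `n`-th operator is selected; on each of them the selected field is a
  -- fixed sum of rank one fields.
  let C : ℕ → Set ((ℝ≥0 × Ω) × U) := fun n => {p | argmin (err p) N = n}
  have hC : ∀ n, MeasurableSet[ℱ.predictable.prod inferInstance] (C n) := fun n =>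
    hsel (measurableSet_singleton n)
  have hCD : ∀ n, MeasurableSet[ℱ.predictable.prod inferInstance]
      (C n ∩ timeBox Ω T V) := fun n =>
    @MeasurableSet.inter _ (ℱ.predictable.prod inferInstance) _ _ (hC n)
    (measurableSet_timeBox (T := T) ℱ (hM.measurableSet hV))
  obtain ⟨h1, h2⟩ := SimplyApproximable.finset_sum (P := P) (μ := μ) hM (Finset.range (N + 1))
    (fun n => (predField_rankOneSum (T := T) hM d d' (L n)).restrictField (hCD n))
    (fun n => simplyApproximable_rankOneSum hM hV d d' (L n) (hC n))
  refine ⟨_, h1, h2, fun r ω u hp => ?_, fun r ω u hp n hn => ?_⟩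
  · refine Finset.sum_eq_zero fun n _ => ?_
    rw [restrictField_of_notMem]
    exact fun h => hp h.2
  · have e : ∑ n ∈ Finset.range (N + 1), restrictField (C n ∩ timeBox Ω T V)
        (fun r _ u => rankOneSum d d' (q r u) (L n)) r ω u =
        rankOneSum d d' (q r u) (L (argmin (err ((r, ω), u)) N)) := by
      rw [Finset.sum_eq_single (argmin (err ((r, ω), u)) N)]
      · rw [restrictField_of_mem]
        exact ⟨rfl, hp⟩
      · intro n _ hn
        rw [restrictField_of_notMem]
        exact fun h => hn h.1.symm
      · intro h
        exact absurd (Finset.mem_range.2 (Nat.lt_succ_of_le (argmin_le _ N))) h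
    have hr : r ∈ Iic T := hp.1.1.2
    have h1 := apply_argmin_le (err ((r, ω), u)) hn
    simp only [err, indicator_of_mem hr] at h1
    rw [e, hsNormSq_sub_comm]
    simpa only [err, indicator_of_mem hr] using h1

/-- Simple integrands built on rank one operators are dense in `Λ²`. -/
theorem MemLambda.simplyApproximable (hΦ : MemLambda P ℱ μ q T Φ) :
    SimplyApproximable P ℱ R μ q T Φ := by
  have hΦm : PredField ℱ q T Φ := hΦ.predictable
  obtain ⟨K, hK, hK0⟩ := hM.exhaust
  let V : ℕ → Set U := fun N => ⋃ i ∈ Finset.range N, K i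
  have hV : ∀ N, V N ∈ R := fun N => hM.isSetRing.biUnion_mem _ fun i _ => hK i
  let L : ℕ → List (ℕ × ℕ) := Denumerable.ofNat (List (ℕ × ℕ))
  -- Index `0` is the zero operator, so it always competes: the selected error never exceeds `‖Φ‖²`,
  -- which serves as the dominating function.
  have hL0 : L 0 = [] := Denumerable.list_ofNat_zero
  choose Θ hm happ hout hin using fun N => exists_nearest_rankOneSum (P := P) (μ := μ) hM (hV N)
    (TopologicalSpace.denseSeq G) (TopologicalSpace.denseSeq H) L hΦm N
  refine SimplyApproximable.of_tendsto (Θ := Θ) hM hΦm hm happ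
    (fun p => hsNormSq (Φ p.2.1 p.1 p.2.2)) ?_ ?_ ?_
  · rw [← hΦm.lambdaNormSq_eq hM.form_measurable]
    exact hΦ.norm_lt_top.ne
  · refine fun N => .of_forall fun p => ?_
    by_cases hp : ((p.2.1, p.1), p.2.2) ∈ timeBox Ω T (V N)
    · refine (hin N _ _ _ hp 0 (Nat.zero_le _)).trans_eq ?_
      rw [hL0, rankOneSum_nil, sub_zero]
    · rw [hout N _ _ _ hp, zero_sub, hsNormSq_neg]
  -- Almost every point has positive time and lies in some `K n`, hence eventually in the boxes over
  -- `V N`. From then on the selection beats every list already enumerated.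
  · have h1 : ∀ᵐ p ∂(leb.restrict (Iic T)).prod μ, p.1 ∈ Ioc 0 T := by
      refine Measure.quasiMeasurePreserving_fst.ae ?_
      have h0 : ∀ᵐ r ∂(leb.restrict (Iic T)), r ≠ 0 :=
        ae_restrict_of_ae (by simp [ae_iff])
      filter_upwards [h0, ae_restrict_mem measurableSet_Iic] with r h0 hr
      exact ⟨pos_iff_ne_zero.2 h0, hr⟩
    have h2 : ∀ᵐ p ∂(leb.restrict (Iic T)).prod μ, p.2 ∈ ⋃ n, K n :=
      Measure.quasiMeasurePreserving_snd.ae (by rw [ae_iff]; exact hK0)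
    have h3 : ∀ᵐ p ∂lambdaMeasure P μ T, p.2.1 ∈ Ioc 0 T ∧ p.2.2 ∈ ⋃ n, K n :=
      Measure.quasiMeasurePreserving_snd.ae (h1.and h2)
    filter_upwards [h3] with ⟨ω, r, u⟩ ⟨hr, hu⟩
    rw [ENNReal.tendsto_nhds_zero]
    intro ε hε
    obtain ⟨l, hl⟩ := exists_rankOneSum_near (TopologicalSpace.denseRange_denseSeq G)
      (TopologicalSpace.denseRange_denseSeq H) (q r u) (Φ r ω u)
      (hΦ.hilbertSchmidt r hr.2 ω u) hε
    obtain ⟨i, hi⟩ := mem_iUnion.1 hu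
    filter_upwards [eventually_gt_atTop i, eventually_ge_atTop (Encodable.encode l)] with N hN hN'
    have hp : ((r, ω), u) ∈ timeBox Ω T (V N) :=
      ⟨⟨hr, trivial⟩, mem_iUnion₂.2 ⟨i, Finset.mem_range.2 hN, hi⟩⟩
    refine (hin N r ω u hp _ hN').trans (le_of_lt ?_)
    simpa only [L, Denumerable.ofNat_encode] using hl

end DensityTheorem

/-! ### Second moments as squares of L² norms. -/

section SecondMoments

variable {Ω : Type uO} {m : MeasurableSpace Ω} {P : Measure Ω}
variable {G : Type uG} [NormedAddCommGroup G]

theorem eLpNorm_two_sq (f : Ω → G) : eLpNorm f 2 P ^ 2 = ∫⁻ ω, ‖f ω‖ₑ ^ 2 ∂P := by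
  rw [eLpNorm_eq_lintegral_rpow_enorm_toReal (by simp) (by simp)]
  simp only [ENNReal.toReal_ofNat, ENNReal.rpow_ofNat, one_div]
  rw [← ENNReal.rpow_natCast, ← ENNReal.rpow_mul]
  simp

theorem lintegral_enorm_add_sq_le {f g : Ω → G} (hf : AEStronglyMeasurable f P) :
    ∫⁻ ω, ‖f ω + g ω‖ₑ ^ 2 ∂P ≤ 2 * ∫⁻ ω, ‖f ω‖ₑ ^ 2 ∂P + 2 * ∫⁻ ω, ‖g ω‖ₑ ^ 2 ∂P := by
  rw [← lintegral_const_mul' _ _ (by simp), ← lintegral_const_mul' _ _ (by simp),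
    ← lintegral_add_left' ((hf.enorm.pow_const 2).const_mul _)]
  exact lintegral_mono fun ω => enorm_add_sq_le _ _

theorem lintegral_enorm_sub_sq_le {f g : Ω → G} (hf : AEStronglyMeasurable f P) :
    ∫⁻ ω, ‖f ω - g ω‖ₑ ^ 2 ∂P ≤ 2 * ∫⁻ ω, ‖f ω‖ₑ ^ 2 ∂P + 2 * ∫⁻ ω, ‖g ω‖ₑ ^ 2 ∂P := by
  simpa [sub_eq_add_neg] using lintegral_enorm_add_sq_le (g := -g) hf

end SecondMoments

/-! ### Existence and continuity of the stochastic integral. -/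

section StochasticIntegral

open ContinuousLinearMap InnerProductSpace

variable {H : Type uH} [NormedAddCommGroup H] [InnerProductSpace ℝ H] [CompleteSpace H]
variable {G : Type uG} [NormedAddCommGroup G] [InnerProductSpace ℝ G] [CompleteSpace G]
variable {U : Type uU} [MeasurableSpace U]
variable {Ω : Type uO} {m : MeasurableSpace Ω} {P : Measure Ω} {ℱ : Filtration ℝ≥0 m}
  {R : Set (Set U)} {μ : Measure U} {q : ℝ≥0 → U → HilbertianSeminorm H}
  {M : ℝ≥0 → Set U → H →ₗ[ℝ] (Ω →ₘ[P] ℝ)} {T : ℝ≥0}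

-- Differences stay within simple integrals, so the isometry also controls distances between them.
omit [MeasurableSpace U] in
theorem IsSimpleIntegral.sub {n n' : ℕ} {Ψ : Fin n → Elementary H G ℱ R T}
    {Ψ' : Fin n' → Elementary H G ℱ R T} {Z Z' : Ω → G} (hZ : IsSimpleIntegral M Ψ Z)
    (hZ' : IsSimpleIntegral M Ψ' Z') :
    IsSimpleIntegral M (Fin.append Ψ fun i => (Ψ' i).neg) fun ω => Z ω - Z' ω := by
  obtain ⟨Y, hY, hYZ⟩ := hZ
  obtain ⟨Y', hY', hYZ'⟩ := hZ'
  refine ⟨Fin.append Y fun i ω => -Y' i ω, fun i => ?_, ?_⟩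
  · refine Fin.addCases (fun i => ?_) (fun i => ?_) i
    · simpa using hY i
    · simp only [Fin.append_right]
      refine ⟨(hY' i).1.neg, fun g => ?_⟩
      filter_upwards [(hY' i).2 g, AEEqFun.coeFn_neg
        (incr M (Ψ' i).s (Ψ' i).t (Ψ' i).A (adjoint (Ψ' i).S g))] with ω h1 h2
      have e : incr M (Ψ' i).s (Ψ' i).t (Ψ' i).A (adjoint (-(Ψ' i).S) g) =
          -incr M (Ψ' i).s (Ψ' i).t (Ψ' i).A (adjoint (Ψ' i).S g) := by
        simp [incr]; abel
      simp only [Elementary.neg]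
      rw [e, h2, inner_neg_left, h1, Pi.neg_apply]
  · filter_upwards [hYZ, hYZ'] with ω h1 h2
    rw [h1, h2, Fin.sum_univ_add]
    simp only [Fin.append_left, Fin.append_right, Elementary.neg, sub_eq_add_neg,
      ← Finset.sum_neg_distrib]
    congr 1
    refine Finset.sum_congr rfl fun i _ => ?_
    by_cases h : ω ∈ (Ψ' i).F <;> simp [h]

omit [CompleteSpace G] [MeasurableSpace U] in
theorem IsSimpleIntegral.aestronglyMeasurable {n : ℕ} {Ψ : Fin n → Elementary H G ℱ R T}
    [CompleteSpace G] {Z : Ω → G} (hZ : IsSimpleIntegral M Ψ Z) : AEStronglyMeasurable Z P := by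
  obtain ⟨Y, hY, hYZ⟩ := hZ
  refine AEStronglyMeasurable.congr ?_ (EventuallyEq.symm hYZ)
  refine Finset.aestronglyMeasurable_fun_sum _ fun i _ => ?_
  exact (hY i).1.indicator (ℱ.le _ _ (Ψ i).measurable_F)

variable (hM : IsCylMartingaleMeasure P ℱ R μ q M)
include hM

/-- For `S = g ⊗ h` the radonification is explicit, `M((s,t],A)(h) g`. This is why density is proved
with rank one operators; measurability with respect to `ℱ T` comes with the formula. -/
theorem exists_isRadonification_rankOne (e : Elementary H G ℱ R T)
    (he : ∃ g h, e.S = rankOne ℝ g h) : ∃ Y : Ω → G, IsRadonification M e.s e.t e.A e.S Y ∧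
      MemLp Y 2 P ∧ AEStronglyMeasurable[ℱ T] Y P := by
  obtain ⟨g, h, hS⟩ := he
  refine ⟨fun ω => incr M e.s e.t e.A h ω • g, ⟨?_, fun g' => ?_⟩, ?_, ?_⟩
  · exact (hM.memLp_incr e.mem_A _ _ _).1.smul_const g
  · rw [hS, adjoint_rankOne, rankOne_apply, incr_smul]
    filter_upwards [AEEqFun.coeFn_smul (⟪g, g'⟫_ℝ) (incr M e.s e.t e.A h)] with ω hω
    rw [hω, real_inner_smul_left, Pi.smul_apply, smul_eq_mul, mul_comm]
  · have h1 := hM.memLp_incr e.mem_A e.s e.t h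
    exact ((toSpanSingleton ℝ g).comp_memLp' h1)
  · exact ((hM.aestronglyMeasurable_incr e.mem_A e.s_lt.le h).mono
      (ℱ.mono e.t_le)).smul_const g

theorem exists_isSimpleIntegral_rankOne {n : ℕ} (Ψ : Fin n → Elementary H G ℱ R T)
    (hΨ : ∀ i, ∃ g h, (Ψ i).S = rankOne ℝ g h) : ∃ Z : Ω → G, IsSimpleIntegral M Ψ Z ∧
      MemLp Z 2 P ∧ AEStronglyMeasurable[ℱ T] Z P := by
  choose Y hY hY2 hYm using fun i => exists_isRadonification_rankOne hM (Ψ i) (hΨ i)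
  refine ⟨fun ω => ∑ i, (Ψ i).F.indicator (Y i) ω, ⟨Y, hY, .of_forall fun ω => rfl⟩, ?_, ?_⟩
  · exact memLp_finsetSum _ fun i _ => (hY2 i).indicator (ℱ.le _ _ (Ψ i).measurable_F)
  · choose W hW hYW using hYm
    refine ⟨fun ω => ∑ i, (Ψ i).F.indicator (W i) ω, ?_, ?_⟩
    · refine Finset.stronglyMeasurable_fun_sum _ fun i _ => (hW i).indicator
        (ℱ.mono ((Ψ i).s_lt.le.trans (Ψ i).t_le) _ (Ψ i).measurable_F)
    · filter_upwards [ae_all_iff.2 hYW] with ω hω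
      simp only [indicator, hω]

variable [TopologicalSpace.SeparableSpace H] [TopologicalSpace.SeparableSpace G]
  [IsFiniteMeasure P] [SigmaFinite μ]

theorem lintegral_sq_sub_simpleIntegral {n n' : ℕ} {Ψ : Fin n → Elementary H G ℱ R T}
    {Ψ' : Fin n' → Elementary H G ℱ R T} {Z Z' : Ω → G} (hZ : IsSimpleIntegral M Ψ Z)
    (hZ' : IsSimpleIntegral M Ψ' Z') :
    ∫⁻ ω, ‖Z ω - Z' ω‖ₑ ^ 2 ∂P = lambdaNormSq P μ q T fun r ω u =>
      (∑ i, (Ψ i).integrand q r ω u) - ∑ i, (Ψ' i).integrand q r ω u := by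
  rw [lintegral_sq_simpleIntegral hM (hZ.sub hZ')]
  simp only [Fin.sum_univ_add, Fin.append_left, Fin.append_right, Elementary.integrand_neg,
    Finset.sum_neg_distrib, sub_eq_add_neg]

/-- Every `Φ ∈ Λ²(M,T)` has a stochastic integral. -/
theorem MemLambda.exists_hasStochIntegral
    {Φ : (r : ℝ≥0) → Ω → (u : U) → (q r u).Space →L[ℝ] G} (hΦ : MemLambda P ℱ μ q T Φ) :
    ∃ Y : Ω → G, HasStochIntegral P ℱ R μ q M T Φ Y ∧ AEStronglyMeasurable[ℱ T] Y P := by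
  have hΦm : PredField ℱ q T Φ := hΦ.predictable
  let δ : ℕ → ℝ≥0∞ := fun k => (k : ℝ≥0∞)⁻¹
  have hδ : Tendsto δ atTop (𝓝 0) := ENNReal.tendsto_inv_nat_nhds_zero
  choose n Ψ hΨ hlt using fun k : ℕ => hΦ.simplyApproximable hM (δ k) (by simp [δ])
  choose Z hZ hZ2 hZm using fun k => exists_isSimpleIntegral_rankOne hM (Ψ k) (hΨ k)
  have : Fact ((1 : ℝ≥0∞) ≤ 2) := ⟨by norm_num⟩
  -- By the isometry, distances between the simple integrals equal distances between their
  -- integrands, which all approach `Φ`.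
  have hcauchy : CauchySeq fun k => (hZ2 k).toLp (Z k) := by
    refine EMetric.cauchySeq_iff.2 fun ε hε => ?_
    have hε' : 0 < ε ^ 2 / 4 := ENNReal.div_pos (pow_ne_zero 2 hε.ne') (by simp)
    obtain ⟨N, hN⟩ := eventually_atTop.1 (hδ.eventually_lt_const hε')
    refine ⟨N, fun k hk l hl => ?_⟩
    rw [Lp.edist_toLp_toLp]
    refine not_le.1 fun hle => absurd (pow_le_pow_left' hle 2) (not_le.2 ?_)
    rw [eLpNorm_two_sq]
    refine (lintegral_sq_sub_simpleIntegral hM (hZ k) (hZ l)).trans_lt ?_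
    have h0 : PredField ℱ q T (fun r ω u => (∑ i, (Ψ k i).integrand q r ω u) - Φ r ω u) :=
      (predField_simple hM (Ψ k)).sub hΦm
    have h1 : PredField ℱ q T (fun r ω u => Φ r ω u - ∑ i, (Ψ l i).integrand q r ω u) :=
      hΦm.sub (predField_simple hM (Ψ l))
    have h2 := h0.lambdaNormSq_add_le (P := P) (μ := μ) hM.form_measurable h1
    simp only [sub_add_sub_cancel] at h2
    refine h2.trans_lt (two_mul_add_two_mul_lt ((hlt k).trans (hN k hk)) ?_)
    rw [lambdaNormSq_sub_comm]
    exact (hlt l).trans (hN l hl)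
  obtain ⟨Y, hY⟩ := cauchySeq_tendsto_of_complete hcauchy
  -- Adaptedness survives the limit because the classes measurable with respect to `ℱ T` form a
  -- closed subset of L².
  have hYm : AEStronglyMeasurable[ℱ T] (Y : Ω → G) P := by
    refine (isClosed_aestronglyMeasurable (F := G) (p := 2) (μ := P) (ℱ.le T)).mem_of_tendsto hY
      (.of_forall fun k => ?_)
    exact (hZm k).congr (hZ2 k).coeFn_toLp.symm
  refine ⟨Y, ⟨hΦ, Lp.memLp Y, n, Ψ, Z, hZ, ?_, ?_⟩, hYm⟩
  · exact tendsto_of_tendsto_of_tendsto_of_le_of_le tendsto_const_nhds hδ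
      (fun _ => zero_le) fun k => (hlt k).le
  · have h1 := (Lp.tendsto_Lp_iff_tendsto_eLpNorm' _ _).1 hY
    refine h1.congr fun k => eLpNorm_congr_ae ?_
    filter_upwards [(hZ2 k).coeFn_toLp] with ω hω
    rw [Pi.sub_apply, hω]

/-- Continuity of the stochastic integral from `Λ²(M,T)` to `L²`. -/
theorem HasStochIntegral.lintegral_sq_sub_le
    {Φ Φ' : (r : ℝ≥0) → Ω → (u : U) → (q r u).Space →L[ℝ] G} {Y Y' : Ω → G}
    (hY : HasStochIntegral P ℱ R μ q M T Φ Y) (hY' : HasStochIntegral P ℱ R μ q M T Φ' Y') :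
    ∫⁻ ω, ‖Y ω - Y' ω‖ₑ ^ 2 ∂P ≤
      4 * lambdaNormSq P μ q T fun r ω u => Φ r ω u - Φ' r ω u := by
  obtain ⟨hΦ, hY2, n, Ψ, Z, hZ, hlim, hZY⟩ := hY
  obtain ⟨hΦ', hY2', n', Ψ', Z', hZ', hlim', hZY'⟩ := hY'
  have hΦm : PredField ℱ q T Φ := hΦ.predictable
  have hΦm' : PredField ℱ q T Φ' := hΦ'.predictable
  set lam := lambdaNormSq P μ q T fun r ω u => Φ r ω u - Φ' r ω u
  -- The isometry applied to `Z k - Z' k`, plus four approximation errors that vanish in the limit.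
  -- The inequality `‖x + y‖² ≤ 2‖x‖² + 2‖y‖²` acts twice on `lam`, once for random variables and
  -- once for integrands: hence the final 4. The two integrals may come from unrelated approximating
  -- sequences.
  have key : ∀ k, ∫⁻ ω, ‖Y ω - Y' ω‖ₑ ^ 2 ∂P ≤
      2 * (2 * (2 * lambdaNormSq P μ q T
        (fun r ω u => (∑ i, (Ψ k i).integrand q r ω u) - Φ r ω u)
        + 2 * lambdaNormSq P μ q T
        (fun r ω u => (∑ i, (Ψ' k i).integrand q r ω u) - Φ' r ω u)) + 2 * lam)
      + 2 * (2 * eLpNorm (fun ω => Z k ω - Y ω) 2 P ^ 2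
        + 2 * eLpNorm (fun ω => Z' k ω - Y' ω) 2 P ^ 2) := by
    intro k
    have hZm := (hZ k).aestronglyMeasurable
    have hZm' := (hZ' k).aestronglyMeasurable
    have e1 := lintegral_enorm_sub_sq_le (P := P) (f := fun ω => Z k ω - Z' k ω)
      (g := fun ω => (Z k ω - Y ω) - (Z' k ω - Y' ω)) (hZm.sub hZm')
    have e2 := lintegral_enorm_sub_sq_le (P := P) (f := fun ω => Z k ω - Y ω)
      (g := fun ω => Z' k ω - Y' ω) (hZm.sub hY2.1)
    have h0 : PredField ℱ q T (fun r ω u => (∑ i, (Ψ k i).integrand q r ω u) - Φ r ω u) :=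
      (predField_simple hM (Ψ k)).sub hΦm
    have h0' : PredField ℱ q T (fun r ω u => -((∑ i, (Ψ' k i).integrand q r ω u) - Φ' r ω u)) :=
      ((predField_simple hM (Ψ' k)).sub hΦm').neg
    have h1 : PredField ℱ q T (fun r ω u => Φ r ω u - Φ' r ω u) := hΦm.sub hΦm'
    have e3 := (h0.add h0').lambdaNormSq_add_le (P := P) (μ := μ) hM.form_measurable h1
    have e4 := h0.lambdaNormSq_add_le (P := P) (μ := μ) hM.form_measurable h0'
    rw [lambdaNormSq_neg] at e4
    rw [lintegral_sq_sub_simpleIntegral hM (hZ k) (hZ' k)] at e1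
    have e5 : ∀ ω, Z k ω - Z' k ω - (Z k ω - Y ω - (Z' k ω - Y' ω)) = Y ω - Y' ω := fun ω => by
      abel
    have e6 : ∀ r ω u, (∑ i, (Ψ k i).integrand q r ω u) - Φ r ω u +
        -((∑ i, (Ψ' k i).integrand q r ω u) - Φ' r ω u) + (Φ r ω u - Φ' r ω u) =
        (∑ i, (Ψ k i).integrand q r ω u) - ∑ i, (Ψ' k i).integrand q r ω u := fun r ω u => by
      abel
    simp only [e5] at e1
    simp only [e6] at e3
    rw [eLpNorm_two_sq, eLpNorm_two_sq]
    refine e1.trans (add_le_add (mul_le_mul_right (e3.trans ?_) _) (mul_le_mul_right e2 _))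
    exact add_le_add_left (mul_le_mul_right e4 _) _
  have c0 : ∀ {f : ℕ → ℝ≥0∞} {a : ℝ≥0∞}, Tendsto f atTop (𝓝 a) →
      Tendsto (fun k => 2 * f k) atTop (𝓝 (2 * a)) := fun h =>
    ENNReal.Tendsto.const_mul h (Or.inr (by simp))
  have hsq := ENNReal.Tendsto.pow (n := 2) hZY
  have hsq' := ENNReal.Tendsto.pow (n := 2) hZY'
  have htot := (c0 ((c0 ((c0 hlim).add (c0 hlim'))).add
    (tendsto_const_nhds (x := 2 * lam)))).add (c0 ((c0 hsq).add (c0 hsq')))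
  have hle := ge_of_tendsto' htot key
  refine hle.trans_eq ?_
  simp only [mul_zero, add_zero, zero_add, ne_eq, OfNat.ofNat_ne_zero, not_false_eq_true, zero_pow]
  rw [← mul_assoc]; norm_num

end StochasticIntegral

/-! ### Changing the time horizon. -/

section Horizon

open ContinuousLinearMap

variable {H : Type uH} [NormedAddCommGroup H] [InnerProductSpace ℝ H] [CompleteSpace H]
variable {G : Type uG} [NormedAddCommGroup G] [InnerProductSpace ℝ G] [CompleteSpace G]
variable {U : Type uU} [MeasurableSpace U]
variable {Ω : Type uO} {m : MeasurableSpace Ω} {P : Measure Ω} {ℱ : Filtration ℝ≥0 m}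
  {R : Set (Set U)} {μ : Measure U} {q : ℝ≥0 → U → HilbertianSeminorm H}
  {M : ℝ≥0 → Set U → H →ₗ[ℝ] (Ω →ₘ[P] ℝ)} {s t : ℝ≥0}
  {Φ : (r : ℝ≥0) → Ω → (u : U) → (q r u).Space →L[ℝ] G}

/-- The field `1_{[0,s]} Φ`. -/
def cutField (s : ℝ≥0) (Φ : (r : ℝ≥0) → Ω → (u : U) → (q r u).Space →L[ℝ] G) :
    (r : ℝ≥0) → Ω → (u : U) → (q r u).Space →L[ℝ] G :=
  fun r ω u => if r ≤ s then Φ r ω u else 0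

omit [CompleteSpace H] [CompleteSpace G] in
theorem lambdaNormSq_of_eq_zero (hst : s ≤ t) (h : ∀ r, s < r → ∀ ω u, Φ r ω u = 0) :
    lambdaNormSq P μ q t Φ = lambdaNormSq P μ q s Φ := by
  refine lintegral_congr fun ω => ?_
  have e : ∀ r, ∫⁻ u, hsNormSq (Φ r ω u) ∂μ =
      (Iic s).indicator (fun r => ∫⁻ u, hsNormSq (Φ r ω u) ∂μ) r := fun r => by
    by_cases hr : r ≤ s
    · simp [hr]
    · simp [hr, h r (not_le.1 hr) ω]
  rw [lintegral_congr e, lintegral_indicator measurableSet_Iic, Measure.restrict_restrict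
    measurableSet_Iic, inter_eq_left.2 (Iic_subset_Iic.2 hst)]

omit [CompleteSpace H] [CompleteSpace G] in
theorem lambdaNormSq_congr {Φ' : (r : ℝ≥0) → Ω → (u : U) → (q r u).Space →L[ℝ] G}
    (h : ∀ r ≤ t, ∀ ω u, Φ r ω u = Φ' r ω u) :
    lambdaNormSq P μ q t Φ = lambdaNormSq P μ q t Φ' := by
  refine lintegral_congr fun ω => setLIntegral_congr_fun measurableSet_Iic fun r hr => ?_
  simp only [h r hr]

omit [CompleteSpace H] in
theorem MemLambda.cutField (hst : s ≤ t) (hΦ : MemLambda P ℱ μ q s Φ) :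
    MemLambda P ℱ μ q t (cutField s Φ) where
  hilbertSchmidt r hr ω u := by
    unfold CylSPDE.cutField
    split_ifs with h
    · exact hΦ.hilbertSchmidt r h ω u
    · simp [IsHilbertSchmidt]
  predictable h g := by
    convert hΦ.predictable h g using 1
    funext p
    by_cases hp : p.1.1 ≤ s
    · simp [CylSPDE.cutField, hp, hp.trans hst]
    · simp [CylSPDE.cutField, hp]
  norm_lt_top := by
    rw [lambdaNormSq_of_eq_zero hst, lambdaNormSq_congr (Φ' := Φ)]
    · exact hΦ.norm_lt_top
    · intro r hr ω u; simp [CylSPDE.cutField, hr]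
    · intro r hr ω u; simp [CylSPDE.cutField, not_le.2 hr]

/-- An elementary datum on `[0,s]` seen as one on `[0,t]`. -/
def Elementary.extend (hst : s ≤ t) (e : Elementary H G ℱ R s) : Elementary H G ℱ R t :=
  { e with t_le := e.t_le.trans hst }

/-- The same simple integrands approximate on the larger interval, since they vanish after `s`.
Integrals up to different times thereby become integrals over one interval and can be compared. -/
theorem HasStochIntegral.cutField (hst : s ≤ t) {Y : Ω → G}
    (hY : HasStochIntegral P ℱ R μ q M s Φ Y) :
    HasStochIntegral P ℱ R μ q M t (cutField s Φ) Y := by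
  obtain ⟨hΦ, hY2, n, Ψ, Z, hZ, hlim, hZY⟩ := hY
  refine ⟨hΦ.cutField hst, hY2, n, fun k i => (Ψ k i).extend hst, Z, hZ, ?_, hZY⟩
  refine hlim.congr fun k => ?_
  have e : ∀ i r ω u, ((Ψ k i).extend hst).integrand q r ω u = (Ψ k i).integrand q r ω u :=
    fun i r ω u => rfl
  simp only [e]
  rw [lambdaNormSq_of_eq_zero hst]
  · refine lambdaNormSq_congr fun r hr ω u => ?_
    simp [CylSPDE.cutField, hr]
  · intro r hr ω u
    have h1 : ∀ i, (Ψ k i).integrand q r ω u = 0 := fun i => by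
      rw [Elementary.integrand, if_neg]
      exact fun h => absurd (h.1.2.trans (Ψ k i).t_le) (not_le.2 hr)
    simp [h1, CylSPDE.cutField, not_le.2 hr]

end Horizon

/-! ### Predictable versions of mean-square continuous adapted processes. -/

section PredictableVersion

variable {G : Type uG} [NormedAddCommGroup G] [CompleteSpace G]
variable {Ω : Type uO} {m : MeasurableSpace Ω} {P : Measure Ω} {ℱ : Filtration ℝ≥0 m}

/-- The left endpoint of the cell `(kδ, (k+1)δ]` containing `t`. -/
def gridPoint (δ t : ℝ≥0) : ℝ≥0 := (⌈t / δ⌉₊ - 1 : ℕ) * δ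

theorem gridPoint_le (δ t : ℝ≥0) : gridPoint δ t ≤ t := by
  unfold gridPoint
  rcases eq_or_ne δ 0 with rfl | hδ
  · simp
  rcases Nat.eq_zero_or_pos ⌈t / δ⌉₊ with h | h
  · simp [h]
  · have h1 : (⌈t / δ⌉₊ - 1 : ℕ) < t / δ := Nat.lt_ceil.1 (by omega)
    calc _ ≤ t / δ * δ := by gcongr
      _ = t := div_mul_cancel₀ t hδ

theorem le_gridPoint_add {δ : ℝ≥0} (hδ : δ ≠ 0) (t : ℝ≥0) : t ≤ gridPoint δ t + δ := by
  unfold gridPoint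
  have h1 : t / δ ≤ (⌈t / δ⌉₊ - 1 : ℕ) + 1 := by
    refine (Nat.le_ceil _).trans ?_
    exact_mod_cast (by omega : ⌈t / δ⌉₊ ≤ ⌈t / δ⌉₊ - 1 + 1)
  calc t = t / δ * δ := (div_mul_cancel₀ t hδ).symm
    _ ≤ ((⌈t / δ⌉₊ - 1 : ℕ) + 1) * δ := by gcongr
    _ = _ := by ring

/-- Truncated subtraction sends `t = 0` to cell `0` as well, the only cell that is not a half-open
interval. -/
theorem gridPoint_eq {δ : ℝ≥0} (hδ : δ ≠ 0) {t : ℝ≥0} {k : ℕ} :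
    ⌈t / δ⌉₊ - 1 = k ↔ (k = 0 ∧ t = 0) ∨ t ∈ Ioc (k * δ) ((k + 1) * δ) := by
  have hδ' : 0 < δ := pos_iff_ne_zero.2 hδ
  rcases eq_or_ne t 0 with rfl | ht
  · simp [eq_comm]
  · have h0 : ⌈t / δ⌉₊ ≠ 0 := by
      have : 0 < t / δ := div_pos (pos_iff_ne_zero.2 ht) hδ'
      exact (Nat.ceil_pos.2 this).ne'
    have h1 : ⌈t / δ⌉₊ - 1 = k ↔ ⌈t / δ⌉₊ = k + 1 := by omega
    rw [h1, Nat.ceil_eq_iff (by omega), mem_Ioc, lt_div_iff₀ hδ', div_le_iff₀ hδ']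
    simp [ht]

omit [CompleteSpace G] in
/-- Freezing an adapted process at the left endpoints of a grid gives a predictable process. -/
theorem isStronglyPredictable_gridPoint [SecondCountableTopology G] {W : ℝ≥0 → Ω → G}
    (hW : ∀ t, StronglyMeasurable[ℱ t] (W t)) {δ : ℝ≥0} (hδ : δ ≠ 0) :
    IsStronglyPredictable ℱ fun t => W (gridPoint δ t) := by
  borelize G
  refine Measurable.stronglyMeasurable (fun B hB => ?_)
  have e : (Function.uncurry fun t => W (gridPoint δ t)) ⁻¹' B =
      ⋃ k : ℕ, ((fun t : ℝ≥0 => ⌈t / δ⌉₊ - 1) ⁻¹' {k}) ×ˢ (W (k * δ) ⁻¹' B) := by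
    ext ⟨t, ω⟩
    simp [gridPoint, Function.uncurry]
  rw [e]
  refine MeasurableSet.iUnion fun k => ?_
  rcases Nat.eq_zero_or_pos k with rfl | hk
  · have e2 : ((fun t : ℝ≥0 => ⌈t / δ⌉₊ - 1) ⁻¹' {0}) ×ˢ (W ((0 : ℕ) * δ) ⁻¹' B) =
        {⊥} ×ˢ (W ((0 : ℕ) * δ) ⁻¹' B) ∪ Ioc 0 δ ×ˢ (W ((0 : ℕ) * δ) ⁻¹' B) := by
      ext ⟨t, ω⟩
      simp only [mem_prod, mem_preimage, mem_singleton_iff, gridPoint_eq hδ, mem_union,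
        bot_eq_zero']
      simp only [Nat.cast_zero, zero_mul, zero_add, one_mul, true_and, or_and_right]
    rw [e2]
    have hA := (hW 0).measurable hB
    simp only [Nat.cast_zero, zero_mul]
    exact (measurableSet_predictable_singleton_bot_prod hA).union
      (measurableSet_predictable_Ioc_prod _ _ hA)
  · have e2 : (fun t : ℝ≥0 => ⌈t / δ⌉₊ - 1) ⁻¹' {k} = Ioc (k * δ) ((k + 1) * δ) := by
      ext t
      simp only [mem_preimage, mem_singleton_iff, gridPoint_eq hδ]
      simp [hk.ne']
    rw [e2]
    exact measurableSet_predictable_Ioc_prod _ _ ((hW (k * δ)).measurable hB)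

-- Finite total expectation makes the series of squared errors finite almost surely, so its terms
-- tend to zero.
omit [CompleteSpace G] in
theorem ae_tendsto_of_tsum_lintegral_sq {f : ℕ → Ω → G} {g : Ω → G}
    (hf : ∀ n, AEStronglyMeasurable (fun ω => f n ω - g ω) P)
    (h : ∑' n, ∫⁻ ω, ‖f n ω - g ω‖ₑ ^ 2 ∂P ≠ ∞) :
    ∀ᵐ ω ∂P, Tendsto (fun n => f n ω) atTop (𝓝 (g ω)) := by
  have hm : ∀ n, AEMeasurable (fun ω => ‖f n ω - g ω‖ₑ ^ 2) P := fun n =>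
    (hf n).enorm.pow_const 2
  rw [← lintegral_tsum hm] at h
  filter_upwards [ae_lt_top' (AEMeasurable.tsum hm) h] with ω hω
  have h1 := ENNReal.tendsto_atTop_zero_of_tsum_ne_top hω.ne
  have h2 : Tendsto (fun n => (‖f n ω - g ω‖ₑ ^ 2) ^ (1 / 2 : ℝ)) atTop (𝓝 0) := by
    have := (ENNReal.continuous_rpow_const (y := 1 / 2)).tendsto 0 |>.comp h1
    simpa [Function.comp_def] using this
  rw [tendsto_iff_edist_tendsto_0]
  refine h2.congr fun n => ?_
  rw [← ENNReal.rpow_natCast, ← ENNReal.rpow_mul, edist_eq_enorm_sub]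
  norm_num

/-- A mean-square continuous adapted process has a predictable version. -/
theorem exists_predictable_version [SecondCountableTopology G] [Fact ((1 : ℝ≥0∞) ≤ 2)]
    {I : ℝ≥0 → Lp G 2 P} (hI : Continuous I) (hm : ∀ t, AEStronglyMeasurable[ℱ t] (I t) P) :
    ∃ X : ℝ≥0 → Ω → G, IsStronglyPredictable ℱ X ∧ ∀ t, X t =ᵐ[P] I t := by
  choose W hW hIW using hm
  -- Uniform continuity on `[0,n]` supplies a mesh with error `2⁻ⁿ`, which is square summable.
  have hδ : ∀ n : ℕ, ∃ δ : ℝ≥0, δ ≠ 0 ∧ ∀ t ≤ (n : ℝ≥0),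
      edist (I (gridPoint δ t)) (I t) ≤ (2⁻¹ : ℝ≥0∞) ^ n := by
    intro n
    have huc := isCompact_Icc (a := (0 : ℝ≥0)) (b := n) |>.uniformContinuousOn_of_continuous
      hI.continuousOn
    obtain ⟨ε, hε, h⟩ := EMetric.uniformContinuousOn_iff.1 huc ((2⁻¹ : ℝ≥0∞) ^ n)
      (ENNReal.pow_pos (by simp) n)
    obtain ⟨δ, hδ0, hδ⟩ := ENNReal.lt_iff_exists_nnreal_btwn.1 hε
    refine ⟨δ, by simpa using hδ0.ne', fun t ht => (h ?_ ?_ ?_).le⟩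
    · exact ⟨zero_le, (gridPoint_le δ t).trans ht⟩
    · exact ⟨zero_le, ht⟩
    · refine lt_of_le_of_lt ?_ hδ
      rw [edist_nndist, NNReal.nndist_eq, ENNReal.coe_le_coe]
      refine max_le ?_ ?_
      · rw [tsub_eq_zero_of_le (gridPoint_le δ t)]; exact zero_le
      · rw [tsub_le_iff_left]
        exact le_gridPoint_add (by simpa using hδ0.ne') t
  choose δ hδ0 hδ using hδ
  -- The limit is taken at every `(t, ω)`, with a default value where it fails to exist; this keeps
  -- predictability and matters only on a null set for each fixed `t`.
  refine ⟨fun t ω => limUnder atTop fun n => W (gridPoint (δ n) t) ω, ?_, fun t => ?_⟩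
  · exact @StronglyMeasurable.limUnder _ _ _ ℱ.predictable _ _ _ _
      (fun n (p : ℝ≥0 × Ω) => W (gridPoint (δ n) p.1) p.2) _ _
      fun n => isStronglyPredictable_gridPoint hW (hδ0 n)
  · obtain ⟨N, hN⟩ := exists_nat_ge t
    -- The `n`-th mesh is controlled only on `[0,n]`, hence the shift by `N ≥ t`.
    have hlim : ∀ᵐ ω ∂P, Tendsto (fun n => W (gridPoint (δ (n + N)) t) ω) atTop
        (𝓝 (I t ω)) := by
      refine ae_tendsto_of_tsum_lintegral_sq (f := fun n => W (gridPoint (δ (n + N)) t))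
        (fun n => ((hW _).mono (ℱ.le _)).aestronglyMeasurable.sub (Lp.aestronglyMeasurable _)) ?_
      have hb : ∀ n, ∫⁻ ω, ‖W (gridPoint (δ (n + N)) t) ω - I t ω‖ₑ ^ 2 ∂P ≤
          (2⁻¹ : ℝ≥0∞) ^ n := fun n => by
        have h1 := hδ (n + N) t (hN.trans (by push_cast; exact le_add_self))
        rw [Lp.edist_def] at h1
        have h2 : eLpNorm (fun ω => W (gridPoint (δ (n + N)) t) ω - I t ω) 2 P ≤
            (2⁻¹ : ℝ≥0∞) ^ (n + N) := by
          refine le_trans (le_of_eq (eLpNorm_congr_ae ?_)) h1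
          filter_upwards [hIW (gridPoint (δ (n + N)) t)] with ω hω
          rw [Pi.sub_apply, hω]
        rw [← eLpNorm_two_sq]
        calc _ ≤ ((2⁻¹ : ℝ≥0∞) ^ (n + N)) ^ 2 := by gcongr
          _ = (2⁻¹ : ℝ≥0∞) ^ (2 * (n + N)) := by rw [← pow_mul, mul_comm]
          _ ≤ (2⁻¹ : ℝ≥0∞) ^ n := pow_le_pow_right_of_le_one' (by simp) (by omega)
      refine ((ENNReal.tsum_le_tsum hb).trans_lt ?_).ne
      rw [ENNReal.tsum_geometric]
      simp
    filter_upwards [hlim] with ω hω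
    exact ((tendsto_add_atTop_iff_nat (f := fun n => W (gridPoint (δ n) t) ω) N).1 hω).limUnder_eq

end PredictableVersion

/-! ### Exponential weights for Volterra kernels. -/

section Weights

/-- The Cauchy-Schwarz inequality for a weighted integral. -/
theorem lintegral_mul_sq_le {X : Type*} {mX : MeasurableSpace X} {ν : Measure X} {k f : X → ℝ≥0∞}
    (hk : AEMeasurable k ν) (hf : AEMeasurable f ν) :
    (∫⁻ x, k x * f x ∂ν) ^ 2 ≤ (∫⁻ x, k x ∂ν) * ∫⁻ x, k x * f x ^ 2 ∂ν := by
  have h := ENNReal.lintegral_mul_le_Lp_mul_Lq ν Real.HolderConjugate.two_two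
    (f := fun x => k x ^ (1 / 2 : ℝ)) (g := fun x => k x ^ (1 / 2 : ℝ) * f x)
    (hk.pow_const _) ((hk.pow_const _).mul hf)
  have e0 : ∀ y : ℝ≥0∞, y ^ (1 / 2 : ℝ) * y ^ (1 / 2 : ℝ) = y := fun y => by
    rw [← ENNReal.rpow_add_of_nonneg _ _ (by norm_num) (by norm_num)]; norm_num
  have e2 : ∀ y : ℝ≥0∞, (y ^ (1 / 2 : ℝ)) ^ (2 : ℝ) = y := fun y => by
    rw [← ENNReal.rpow_mul]; norm_num
  have e3 : ∀ x, (k x ^ (1 / 2 : ℝ) * f x) ^ (2 : ℝ) = k x * f x ^ 2 := fun x => by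
    rw [ENNReal.mul_rpow_of_nonneg _ _ (by norm_num), e2, ENNReal.rpow_ofNat]
  have e1 : ∀ x, ((fun x => k x ^ (1 / 2 : ℝ)) * fun x => k x ^ (1 / 2 : ℝ) * f x) x =
      k x * f x := fun x => by
    rw [Pi.mul_apply, ← mul_assoc, e0]
  simp only [e1, e2, e3] at h
  calc _ ≤ ((∫⁻ x, k x ∂ν) ^ (1 / 2 : ℝ) * (∫⁻ x, k x * f x ^ 2 ∂ν) ^ (1 / 2 : ℝ)) ^ 2 := by gcongr
    _ = _ := by
      rw [mul_pow, sq, sq, e0, e0]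

theorem lintegral_exp_le (t : ℝ≥0) {c : ℝ} (hc : 0 < c) :
    ∫⁻ r in Iic t, ENNReal.ofReal (Real.exp (c * r)) ∂leb ≤
      ENNReal.ofReal (Real.exp (c * t) / c) := by
  rw [lintegral_leb (fun r => ENNReal.ofReal (Real.exp (c * r)))]
  have h1 : ((↑) : ℝ≥0 → ℝ) '' Iic t ⊆ Iic (t : ℝ) := by
    rintro _ ⟨x, hx, rfl⟩; exact_mod_cast hx
  refine (lintegral_mono_set h1).trans (le_of_eq ?_)
  rw [← ofReal_integral_eq_lintegral_ofReal (integrableOn_exp_mul_Iic hc _)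
    (.of_forall fun _ => (Real.exp_pos _).le), integral_exp_mul_Iic hc]

/-- An exponential weight that makes a Volterra kernel with integrable bound small. -/
theorem exists_exp_weight (T : ℝ≥0) {k : ℝ≥0 → ℝ≥0∞} (hk : AEMeasurable k (leb.restrict (Iic T)))
    (hkT : ∫⁻ r in Iic T, k r ∂leb ≠ ∞) :
    ∃ c : ℝ, 0 < c ∧ ∀ t ≤ T, ∫⁻ r in Iic t, k r * ENNReal.ofReal (Real.exp (c * r)) ∂leb ≤
      ENNReal.ofReal (Real.exp (c * t)) / 4 := by
  -- Truncated subtraction gives the excess of `k` over level `N`; its integral tends to zero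
  -- because `k` is integrable.
  have h1 : Tendsto (fun N : ℕ => ∫⁻ r in Iic T, (k r - N) ∂leb) atTop
      (𝓝 (∫⁻ _ in Iic T, 0 ∂leb)) := by
    refine tendsto_lintegral_of_dominated_convergence' k (fun N => hk.sub_const _)
      (fun N => .of_forall fun r => tsub_le_self) hkT ?_
    filter_upwards [ae_lt_top' hk hkT] with r hr
    obtain ⟨n, hn⟩ := ENNReal.exists_nat_gt hr.ne
    refine tendsto_const_nhds.congr' ?_
    filter_upwards [eventually_ge_atTop n] with N hN
    rw [tsub_eq_zero_of_le]
    exact hn.le.trans (by exact_mod_cast hN)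
  rw [lintegral_zero] at h1
  obtain ⟨N, hN⟩ := (h1.eventually_lt_const (show (0 : ℝ≥0∞) < 8⁻¹ by simp)).exists
  -- The bounded part contributes at most `(N / c) e^{ct} ≤ e^{ct} / 8`, and the excess at most
  -- `e^{ct} / 8`. The `+ 1` keeps `c` positive when `N = 0`.
  refine ⟨8 * N + 1, by positivity, fun t ht => ?_⟩
  set c : ℝ := 8 * N + 1
  have hc : 0 < c := by positivity
  set w : ℝ≥0 → ℝ≥0∞ := fun r => ENNReal.ofReal (Real.exp (c * r))
  have hkt : AEMeasurable k (leb.restrict (Iic t)) :=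
    hk.mono_measure (Measure.restrict_mono (Iic_subset_Iic.2 ht) le_rfl)
  have hw : Measurable w := by
    refine ENNReal.measurable_ofReal.comp (Real.measurable_exp.comp ?_)
    exact (measurable_const.mul measurable_coe_nnreal_real)
  have hsplit : ∀ r, k r * w r ≤ N * w r + (k r - N) * w r := fun r => by
    rw [← add_mul]; gcongr; exact le_add_tsub
  have hmono : ∀ r ≤ t, w r ≤ w t := fun r hr => by
    refine ENNReal.ofReal_le_ofReal (Real.exp_le_exp.2 ?_)
    gcongr
  have hA : ∫⁻ r in Iic t, N * w r ∂leb ≤ w t / 8 := by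
    rw [lintegral_const_mul _ hw]
    refine (mul_le_mul_right (lintegral_exp_le t hc) _).trans ?_
    rw [← ENNReal.ofReal_natCast, ← ENNReal.ofReal_mul (by positivity)]
    have : w t / 8 = ENNReal.ofReal (Real.exp (c * t) / 8) := by
      rw [ENNReal.ofReal_div_of_pos (by norm_num)]; simp [w]
    rw [this]
    refine ENNReal.ofReal_le_ofReal ?_
    rw [mul_div_assoc', div_le_div_iff₀ hc (by norm_num)]
    have := Real.exp_pos (c * t)
    nlinarith
  have hB : ∫⁻ r in Iic t, (k r - N) * w r ∂leb ≤ w t / 8 := by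
    calc _ ≤ ∫⁻ r in Iic t, (k r - N) * w t ∂leb :=
          setLIntegral_mono' measurableSet_Iic fun r hr => by gcongr; exact hmono r hr
      _ = (∫⁻ r in Iic t, (k r - N) ∂leb) * w t := by
          rw [lintegral_mul_const'' _ (hkt.sub_const _)]
      _ ≤ 8⁻¹ * w t := by
          gcongr
          exact (lintegral_mono_set (Iic_subset_Iic.2 ht)).trans hN.le
      _ = w t / 8 := by rw [mul_comm, div_eq_mul_inv]
  calc ∫⁻ r in Iic t, k r * w r ∂leb ≤ ∫⁻ r in Iic t, (N * w r + (k r - N) * w r) ∂leb :=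
        lintegral_mono hsplit
    _ = ∫⁻ r in Iic t, N * w r ∂leb + ∫⁻ r in Iic t, (k r - N) * w r ∂leb :=
        lintegral_add_left (hw.const_mul _) _
    _ ≤ w t / 8 + w t / 8 := add_le_add hA hB
    _ = w t / 4 := by
        rw [← two_mul, mul_comm, div_eq_mul_inv, div_eq_mul_inv, mul_assoc]
        congr 1
        rw [← ENNReal.toReal_eq_toReal_iff' (by finiteness) (by finiteness)]
        simp; norm_num

end Weights

/-! ### Bounds, continuity and measurability of the semigroup. -/

section SemigroupLemmas

variable {G : Type uG} [NormedAddCommGroup G] [InnerProductSpace ℝ G]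
  {S : ℝ≥0 → G →L[ℝ] G}

/-- Orbits are bounded on compact time intervals, so the uniform boundedness principle applies. -/
theorem IsC0Semigroup.exists_bound [CompleteSpace G] (hS : IsC0Semigroup S) (T : ℝ≥0) :
    ∃ c : ℝ≥0, ∀ t ≤ T, ‖S t‖ₑ ≤ c := by
  obtain ⟨C, hC⟩ := banach_steinhaus (g := fun t : Iic T => S t) fun x => by
    have hc : IsCompact ((fun t => ‖S t x‖) '' Icc 0 T) :=
      isCompact_Icc.image (hS.continuous x).norm
    obtain ⟨C, hC⟩ := hc.bddAbove
    exact ⟨C, fun t => hC ⟨t, ⟨zero_le, t.2⟩, rfl⟩⟩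
  refine ⟨C.toNNReal, fun t ht => ?_⟩
  rw [← ofReal_norm]
  exact ENNReal.ofReal_le_ofReal (hC ⟨t, ht⟩)

/-- The evolution operator `1_{r ≤ t} S(t - r)`. -/
def evol (S : ℝ≥0 → G →L[ℝ] G) (t r : ℝ≥0) : G →L[ℝ] G := if r ≤ t then S (t - r) else 0

theorem evol_of_le {t r : ℝ≥0} (h : r ≤ t) : evol S t r = S (t - r) := if_pos h

theorem evol_of_lt {t r : ℝ≥0} (h : t < r) : evol S t r = 0 := if_neg (not_le.2 h)

theorem enorm_evol_le {T : ℝ≥0} {c : ℝ≥0} (hc : ∀ t ≤ T, ‖S t‖ₑ ≤ c) {t : ℝ≥0} (ht : t ≤ T)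
    (r : ℝ≥0) : ‖evol S t r‖ₑ ≤ c := by
  unfold evol
  split_ifs
  · exact hc _ (tsub_le_self.trans ht)
  · simp

/-- At `r = t₀` the cutoff jumps; this single instant is Lebesgue-null and is discarded in every
use. -/
theorem IsC0Semigroup.tendsto_evol (hS : IsC0Semigroup S) {t₀ r : ℝ≥0} (hr : r ≠ t₀) (x : G) :
    Tendsto (fun t => evol S t r x) (𝓝 t₀) (𝓝 (evol S t₀ r x)) := by
  rcases lt_or_gt_of_ne hr with h | h
  · rw [evol_of_le h.le]
    have h1 : Tendsto (fun t : ℝ≥0 => S (t - r) x) (𝓝 t₀) (𝓝 (S (t₀ - r) x)) :=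
      ((hS.continuous x).comp (continuous_id.sub continuous_const)).tendsto t₀
    refine h1.congr' ?_
    filter_upwards [lt_mem_nhds h] with t ht
    rw [evol_of_le ht.le]
  · rw [evol_of_lt h]
    refine tendsto_const_nhds.congr' ?_
    filter_upwards [gt_mem_nhds h] with t ht
    rw [evol_of_lt ht]

theorem IsC0Semigroup.measurable_evol_apply [MeasurableSpace G] [BorelSpace G]
    (hS : IsC0Semigroup S) (t : ℝ≥0) (g : G) : Measurable fun r => evol S t r g := by
  have h1 : Measurable fun r : ℝ≥0 => S (t - r) g :=
    ((hS.continuous g).comp (continuous_const.sub continuous_id)).measurable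
  have e : (fun r => evol S t r g) = (Iic t).indicator fun r => S (t - r) g := by
    funext r
    by_cases hr : r ≤ t <;> simp [evol, hr]
  rw [e]
  exact h1.indicator measurableSet_Iic

/-- A Carathéodory function: continuous in the vector, measurable in time. -/
theorem IsC0Semigroup.measurable_evol [MeasurableSpace G] [BorelSpace G]
    [SecondCountableTopology G] (hS : IsC0Semigroup S) (t : ℝ≥0) :
    Measurable fun p : G × ℝ≥0 => evol S t p.2 p.1 :=
  measurable_uncurry_of_continuous_of_measurable (u := fun (g : G) (r : ℝ≥0) => evol S t r g)
    (fun r => (evol S t r).continuous) fun g => hS.measurable_evol_apply t g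

end SemigroupLemmas

/-! ### The drift convolution. -/

section Drift

variable {G : Type uG} [NormedAddCommGroup G] [InnerProductSpace ℝ G]
variable {Ω : Type uO} {m : MeasurableSpace Ω} {P : Measure Ω} {ℱ : Filtration ℝ≥0 m}

theorem ae_pos_leb (T : ℝ≥0) : ∀ᵐ r ∂leb.restrict (Iic T), 0 < r := by
  have h : ∀ᵐ r ∂leb.restrict (Iic T), r ∉ ({0} : Set ℝ≥0) :=
    measure_eq_zero_iff_ae_notMem.1 (measure_singleton 0)
  filter_upwards [h] with r hr
  exact pos_iff_ne_zero.2 hr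

-- Cauchy–Schwarz with weight `a`, then Tonelli. The weighted form is needed since `a` is integrable
-- but not necessarily square integrable.
omit [InnerProductSpace ℝ G] in
theorem lintegral_sq_lintegral_le [SFinite P] {T : ℝ≥0} {W : ℝ≥0 → Ω → G} {a : ℝ≥0 → ℝ≥0∞}
    {N : ℝ≥0 → Ω → ℝ≥0∞} (ha : AEMeasurable a (leb.restrict (Iic T)))
    (hN : Measurable fun p : ℝ≥0 × Ω => N p.1 p.2)
    (hW : ∀ r > 0, ∀ ω, ‖W r ω‖ₑ ≤ a r * N r ω) :
    ∫⁻ ω, (∫⁻ r in Iic T, ‖W r ω‖ₑ ∂leb) ^ 2 ∂P ≤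
      (∫⁻ r in Iic T, a r ∂leb) * ∫⁻ r in Iic T, a r * ∫⁻ ω, N r ω ^ 2 ∂P ∂leb := by
  have hNω : ∀ ω, Measurable fun r => N r ω := fun ω => hN.comp measurable_prodMk_right
  have hNr : ∀ r, Measurable fun ω => N r ω := fun ω => hN.comp measurable_prodMk_left
  have h1 : ∀ ω, (∫⁻ r in Iic T, ‖W r ω‖ₑ ∂leb) ^ 2 ≤
      (∫⁻ r in Iic T, a r ∂leb) * ∫⁻ r in Iic T, a r * N r ω ^ 2 ∂leb := fun ω => by
    refine le_trans ?_ (lintegral_mul_sq_le ha (hNω ω).aemeasurable)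
    refine pow_le_pow_left' (lintegral_mono_ae ?_) 2
    filter_upwards [ae_pos_leb T] with r hr using hW r hr ω
  refine (lintegral_mono h1).trans ?_
  have hm : AEMeasurable (Function.uncurry fun (ω : Ω) r => a r * N r ω ^ 2)
      (P.prod (leb.restrict (Iic T))) :=
    (ha.comp_quasiMeasurePreserving Measure.quasiMeasurePreserving_snd).mul
      ((hN.comp measurable_swap).pow_const 2).aemeasurable
  have h2 : ∫⁻ ω, ∫⁻ r in Iic T, a r * N r ω ^ 2 ∂leb ∂P =
      ∫⁻ r in Iic T, a r * ∫⁻ ω, N r ω ^ 2 ∂P ∂leb := by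
    rw [lintegral_lintegral_swap hm]
    exact lintegral_congr fun r => lintegral_const_mul _ ((hNr r).pow_const 2)
  rw [← h2, lintegral_const_mul'' (f := fun ω => ∫⁻ r in Iic T, a r * N r ω ^ 2 ∂leb) _
    hm.lintegral_prod_right']

variable (ℱ P) in
/-- A predictable process `V` with `E (∫_0^T ‖V_r‖ dr)² < ∞` for each `T`. -/
structure IsDrift (V : ℝ≥0 → Ω → G) : Prop where
  predictable : IsStronglyPredictable ℱ V
  moment : ∀ T, ∫⁻ ω, (∫⁻ r in Iic T, ‖V r ω‖ₑ ∂leb) ^ 2 ∂P ≠ ∞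

/-- The convolution `∫_0^t S(t - r) V_r dr`. -/
def driftConv (S : ℝ≥0 → G →L[ℝ] G) (V : ℝ≥0 → Ω → G) (t : ℝ≥0) (ω : Ω) : G :=
  ∫ r in Iic t, S (t - r) (V r ω) ∂leb

variable {S : ℝ≥0 → G →L[ℝ] G} {V V' : ℝ≥0 → Ω → G}

omit [InnerProductSpace ℝ G] in
theorem IsDrift.stronglyMeasurable (hV : IsDrift P ℱ V) :
    StronglyMeasurable fun p : ℝ≥0 × Ω => V p.1 p.2 :=
  StronglyMeasurable.mono hV.predictable (predictable_le ℱ)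

/-- A time-independent domain of integration allows convolutions at different times to be
subtracted. -/
theorem driftConv_eq_evol {t T : ℝ≥0} (ht : t ≤ T) (ω : Ω) :
    driftConv S V t ω = ∫ r in Iic T, evol S t r (V r ω) ∂leb := by
  have h1 : ∫ r in Iic T, evol S t r (V r ω) ∂leb = ∫ r in Iic t, evol S t r (V r ω) ∂leb := by
    refine (setIntegral_eq_of_subset_of_forall_sdiff_eq_zero measurableSet_Iic
      (Iic_subset_Iic.2 ht) fun r hr => ?_)
    rw [evol_of_lt (not_le.1 hr.2)]; simp
  rw [h1]
  refine setIntegral_congr_fun measurableSet_Iic fun r hr => ?_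
  simp only [evol_of_le (mem_Iic.1 hr)]

omit [InnerProductSpace ℝ G] in
theorem IsDrift.ae_lt_top (hV : IsDrift P ℱ V) (T : ℝ≥0) :
    ∀ᵐ ω ∂P, ∫⁻ r in Iic T, ‖V r ω‖ₑ ∂leb < ∞ := by
  have hm : Measurable fun ω => ∫⁻ r in Iic T, ‖V r ω‖ₑ ∂leb :=
    (hV.stronglyMeasurable.enorm.comp measurable_swap).lintegral_prod_right'
  filter_upwards [MeasureTheory.ae_lt_top (hm.pow_const 2) (hV.moment T)] with ω hω
  simpa using hω

variable [MeasurableSpace G] [BorelSpace G] [SecondCountableTopology G]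

theorem IsDrift.aestronglyMeasurable_evol (hV : IsDrift P ℱ V) (hS : IsC0Semigroup S)
    (t T : ℝ≥0) (ω : Ω) :
    AEStronglyMeasurable (fun r => evol S t r (V r ω)) (leb.restrict (Iic T)) :=
  ((hS.measurable_evol t).comp ((hV.stronglyMeasurable.measurable.comp
    measurable_prodMk_right).prodMk measurable_id)).aestronglyMeasurable

omit [MeasurableSpace G] [BorelSpace G] [SecondCountableTopology G] in
theorem lintegral_enorm_evol_le [CompleteSpace G] {T : ℝ≥0} {c : ℝ≥0} (hc : ∀ t ≤ T, ‖S t‖ₑ ≤ c)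
    {t : ℝ≥0} (ht : t ≤ T) (f : ℝ≥0 → G) :
    ∫⁻ r in Iic T, ‖evol S t r (f r)‖ₑ ∂leb ≤ c * ∫⁻ r in Iic T, ‖f r‖ₑ ∂leb := by
  rw [← lintegral_const_mul' _ _ (by simp)]
  exact lintegral_mono fun r => ((evol S t r).le_opENorm _).trans
    (mul_le_mul_left (enorm_evol_le hc ht r) _)

theorem IsDrift.integrable_evol [CompleteSpace G] (hV : IsDrift P ℱ V) (hS : IsC0Semigroup S)
    {t T : ℝ≥0} (ht : t ≤ T) {ω : Ω} (hω : ∫⁻ r in Iic T, ‖V r ω‖ₑ ∂leb < ∞) :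
    IntegrableOn (fun r => evol S t r (V r ω)) (Iic T) leb := by
  obtain ⟨c, hc⟩ := hS.exists_bound T
  refine ⟨hV.aestronglyMeasurable_evol hS t T ω, ?_⟩
  exact (lintegral_enorm_evol_le hc ht _).trans_lt (ENNReal.mul_lt_top (by simp) hω)

theorem IsDrift.ae_integrableOn [CompleteSpace G] (hV : IsDrift P ℱ V) (hS : IsC0Semigroup S)
    (t : ℝ≥0) : ∀ᵐ ω ∂P, IntegrableOn (fun r => S (t - r) (V r ω)) (Iic t) leb := by
  filter_upwards [hV.ae_lt_top t] with ω hω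
  refine (hV.integrable_evol hS le_rfl hω).congr_fun (fun r hr => ?_) measurableSet_Iic
  simp only [evol_of_le (mem_Iic.1 hr)]

/-- Adaptedness of the drift convolution. -/
theorem IsDrift.stronglyMeasurable_driftConv (hV : IsDrift P ℱ V) (hS : IsC0Semigroup S)
    (t : ℝ≥0) : StronglyMeasurable[ℱ t] (driftConv S V t) := by
  have hfin : IsFiniteMeasure (leb.comap ((↑) : Iic t → ℝ≥0)) := ⟨by
    rw [(MeasurableEmbedding.subtype_coe measurableSet_Iic).comap_apply]
    exact (measure_mono (Subtype.coe_image_subset _ _)).trans_lt (leb_Iic_lt_top t)⟩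
  -- Predictability implies progressive measurability, so on `[0,t] × Ω` only information from `ℱ t`
  -- enters.
  have h1 := hV.predictable.isStronglyProgressive t
  have h2 : StronglyMeasurable[Prod.instMeasurableSpace (m₂ := ℱ t)]
      fun p : Iic t × Ω => evol S t p.1 (V p.1 p.2) := by
    let := ℱ t
    exact ((hS.measurable_evol t).comp (h1.measurable.prodMk
      (measurable_subtype_coe.comp measurable_fst))).stronglyMeasurable
  have h3 : driftConv S V t = fun ω => ∫ r : Iic t, evol S t r (V r ω)
      ∂(leb.comap ((↑) : Iic t → ℝ≥0)) := by
    funext ω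
    rw [driftConv_eq_evol le_rfl,
      integral_subtype_comap measurableSet_Iic fun r : ℝ≥0 => evol S t r (V r ω)]
  rw [h3]
  let := ℱ t
  exact h2.integral_prod_left

theorem IsDrift.lintegral_sq_sub_le [CompleteSpace G] (hV : IsDrift P ℱ V)
    (hV' : IsDrift P ℱ V') (hS : IsC0Semigroup S) {t T : ℝ≥0} {c : ℝ≥0}
    (hc : ∀ t ≤ T, ‖S t‖ₑ ≤ c) (ht : t ≤ T) :
    ∫⁻ ω, ‖driftConv S V t ω - driftConv S V' t ω‖ₑ ^ 2 ∂P ≤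
      c ^ 2 * ∫⁻ ω, (∫⁻ r in Iic t, ‖V r ω - V' r ω‖ₑ ∂leb) ^ 2 ∂P := by
  rw [← lintegral_const_mul' _ _ (by simp)]
  refine lintegral_mono_ae ?_
  filter_upwards [hV.ae_lt_top t, hV'.ae_lt_top t] with ω h1 h2
  rw [← mul_pow, driftConv_eq_evol le_rfl, driftConv_eq_evol le_rfl,
    ← integral_sub (hV.integrable_evol hS le_rfl h1) (hV'.integrable_evol hS le_rfl h2)]
  refine pow_le_pow_left' ((enorm_integral_le_lintegral_enorm _).trans ?_) 2
  simp_rw [← map_sub]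
  exact lintegral_enorm_evol_le (fun s hs => hc s (hs.trans ht)) le_rfl _

theorem IsDrift.lintegral_sq_lt_top [CompleteSpace G] (hV : IsDrift P ℱ V)
    (hS : IsC0Semigroup S) (t : ℝ≥0) : ∫⁻ ω, ‖driftConv S V t ω‖ₑ ^ 2 ∂P < ∞ := by
  obtain ⟨c, hc⟩ := hS.exists_bound t
  -- Square integrability is the difference bound compared with zero drift.
  have h0 : IsDrift P ℱ fun _ _ => (0 : G) := ⟨stronglyMeasurable_const, by simp⟩
  have h := hV.lintegral_sq_sub_le h0 hS hc le_rfl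
  simp only [driftConv, map_zero, integral_zero, sub_zero] at h
  exact h.trans_lt (ENNReal.mul_lt_top (by simp) (hV.moment t).lt_top)

/-- Mean square continuity of the drift convolution. -/
theorem IsDrift.tendsto_driftConv [CompleteSpace G] (hV : IsDrift P ℱ V) (hS : IsC0Semigroup S)
    (t₀ : ℝ≥0) :
    Tendsto (fun t => ∫⁻ ω, ‖driftConv S V t ω - driftConv S V t₀ ω‖ₑ ^ 2 ∂P) (𝓝 t₀) (𝓝 0) := by
  set T := t₀ + 1
  have hT : t₀ ≤ T := le_self_add
  obtain ⟨c, hc⟩ := hS.exists_bound T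
  set N : Ω → ℝ≥0∞ := fun ω => ∫⁻ r in Iic T, ‖V r ω‖ₑ ∂leb
  have hnhds : ∀ᶠ t in 𝓝 t₀, t ≤ T := by
    filter_upwards [gt_mem_nhds (show t₀ < T from lt_add_one t₀)] with t ht using ht.le
  set g : ℝ≥0 → Ω → ℝ≥0∞ := fun t ω =>
    ∫⁻ r in Iic T, ‖evol S t r (V r ω) - evol S t₀ r (V r ω)‖ₑ ∂leb
  have hptw : ∀ t ≤ T, ∀ r ω, ‖evol S t r (V r ω) - evol S t₀ r (V r ω)‖ₑ ≤
      2 * c * ‖V r ω‖ₑ := fun t ht r ω => by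
    refine enorm_sub_le.trans ?_
    rw [two_mul, add_mul]
    exact add_le_add (((evol S t r).le_opENorm _).trans (mul_le_mul_left (enorm_evol_le hc ht r) _))
      (((evol S t₀ r).le_opENorm _).trans (mul_le_mul_left (enorm_evol_le hc hT r) _))
  have hgN : ∀ t ≤ T, ∀ ω, g t ω ≤ 2 * c * N ω := fun t ht ω => by
    rw [← lintegral_const_mul' _ _ (by finiteness)]
    exact lintegral_mono fun r => hptw t ht r ω
  have hg : ∀ t, Measurable (g t) := fun t => by
    have h1 : ∀ s, Measurable fun p : Ω × ℝ≥0 => evol S s p.2 (V p.2 p.1) := fun s =>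
      (hS.measurable_evol s).comp ((hV.stronglyMeasurable.measurable.comp measurable_swap).prodMk
        measurable_snd)
    exact ((h1 t).sub (h1 t₀)).enorm.lintegral_prod_right'
  have hle : ∀ᶠ t in 𝓝 t₀, ∫⁻ ω, ‖driftConv S V t ω - driftConv S V t₀ ω‖ₑ ^ 2 ∂P ≤
      ∫⁻ ω, g t ω ^ 2 ∂P := by
    filter_upwards [hnhds] with t ht
    refine lintegral_mono_ae ?_
    filter_upwards [hV.ae_lt_top T] with ω hω
    rw [driftConv_eq_evol ht, driftConv_eq_evol hT,
      ← integral_sub (hV.integrable_evol hS ht hω) (hV.integrable_evol hS hT hω)]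
    exact pow_le_pow_left' (enorm_integral_le_lintegral_enorm _) 2
  refine tendsto_of_tendsto_of_tendsto_of_le_of_le' tendsto_const_nhds ?_
    (.of_forall fun _ => zero_le) hle
  -- Two dominated convergences: in `r` for fixed `ω` with bound `2c‖V_r‖`, then in `ω` with bound
  -- `(2cN)²`.
  have hlim : Tendsto (fun t => ∫⁻ ω, g t ω ^ 2 ∂P) (𝓝 t₀) (𝓝 (∫⁻ _, 0 ∂P)) := by
    refine tendsto_lintegral_filter_of_dominated_convergence (fun ω => (2 * c * N ω) ^ 2)
      (.of_forall fun t => (hg t).pow_const 2)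
      (hnhds.mono fun t ht => .of_forall fun ω => pow_le_pow_left' (hgN t ht ω) 2) ?_ ?_
    · simp_rw [mul_pow]
      rw [lintegral_const_mul' _ _ (by finiteness)]
      exact ENNReal.mul_ne_top (by finiteness) (hV.moment T)
    · filter_upwards [hV.ae_lt_top T] with ω hω
      have h1 : Tendsto (fun t => g t ω) (𝓝 t₀) (𝓝 (∫⁻ _ in Iic T, 0 ∂leb)) := by
        refine tendsto_lintegral_filter_of_dominated_convergence' (fun r => 2 * c * ‖V r ω‖ₑ)
          (.of_forall fun t => ((hV.aestronglyMeasurable_evol hS t T ω).sub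
            (hV.aestronglyMeasurable_evol hS t₀ T ω)).enorm)
          (hnhds.mono fun t ht => .of_forall fun r => hptw t ht r ω) ?_ ?_
        · rw [lintegral_const_mul' _ _ (by finiteness)]
          exact ENNReal.mul_ne_top (by finiteness) hω.ne
        · have h : ∀ᵐ r ∂leb.restrict (Iic T), r ∉ ({t₀} : Set ℝ≥0) :=
            measure_eq_zero_iff_ae_notMem.1 (measure_singleton t₀)
          filter_upwards [h] with r hr
          have h2 := (hS.tendsto_evol (show r ≠ t₀ from hr) (V r ω)).sub
            (tendsto_const_nhds (x := evol S t₀ r (V r ω)))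
          rw [sub_self] at h2
          simpa using h2.enorm
      rw [lintegral_zero] at h1
      simpa using ENNReal.Tendsto.pow (n := 2) h1
  simpa using hlim

end Drift

/-! ### The stochastic convolution. -/

section StochasticConvolution

variable {H : Type uH} [NormedAddCommGroup H] [InnerProductSpace ℝ H] [CompleteSpace H]
variable {G : Type uG} [NormedAddCommGroup G] [InnerProductSpace ℝ G] [CompleteSpace G]
variable {U : Type uU} [MeasurableSpace U]
variable {Ω : Type uO} {m : MeasurableSpace Ω} {P : Measure Ω} {ℱ : Filtration ℝ≥0 m}
  {R : Set (Set U)} {μ : Measure U} {q : ℝ≥0 → U → HilbertianSeminorm H}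
  {M : ℝ≥0 → Set U → H →ₗ[ℝ] (Ω →ₘ[P] ℝ)} {S : ℝ≥0 → G →L[ℝ] G}
  {Ψ Ψ' : (r : ℝ≥0) → Ω → (u : U) → (q r u).Space →L[ℝ] G}

omit [CompleteSpace H] [CompleteSpace G] in
theorem lambdaNormSq_comp_le {T : ℝ≥0} {c : ℝ≥0} {L : ℝ≥0 → G →L[ℝ] G}
    (hL : ∀ r ≤ T, ‖L r‖ₑ ≤ c) :
    lambdaNormSq P μ q T (fun r ω u => L r ∘L Ψ r ω u) ≤ c ^ 2 * lambdaNormSq P μ q T Ψ := by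
  unfold lambdaNormSq
  rw [← lintegral_const_mul' _ _ (by finiteness)]
  refine lintegral_mono fun ω => ?_
  rw [← lintegral_const_mul' _ _ (by finiteness)]
  refine setLIntegral_mono' measurableSet_Iic fun r hr => ?_
  rw [← lintegral_const_mul' _ _ (by finiteness)]
  refine lintegral_mono fun u => (hsNormSq_comp_le _ _).trans ?_
  exact mul_le_mul_left (pow_le_pow_left' (hL r hr) 2) _

omit [CompleteSpace H] [CompleteSpace G] in
theorem lambdaNormSq_le_lintegral [SFinite P] {T : ℝ≥0} {β : ℝ≥0 → ℝ≥0∞} {N : ℝ≥0 → Ω → ℝ≥0∞}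
    (hβ : AEMeasurable β (leb.restrict (Iic T))) (hN : Measurable fun p : ℝ≥0 × Ω => N p.1 p.2)
    (hΨ : ∀ r > 0, ∀ ω, ∫⁻ u, hsNormSq (Ψ r ω u) ∂μ ≤ β r * N r ω ^ 2) :
    lambdaNormSq P μ q T Ψ ≤ ∫⁻ r in Iic T, β r * ∫⁻ ω, N r ω ^ 2 ∂P ∂leb := by
  have hNr : ∀ r, Measurable fun ω => N r ω := fun ω => hN.comp measurable_prodMk_left
  have hm : AEMeasurable (Function.uncurry fun (ω : Ω) r => β r * N r ω ^ 2)
      (P.prod (leb.restrict (Iic T))) :=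
    (hβ.comp_quasiMeasurePreserving Measure.quasiMeasurePreserving_snd).mul
      ((hN.comp measurable_swap).pow_const 2).aemeasurable
  calc _ ≤ ∫⁻ ω, ∫⁻ r in Iic T, β r * N r ω ^ 2 ∂leb ∂P := by
        refine lintegral_mono fun ω => lintegral_mono_ae ?_
        filter_upwards [ae_pos_leb T] with r hr using hΨ r hr ω
    _ = _ := by
        rw [lintegral_lintegral_swap hm]
        exact lintegral_congr fun r => lintegral_const_mul _ ((hNr r).pow_const 2)

section Measurability

variable [MeasurableSpace G] [BorelSpace G] [TopologicalSpace.SeparableSpace G]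

omit [CompleteSpace H] [TopologicalSpace.SeparableSpace G] in
/-- A Borel operator field evaluated along a predictable process is predictable. -/
theorem predField_comp {F : (r : ℝ≥0) → (u : U) → G → (q r u).Space →L[ℝ] G}
    (hF : ∀ (g₂ : G) (h : H), Measurable fun p : ℝ≥0 × U × G =>
      ⟪ContinuousLinearMap.adjoint (F p.1 p.2.1 p.2.2) g₂, (q p.1 p.2.1).incl h⟫_ℝ)
    {X : ℝ≥0 → Ω → G} (hX : IsStronglyPredictable ℱ X) (T : ℝ≥0) :
    PredField ℱ q T fun r ω u => F r u (X r ω) := fun h g => by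
  have hXm : Measurable[ℱ.predictable] fun p : ℝ≥0 × Ω => X p.1 p.2 :=
    StronglyMeasurable.measurable hX
  have h1 := measurable_time_space (U := U) ℱ
  have h2 : Measurable[ℱ.predictable.prod inferInstance]
      fun p : (ℝ≥0 × Ω) × U => (p.1.1, p.2, X p.1.1 p.1.2) :=
    (measurable_fst.comp h1).prodMk ((measurable_snd.comp h1).prodMk
      (hXm.comp (@measurable_fst _ _ ℱ.predictable _)))
  have hs : MeasurableSet[ℱ.predictable.prod inferInstance] {p : (ℝ≥0 × Ω) × U | p.1.1 ≤ T} :=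
    (measurable_fst.comp h1) measurableSet_Iic
  exact ((hF g h).comp h2).indicator hs

omit [CompleteSpace H] in
theorem PredField.evol (hS : IsC0Semigroup S) {T : ℝ≥0} (hΨ : PredField ℱ q T Ψ) (t : ℝ≥0) :
    PredField ℱ q T fun r ω u => evol S t r ∘L Ψ r ω u := fun h g => by
  classical
  have := measurable_comp_field (mX := ℱ.predictable.prod inferInstance)
    (fun p : (ℝ≥0 × Ω) × U => q p.1.1 p.2)
    (fun p => if p.1.1 ≤ T then Ψ p.1.1 p.1.2 p.2 else 0) (fun h g => by
      convert hΨ h g using 1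
      funext p
      by_cases hp : p.1.1 ≤ T <;> simp [Set.indicator, hp])
    (fun p => CylSPDE.evol S t p.1.1) (fun g g' => by
      have h1 : Measurable fun r => ⟪CylSPDE.evol S t r g, g'⟫_ℝ :=
        (hS.measurable_evol_apply t g).inner_const
      have h2 : Measurable[ℱ.predictable.prod inferInstance] fun p : (ℝ≥0 × Ω) × U => p.1.1 :=
        (measurable_fst_predictable ℱ).comp (@measurable_fst _ _ ℱ.predictable _)
      exact h1.comp h2) h g
  convert this using 1
  funext p
  by_cases hp : p.1.1 ≤ T <;> simp [Set.indicator, hp]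

omit [CompleteSpace H] in
theorem MemLambda.semigroup_comp (hS : IsC0Semigroup S) {t : ℝ≥0} (hΨ : MemLambda P ℱ μ q t Ψ) :
    MemLambda P ℱ μ q t fun r ω u => S (t - r) ∘L Ψ r ω u where
  hilbertSchmidt r hr ω u :=
    (hsNormSq_comp_le _ _).trans_lt (ENNReal.mul_lt_top (by finiteness)
      (hΨ.hilbertSchmidt r hr ω u))
  predictable h g := by
    have h0 : PredField ℱ q t Ψ := hΨ.predictable
    convert h0.evol hS t h g using 1
    funext p
    by_cases hp : p.1.1 ≤ t <;> simp [Set.indicator, hp, CylSPDE.evol]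
  norm_lt_top := by
    obtain ⟨c, hc⟩ := hS.exists_bound t
    exact (lambdaNormSq_comp_le (L := fun r => S (t - r)) fun r _ =>
      hc _ tsub_le_self).trans_lt (ENNReal.mul_lt_top (by finiteness) hΨ.norm_lt_top)

end Measurability

/-- Puts the convolution at time `t` on the fixed horizon `T`, so that convolutions at different
times become integrals over the same interval. -/
theorem HasStochIntegral.evol {t T : ℝ≥0} (ht : t ≤ T) {Y : Ω → G}
    (hY : HasStochIntegral P ℱ R μ q M t (fun r ω u => S (t - r) ∘L Ψ r ω u) Y) :
    HasStochIntegral P ℱ R μ q M T (fun r ω u => evol S t r ∘L Ψ r ω u) Y := by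
  have e : (fun r ω u => CylSPDE.evol S t r ∘L Ψ r ω u) =
      CylSPDE.cutField t (fun r ω u => S (t - r) ∘L Ψ r ω u) := by
    funext r ω u
    by_cases hr : r ≤ t <;> simp [CylSPDE.evol, CylSPDE.cutField, hr]
  rw [e]
  exact hY.cutField ht

variable [TopologicalSpace.SeparableSpace H] [TopologicalSpace.SeparableSpace G]
  [IsFiniteMeasure P] [SigmaFinite μ]

theorem lintegral_sq_stochConv_sub_le (hM : IsCylMartingaleMeasure P ℱ R μ q M) {t : ℝ≥0}
    {c : ℝ≥0} (hc : ∀ s ≤ t, ‖S s‖ₑ ≤ c) {Y Y' : Ω → G}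
    (hY : HasStochIntegral P ℱ R μ q M t (fun r ω u => S (t - r) ∘L Ψ r ω u) Y)
    (hY' : HasStochIntegral P ℱ R μ q M t (fun r ω u => S (t - r) ∘L Ψ' r ω u) Y') :
    ∫⁻ ω, ‖Y ω - Y' ω‖ₑ ^ 2 ∂P ≤
      4 * (c ^ 2 * lambdaNormSq P μ q t fun r ω u => Ψ r ω u - Ψ' r ω u) := by
  refine (hY.lintegral_sq_sub_le hM hY').trans (mul_le_mul_right ?_ _)
  simp_rw [← ContinuousLinearMap.comp_sub]
  exact lambdaNormSq_comp_le (L := fun r => S (t - r)) fun r _ => hc _ tsub_le_self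

variable [MeasurableSpace G] [BorelSpace G]

/-- Mean square continuity of the stochastic convolution. -/
theorem tendsto_stochConv (hM : IsCylMartingaleMeasure P ℱ R μ q M) (hS : IsC0Semigroup S)
    (hΨ : ∀ T, MemLambda P ℱ μ q T Ψ) {Y : ℝ≥0 → Ω → G}
    (hY : ∀ t, HasStochIntegral P ℱ R μ q M t (fun r ω u => S (t - r) ∘L Ψ r ω u) (Y t))
    (t₀ : ℝ≥0) :
    Tendsto (fun t => ∫⁻ ω, ‖Y t ω - Y t₀ ω‖ₑ ^ 2 ∂P) (𝓝 t₀) (𝓝 0) := by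
  set T := t₀ + 1
  have hT : t₀ ≤ T := le_self_add
  obtain ⟨c, hc⟩ := hS.exists_bound T
  have hnhds : ∀ᶠ t in 𝓝 t₀, t ≤ T := by
    filter_upwards [gt_mem_nhds (show t₀ < T from lt_add_one t₀)] with t ht using ht.le
  have h0 : PredField ℱ q T Ψ := (hΨ T).predictable
  have hq := hM.form_measurable
  have hpf : ∀ t, PredField ℱ q T fun r ω u => (evol S t r - evol S t₀ r) ∘L Ψ r ω u := fun t => by
    simp_rw [ContinuousLinearMap.sub_comp]
    exact PredField.sub (h0.evol hS t) (h0.evol hS t₀)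
  have hbd : ∀ t ≤ T, ∀ r, ‖evol S t r - evol S t₀ r‖ₑ ≤ 2 * c := fun t ht r => by
    refine enorm_sub_le.trans ?_
    rw [two_mul]
    exact add_le_add (enorm_evol_le hc ht r) (enorm_evol_le hc hT r)
  have hle : ∀ᶠ t in 𝓝 t₀, ∫⁻ ω, ‖Y t ω - Y t₀ ω‖ₑ ^ 2 ∂P ≤ 4 * ∫⁻ p,
      hsNormSq ((evol S t p.2.1 - evol S t₀ p.2.1) ∘L Ψ p.2.1 p.1 p.2.2) ∂lambdaMeasure P μ T := by
    filter_upwards [hnhds] with t ht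
    refine (((hY t).evol ht).lintegral_sq_sub_le hM ((hY t₀).evol hT)).trans (le_of_eq ?_)
    rw [← (hpf t).lambdaNormSq_eq hq]
    simp_rw [ContinuousLinearMap.sub_comp]
  refine tendsto_of_tendsto_of_tendsto_of_le_of_le' tendsto_const_nhds ?_
    (.of_forall fun _ => zero_le) hle
  -- Dominated convergence with bound `(2c)² ‖Ψ‖²`; off the null set `r = t₀` the integrand tends to
  -- zero by `tendsto_hsNormSq_comp`.
  have hlim : Tendsto (fun t => ∫⁻ p,
      hsNormSq ((evol S t p.2.1 - evol S t₀ p.2.1) ∘L Ψ p.2.1 p.1 p.2.2) ∂lambdaMeasure P μ T)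
      (𝓝 t₀) (𝓝 (∫⁻ _, 0 ∂lambdaMeasure P μ T)) := by
    have hae : ∀ t, AEMeasurable (fun p : Ω × ℝ≥0 × U =>
        hsNormSq ((evol S t p.2.1 - evol S t₀ p.2.1) ∘L Ψ p.2.1 p.1 p.2.2)) (lambdaMeasure P μ T) :=
      fun t => by
        have h := (hpf t).aemeasurable_lambda (P := P) (μ := μ) hq
        exact h
    refine tendsto_lintegral_filter_of_dominated_convergence'
      (fun p => (2 * c) ^ 2 * hsNormSq (Ψ p.2.1 p.1 p.2.2)) (.of_forall hae) ?_ ?_ ?_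
    · filter_upwards [hnhds] with t ht
      refine .of_forall fun p => (hsNormSq_comp_le _ _).trans ?_
      exact mul_le_mul_left (pow_le_pow_left' (hbd t ht _) 2) _
    · rw [lintegral_const_mul' _ _ (by finiteness)]
      have e0 := h0.lambdaNormSq_eq (P := P) (μ := μ) hq
      rw [← e0]
      exact ENNReal.mul_ne_top (by finiteness) (hΨ T).norm_lt_top.ne
    · have h1 : ∀ᵐ r ∂leb.restrict (Iic T), r ∉ ({t₀} : Set ℝ≥0) :=
        measure_eq_zero_iff_ae_notMem.1 (measure_singleton t₀)
      have h2 : ∀ᵐ p ∂lambdaMeasure P μ T, p.2.1 ∉ ({t₀} : Set ℝ≥0) :=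
        Measure.quasiMeasurePreserving_snd.ae (Measure.quasiMeasurePreserving_fst.ae h1)
      filter_upwards [h2] with p hp
      refine tendsto_hsNormSq_comp (C := 2 * c) _ _
        ((hΨ p.2.1).hilbertSchmidt _ le_rfl p.1 p.2.2).ne (fun x => ?_) (by finiteness)
        (hnhds.mono fun t ht => hbd t ht _)
      have h3 := (hS.tendsto_evol (show p.2.1 ≠ t₀ from hp) x).sub
        (tendsto_const_nhds (x := evol S t₀ p.2.1 x))
      rw [sub_self] at h3
      exact h3
  rw [lintegral_zero] at hlim
  simpa using ENNReal.Tendsto.const_mul (a := 4) hlim (.inr (by simp))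

end StochasticConvolution

/-! ### The orbit of the initial value. -/

section InitialValue

variable {G : Type uG} [NormedAddCommGroup G] [InnerProductSpace ℝ G] [CompleteSpace G]
variable {Ω : Type uO} {m : MeasurableSpace Ω} {P : Measure Ω} {S : ℝ≥0 → G →L[ℝ] G}

/-- Mean square continuity of the orbit of a random initial value. -/
theorem IsC0Semigroup.tendsto_lintegral_sq (hS : IsC0Semigroup S) {ξ : Ω → G} (hξ : MemLp ξ 2 P)
    (t₀ : ℝ≥0) :
    Tendsto (fun t => ∫⁻ ω, ‖S t (ξ ω) - S t₀ (ξ ω)‖ₑ ^ 2 ∂P) (𝓝 t₀) (𝓝 0) := by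
  obtain ⟨c, hc⟩ := hS.exists_bound (t₀ + 1)
  have hnhds : ∀ᶠ t in 𝓝 t₀, t ≤ t₀ + 1 := by
    filter_upwards [gt_mem_nhds (lt_add_one t₀)] with t ht using ht.le
  rw [← lintegral_zero (μ := P)]
  refine tendsto_lintegral_filter_of_dominated_convergence' (fun ω => (2 * c * ‖ξ ω‖ₑ) ^ 2)
    (.of_forall fun t => ?_) (hnhds.mono fun t ht => .of_forall fun ω => ?_) ?_
    (.of_forall fun ω => ?_)
  · exact (((S t).continuous.comp_aestronglyMeasurable hξ.1).sub
      ((S t₀).continuous.comp_aestronglyMeasurable hξ.1)).enorm.pow_const 2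
  · refine pow_le_pow_left' (enorm_sub_le.trans ?_) 2
    rw [two_mul, add_mul]
    exact add_le_add (((S t).le_opENorm _).trans (mul_le_mul_left (hc t ht) _))
      (((S t₀).le_opENorm _).trans (mul_le_mul_left (hc t₀ le_self_add) _))
  · simp_rw [mul_pow]
    rw [lintegral_const_mul' _ _ (by finiteness), ← eLpNorm_two_sq]
    exact ENNReal.mul_ne_top (by finiteness) (by have := hξ.2; finiteness)
  · have h := ((hS.continuous (ξ ω)).tendsto t₀).sub (tendsto_const_nhds (x := S t₀ (ξ ω)))
    rw [sub_self] at h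
    simpa using ENNReal.Tendsto.pow (n := 2) h.enorm

end InitialValue

/-! ### Locally bounded second moments. -/

section SecondMoments

variable {G : Type uG} [NormedAddCommGroup G]
variable {Ω : Type uO} {m : MeasurableSpace Ω} {P : Measure Ω} {ℱ : Filtration ℝ≥0 m}

theorem aestronglyMeasurable_of_predictable {X : ℝ≥0 → Ω → G} (hX : IsStronglyPredictable ℱ X)
    (t : ℝ≥0) : AEStronglyMeasurable (X t) P :=
  ((StronglyMeasurable.mono hX (predictable_le ℱ)).comp_measurable
    measurable_prodMk_left).aestronglyMeasurable

theorem LocallyBoundedSecondMoment.exists_bound {X : ℝ≥0 → Ω → G}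
    (hX : LocallyBoundedSecondMoment P X) (T : ℝ≥0) :
    ∃ C : ℝ≥0∞, C ≠ ∞ ∧ ∀ t ≤ T, ∫⁻ ω, ‖X t ω‖ₑ ^ 2 ∂P ≤ C :=
  ⟨_, (hX T).ne, fun _ ht => le_biSup (fun t => ∫⁻ ω, ‖X t ω‖ₑ ^ 2 ∂P) (mem_Iic.2 ht)⟩

theorem locallyBoundedSecondMoment_of_continuous [Fact ((1 : ℝ≥0∞) ≤ 2)] {I : ℝ≥0 → Lp G 2 P}
    (hI : Continuous I) {X : ℝ≥0 → Ω → G} (hX : ∀ t, X t =ᵐ[P] I t) :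
    LocallyBoundedSecondMoment P X := fun T => by
  obtain ⟨C, hC⟩ := (isCompact_Icc (a := 0) (b := T)).exists_bound_of_continuousOn hI.continuousOn
  refine lt_of_le_of_lt (b := ENNReal.ofReal C ^ 2) (iSup₂_le fun t ht => ?_) (by finiteness)
  rw [← eLpNorm_two_sq, eLpNorm_congr_ae (hX t), ← Lp.enorm_def, ← ofReal_norm]
  exact pow_le_pow_left' (ENNReal.ofReal_le_ofReal (hC t ⟨zero_le, ht⟩)) 2

end SecondMoments

/-! ### The fixed point formulation of the mild equation. -/

section MildImage

variable {H : Type uH} [NormedAddCommGroup H] [InnerProductSpace ℝ H] [CompleteSpace H]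
variable {G : Type uG} [NormedAddCommGroup G] [InnerProductSpace ℝ G] [CompleteSpace G]
variable {U : Type uU} [MeasurableSpace U]
variable {Ω : Type uO} {m : MeasurableSpace Ω}
variable {P : Measure Ω} {ℱ : Filtration ℝ≥0 m}
  {R : Set (Set U)} {μ : Measure U} {q : ℝ≥0 → U → HilbertianSeminorm H}
  {M : ℝ≥0 → Set U → H →ₗ[ℝ] (Ω →ₘ[P] ℝ)} {S : ℝ≥0 → G →L[ℝ] G} {B : ℝ≥0 → Ω → G → G}
  {F : (r : ℝ≥0) → (u : U) → G → (q r u).Space →L[ℝ] G} {ξ : Ω → G} {X Z Z' : ℝ≥0 → Ω → G}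

variable (P ℱ R μ q M S B F ξ) in
/-- `Z` is the right-hand side of the mild equation, evaluated along `X`. -/
def IsMildImage (X Z : ℝ≥0 → Ω → G) : Prop :=
  ∀ t, ∃ Y : Ω → G, HasStochIntegral P ℱ R μ q M t (fun r ω u => S (t - r) ∘L F r u (X r ω)) Y ∧
    ∀ᵐ ω ∂P, Z t ω = S t (ξ ω) + driftConv S (fun r ω => B r ω (X r ω)) t ω + Y ω

theorem IsMildImage.congr (h : IsMildImage P ℱ R μ q M S B F ξ X Z)
    (hZ : ∀ t, Z' t =ᵐ[P] Z t) : IsMildImage P ℱ R μ q M S B F ξ X Z' := fun t => by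
  obtain ⟨Y, hY, hZY⟩ := h t
  refine ⟨Y, hY, ?_⟩
  filter_upwards [hZY, hZ t] with ω h1 h2
  rw [h2, h1]

theorem IsMildSolution.isMildImage (h : IsMildSolution P ℱ R μ q M S B F ξ X) :
    IsMildImage P ℱ R μ q M S B F ξ X X := fun t => (h.2 t).2

end MildImage

/-! ### Consequences of the growth and Lipschitz conditions. -/

section Equation

variable {H : Type uH} [NormedAddCommGroup H] [InnerProductSpace ℝ H] [CompleteSpace H]
variable {G : Type uG} [NormedAddCommGroup G] [InnerProductSpace ℝ G] [CompleteSpace G]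
  [MeasurableSpace G]
variable {U : Type uU} [MeasurableSpace U]
variable {Ω : Type uO} {m : MeasurableSpace Ω}

/-- Measurability, growth and Lipschitz conditions on the drift `B`. -/
structure IsLipschitzDrift (ℱ : Filtration ℝ≥0 m) (B : ℝ≥0 → Ω → G → G) (a : ℝ≥0 → ℝ≥0) :
    Prop where
  measurable : Measurable[ℱ.predictable.prod inferInstance]
    fun p : (ℝ≥0 × Ω) × G => B p.1.1 p.1.2 p.2
  integrable : ∀ T, IntegrableOn (fun r => (a r : ℝ)) (Iic T) leb
  growth : ∀ r > 0, ∀ ω g, ‖B r ω g‖ ≤ a r * (1 + ‖g‖)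
  lipschitz : ∀ r > 0, ∀ ω g₁ g₂, ‖B r ω g₁ - B r ω g₂‖ ≤ a r * ‖g₁ - g₂‖

/-- Measurability, growth and Lipschitz conditions on the diffusion coefficient `F`. -/
structure IsLipschitzDiffusion (μ : Measure U) (q : ℝ≥0 → U → HilbertianSeminorm H)
    (F : (r : ℝ≥0) → (u : U) → G → (q r u).Space →L[ℝ] G) (b : ℝ≥0 → ℝ≥0) : Prop where
  hilbertSchmidt : ∀ r u g, IsHilbertSchmidt (F r u g)
  measurable : ∀ (g₂ : G) (h : H), Measurable fun p : ℝ≥0 × U × G =>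
    ⟪ContinuousLinearMap.adjoint (F p.1 p.2.1 p.2.2) g₂, (q p.1 p.2.1).incl h⟫_ℝ
  integrable : ∀ T, IntegrableOn (fun r => (b r : ℝ) ^ 2) (Iic T) leb
  growth : ∀ r > 0, ∀ g,
    ∫⁻ u, hsNormSq (F r u g) ∂μ ≤ ENNReal.ofReal ((b r : ℝ) ^ 2 * (1 + ‖g‖) ^ 2)
  lipschitz : ∀ r > 0, ∀ g₁ g₂,
    ∫⁻ u, hsNormSq (F r u g₁ - F r u g₂) ∂μ ≤ ENNReal.ofReal ((b r : ℝ) ^ 2 * ‖g₁ - g₂‖ ^ 2)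

theorem aemeasurable_coe_of_integrableOn {k : ℝ≥0 → ℝ≥0} {T : ℝ≥0}
    (hk : IntegrableOn (fun r => (k r : ℝ)) (Iic T) leb) :
    AEMeasurable (fun r => (k r : ℝ≥0∞)) (leb.restrict (Iic T)) := by
  simpa using hk.1.aemeasurable.ennreal_ofReal

theorem lintegral_coe_ne_top_of_integrableOn {k : ℝ≥0 → ℝ≥0} {T : ℝ≥0}
    (hk : IntegrableOn (fun r => (k r : ℝ)) (Iic T) leb) :
    ∫⁻ r in Iic T, (k r : ℝ≥0∞) ∂leb ≠ ∞ := by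
  have h := hk.2.ne
  simpa using h

variable {P : Measure Ω} {ℱ : Filtration ℝ≥0 m}
  {R : Set (Set U)} {μ : Measure U} {q : ℝ≥0 → U → HilbertianSeminorm H}
  {M : ℝ≥0 → Set U → H →ₗ[ℝ] (Ω →ₘ[P] ℝ)} {S : ℝ≥0 → G →L[ℝ] G} {B : ℝ≥0 → Ω → G → G}
  {F : (r : ℝ≥0) → (u : U) → G → (q r u).Space →L[ℝ] G} {a b : ℝ≥0 → ℝ≥0} {ξ : Ω → G}
  {X X' Z Z' : ℝ≥0 → Ω → G}

namespace IsLipschitzDrift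

omit [InnerProductSpace ℝ G] [CompleteSpace G] in
theorem enorm_le (hB : IsLipschitzDrift ℱ B a) {r : ℝ≥0} (hr : 0 < r) (ω : Ω) (g : G) :
    ‖B r ω g‖ₑ ≤ a r * (1 + ‖g‖ₑ) := by
  rw [← ofReal_norm]
  refine (ENNReal.ofReal_le_ofReal (hB.growth r hr ω g)).trans (le_of_eq ?_)
  rw [ENNReal.ofReal_mul (by positivity), ENNReal.ofReal_add (by positivity) (by positivity),
    ofReal_norm]
  simp

omit [InnerProductSpace ℝ G] [CompleteSpace G] in
theorem enorm_sub_le (hB : IsLipschitzDrift ℱ B a) {r : ℝ≥0} (hr : 0 < r) (ω : Ω) (g₁ g₂ : G) :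
    ‖B r ω g₁ - B r ω g₂‖ₑ ≤ a r * ‖g₁ - g₂‖ₑ := by
  rw [← ofReal_norm]
  refine (ENNReal.ofReal_le_ofReal (hB.lipschitz r hr ω g₁ g₂)).trans (le_of_eq ?_)
  rw [ENNReal.ofReal_mul (by positivity), ofReal_norm]
  simp

end IsLipschitzDrift

namespace IsLipschitzDiffusion

omit [CompleteSpace H] in
theorem integrable' (hF : IsLipschitzDiffusion μ q F b) (T : ℝ≥0) :
    IntegrableOn (fun r => ((b r ^ 2 : ℝ≥0) : ℝ)) (Iic T) leb := by
  simpa using hF.integrable T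

omit [CompleteSpace H] in
theorem lintegral_le (hF : IsLipschitzDiffusion μ q F b) {r : ℝ≥0} (hr : 0 < r) (g : G) :
    ∫⁻ u, hsNormSq (F r u g) ∂μ ≤ (b r ^ 2 : ℝ≥0) * (1 + ‖g‖ₑ) ^ 2 := by
  refine (hF.growth r hr g).trans (le_of_eq ?_)
  rw [ENNReal.ofReal_mul (by positivity), ENNReal.ofReal_pow (by positivity),
    ENNReal.ofReal_pow (by positivity), ENNReal.ofReal_add (by positivity) (by positivity),
    ofReal_norm]
  simp

omit [CompleteSpace H] in
theorem lintegral_sub_le (hF : IsLipschitzDiffusion μ q F b) {r : ℝ≥0} (hr : 0 < r) (g₁ g₂ : G) :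
    ∫⁻ u, hsNormSq (F r u g₁ - F r u g₂) ∂μ ≤ (b r ^ 2 : ℝ≥0) * ‖g₁ - g₂‖ₑ ^ 2 := by
  refine (hF.lipschitz r hr g₁ g₂).trans (le_of_eq ?_)
  rw [ENNReal.ofReal_mul (by positivity), ENNReal.ofReal_pow (by positivity),
    ENNReal.ofReal_pow (by positivity), ofReal_norm]
  simp

end IsLipschitzDiffusion

-- The finiteness behind both linear growth conditions, used with `k = a` for the drift and `k = b²`
-- for the noise.
omit [InnerProductSpace ℝ G] [CompleteSpace G] [MeasurableSpace G] in
theorem lintegral_mul_one_add_sq_ne_top [IsProbabilityMeasure P]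
    (hX2 : LocallyBoundedSecondMoment P X) {k : ℝ≥0 → ℝ≥0} {T : ℝ≥0}
    (hk : IntegrableOn (fun r => (k r : ℝ)) (Iic T) leb) :
    ∫⁻ r in Iic T, k r * ∫⁻ ω, (1 + ‖X r ω‖ₑ) ^ 2 ∂P ∂leb ≠ ∞ := by
  obtain ⟨C, hC, hXC⟩ := hX2.exists_bound T
  have h1 : ∀ r ≤ T, ∫⁻ ω, (1 + ‖X r ω‖ₑ) ^ 2 ∂P ≤ 2 + 2 * C := fun r hr => by
    have hle : ∀ y : ℝ≥0∞, (1 + y) ^ 2 ≤ 2 + 2 * y ^ 2 := fun y => by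
      induction y with
      | top => simp
      | coe y =>
        norm_cast
        rw [← NNReal.coe_le_coe]; push_cast
        nlinarith [sq_nonneg ((y : ℝ) - 1)]
    calc _ ≤ ∫⁻ ω, (2 + 2 * ‖X r ω‖ₑ ^ 2) ∂P := lintegral_mono fun ω => hle _
      _ = 2 + 2 * ∫⁻ ω, ‖X r ω‖ₑ ^ 2 ∂P := by
        rw [lintegral_add_left measurable_const, lintegral_const_mul' _ _ (by simp)]
        simp
      _ ≤ _ := by gcongr; exact hXC r hr
  refine ((setLIntegral_mono' (g := fun r => k r * (2 + 2 * C)) measurableSet_Iic fun r hr =>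
    mul_le_mul_right (h1 r hr) _).trans_lt ?_).ne
  rw [lintegral_mul_const' _ _ (by finiteness)]
  exact ENNReal.mul_lt_top (lintegral_coe_ne_top_of_integrableOn hk).lt_top (by finiteness)

omit [InnerProductSpace ℝ G] [CompleteSpace G] [MeasurableSpace G] in
theorem measurable_one_add_enorm (hX : IsStronglyPredictable ℱ X) :
    Measurable fun p : ℝ≥0 × Ω => 1 + ‖X p.1 p.2‖ₑ :=
  measurable_const.add (StronglyMeasurable.mono hX (predictable_le ℱ)).enorm

omit [InnerProductSpace ℝ G] [CompleteSpace G] [MeasurableSpace G] in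
theorem measurable_enorm_sub (hX : IsStronglyPredictable ℱ X) (hX' : IsStronglyPredictable ℱ X') :
    Measurable fun p : ℝ≥0 × Ω => ‖X p.1 p.2 - X' p.1 p.2‖ₑ :=
  ((StronglyMeasurable.mono hX (predictable_le ℱ)).sub
    (StronglyMeasurable.mono hX' (predictable_le ℱ))).enorm

variable [BorelSpace G] [SecondCountableTopology G] [IsProbabilityMeasure P]

omit [InnerProductSpace ℝ G] [CompleteSpace G] in
theorem IsLipschitzDrift.isDrift (hB : IsLipschitzDrift ℱ B a) (hX : IsStronglyPredictable ℱ X)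
    (hX2 : LocallyBoundedSecondMoment P X) : IsDrift P ℱ fun r ω => B r ω (X r ω) where
  predictable := by
    have hXm : Measurable[ℱ.predictable] fun p : ℝ≥0 × Ω => X p.1 p.2 :=
      StronglyMeasurable.measurable hX
    have h1 : @Measurable _ _ ℱ.predictable (ℱ.predictable.prod inferInstance)
        fun p : ℝ≥0 × Ω => (p, X p.1 p.2) :=
      Measurable.prodMk (@measurable_id _ ℱ.predictable) hXm
    exact Measurable.stronglyMeasurable (hB.measurable.comp h1)
  moment T := by
    refine ((lintegral_sq_lintegral_le (aemeasurable_coe_of_integrableOn (hB.integrable T))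
      (measurable_one_add_enorm hX) fun r hr ω => hB.enorm_le hr ω _).trans_lt ?_).ne
    exact ENNReal.mul_lt_top (lintegral_coe_ne_top_of_integrableOn (hB.integrable T)).lt_top
      (lintegral_mul_one_add_sq_ne_top hX2 (hB.integrable T)).lt_top

omit [CompleteSpace H] [SecondCountableTopology G] in
theorem IsLipschitzDiffusion.memLambda (hF : IsLipschitzDiffusion μ q F b)
    (hX : IsStronglyPredictable ℱ X) (hX2 : LocallyBoundedSecondMoment P X) (T : ℝ≥0) :
    MemLambda P ℱ μ q T fun r ω u => F r u (X r ω) where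
  hilbertSchmidt r _ ω u := hF.hilbertSchmidt r u _
  predictable := predField_comp hF.measurable hX T
  norm_lt_top := by
    refine (lambdaNormSq_le_lintegral (aemeasurable_coe_of_integrableOn (hF.integrable' T))
      (measurable_one_add_enorm hX) fun r hr ω => hF.lintegral_le hr _).trans_lt ?_
    exact (lintegral_mul_one_add_sq_ne_top hX2 (hF.integrable' T)).lt_top

variable [TopologicalSpace.SeparableSpace H] [SigmaFinite μ]

/-- The right-hand side of the mild equation is an adapted, mean-square continuous process. -/
theorem exists_mildImage (hM : IsCylMartingaleMeasure P ℱ R μ q M) (hS : IsC0Semigroup S)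
    (hB : IsLipschitzDrift ℱ B a) (hF : IsLipschitzDiffusion μ q F b) (hξ : Measurable[ℱ 0] ξ)
    (hξ2 : MemLp ξ 2 P) (hX : IsStronglyPredictable ℱ X) (hX2 : LocallyBoundedSecondMoment P X) :
    ∃ I : ℝ≥0 → Lp G 2 P, Continuous I ∧ (∀ t, AEStronglyMeasurable[ℱ t] (I t) P) ∧
      IsMildImage P ℱ R μ q M S B F ξ X fun t => I t := by
  have hD := hB.isDrift hX hX2
  have hΨ := hF.memLambda (P := P) hX hX2
  choose Y hY hYm using fun t => ((hΨ t).semigroup_comp hS).exists_hasStochIntegral hM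
  set V : ℝ≥0 → Ω → G := fun r ω => B r ω (X r ω)
  set Z : ℝ≥0 → Ω → G := fun t ω => S t (ξ ω) + driftConv S V t ω + Y t ω
  have hSξ : ∀ t, AEStronglyMeasurable[ℱ t] (fun ω => S t (ξ ω)) P := fun t => by
    have h1 : StronglyMeasurable[ℱ t] ξ := (hξ.mono (ℱ.mono zero_le) le_rfl).stronglyMeasurable
    exact ((S t).continuous.comp_stronglyMeasurable h1).aestronglyMeasurable
  have hDm : ∀ t, AEStronglyMeasurable[ℱ t] (driftConv S V t) P := fun t =>
    (hD.stronglyMeasurable_driftConv hS t).aestronglyMeasurable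
  have hZm : ∀ t, AEStronglyMeasurable[ℱ t] (Z t) P := fun t => ((hSξ t).add (hDm t)).add (hYm t)
  have hD2 : ∀ t, MemLp (driftConv S V t) 2 P := fun t => by
    refine ⟨(hDm t).mono (ℱ.le t), ?_⟩
    have h := hD.lintegral_sq_lt_top hS t
    rw [← eLpNorm_two_sq] at h
    simpa using h
  have hZ2 : ∀ t, MemLp (Z t) 2 P := fun t =>
    (((S t).comp_memLp' hξ2).add (hD2 t)).add (hY t).2.1
  have hZI : ∀ t, (hZ2 t).toLp (Z t) =ᵐ[P] Z t := fun t => (hZ2 t).coeFn_toLp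
  refine ⟨fun t => (hZ2 t).toLp (Z t), ?_, fun t => ?_, fun t => ⟨Y t, hY t, hZI t⟩⟩
  · refine continuous_iff_continuousAt.2 fun t₀ => ?_
    rw [ContinuousAt, tendsto_iff_edist_tendsto_0]
    have hlim : Tendsto (fun t => ∫⁻ ω, ‖Z t ω - Z t₀ ω‖ₑ ^ 2 ∂P) (𝓝 t₀) (𝓝 0) := by
      have h1 := hS.tendsto_lintegral_sq hξ2 t₀
      have h2 := hD.tendsto_driftConv hS t₀
      have h3 := tendsto_stochConv hM hS hΨ hY t₀
      have h4 := (ENNReal.Tendsto.const_mul (a := 2) ((ENNReal.Tendsto.const_mul (a := 2) h1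
        (.inr (by simp))).add (ENNReal.Tendsto.const_mul (a := 2) h2 (.inr (by simp))))
        (.inr (by simp))).add (ENNReal.Tendsto.const_mul (a := 2) h3 (.inr (by simp)))
      simp only [mul_zero, add_zero] at h4
      refine tendsto_of_tendsto_of_tendsto_of_le_of_le tendsto_const_nhds h4
        (fun _ => zero_le) fun t => ?_
      have m1 : AEStronglyMeasurable (fun ω => S t (ξ ω) - S t₀ (ξ ω)) P :=
        ((hSξ t).mono (ℱ.le t)).sub ((hSξ t₀).mono (ℱ.le t₀))
      have m2 : AEStronglyMeasurable (fun ω => driftConv S V t ω - driftConv S V t₀ ω) P :=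
        ((hDm t).mono (ℱ.le t)).sub ((hDm t₀).mono (ℱ.le t₀))
      have e : ∀ ω, Z t ω - Z t₀ ω = ((S t (ξ ω) - S t₀ (ξ ω)) +
          (driftConv S V t ω - driftConv S V t₀ ω)) + (Y t ω - Y t₀ ω) := fun ω => by
        simp only [Z]; abel
      simp_rw [e]
      exact (lintegral_enorm_add_sq_le (m1.add m2)).trans
        (add_le_add_left (mul_le_mul_right (lintegral_enorm_add_sq_le m1) _) _)
    have h5 : ∀ t, edist ((hZ2 t).toLp (Z t)) ((hZ2 t₀).toLp (Z t₀)) =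
        (∫⁻ ω, ‖Z t ω - Z t₀ ω‖ₑ ^ 2 ∂P) ^ (1 / 2 : ℝ) := fun t => by
      rw [Lp.edist_toLp_toLp, ← eLpNorm_two_sq, ← ENNReal.rpow_natCast, ← ENNReal.rpow_mul]
      norm_num
      rfl
    simp_rw [h5]
    simpa using hlim.ennrpow_const (1 / 2 : ℝ)
  · exact (hZm t).congr (hZI t).symm

/-- The right-hand side of the mild equation depends on the process through a Volterra kernel. -/
theorem exists_kernel (hM : IsCylMartingaleMeasure P ℱ R μ q M) (hS : IsC0Semigroup S)
    (hB : IsLipschitzDrift ℱ B a) (hF : IsLipschitzDiffusion μ q F b) (T : ℝ≥0) :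
    ∃ k : ℝ≥0 → ℝ≥0∞, AEMeasurable k (leb.restrict (Iic T)) ∧ ∫⁻ r in Iic T, k r ∂leb ≠ ∞ ∧
      ∀ X X' Z Z' : ℝ≥0 → Ω → G, IsStronglyPredictable ℱ X → IsStronglyPredictable ℱ X' →
        LocallyBoundedSecondMoment P X → LocallyBoundedSecondMoment P X' →
        IsMildImage P ℱ R μ q M S B F ξ X Z → IsMildImage P ℱ R μ q M S B F ξ X' Z' →
        ∀ t ≤ T, ∫⁻ ω, ‖Z t ω - Z' t ω‖ₑ ^ 2 ∂P ≤
          ∫⁻ r in Iic t, k r * ∫⁻ ω, ‖X r ω - X' r ω‖ₑ ^ 2 ∂P ∂leb := by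
  obtain ⟨c, hc⟩ := hS.exists_bound T
  have ham := aemeasurable_coe_of_integrableOn (hB.integrable T)
  have hbm := aemeasurable_coe_of_integrableOn (hF.integrable' T)
  have ha := lintegral_coe_ne_top_of_integrableOn (hB.integrable T)
  have hb := lintegral_coe_ne_top_of_integrableOn (hF.integrable' T)
  set A := ∫⁻ r in Iic T, (a r : ℝ≥0∞) ∂leb
  -- The factor 2 separates drift and noise. Cauchy–Schwarz turns the drift into `c² A ∫ a f`, and
  -- the continuity constant 4 of the stochastic integral gives `8 = 2 · 4` in front of `b²`.
  refine ⟨fun r => 2 * c ^ 2 * A * a r + 8 * c ^ 2 * (b r ^ 2 : ℝ≥0),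
    (ham.const_mul _).add (hbm.const_mul _), ?_, ?_⟩
  · rw [lintegral_add_left' (ham.const_mul _), lintegral_const_mul' _ _ (by finiteness),
      lintegral_const_mul' _ _ (by finiteness)]
    finiteness
  intro X X' Z Z' hX hX' hX2 hX2' hZ hZ' t ht
  obtain ⟨Y, hY, hZY⟩ := hZ t
  obtain ⟨Y', hY', hZY'⟩ := hZ' t
  have hD := hB.isDrift hX hX2
  have hD' := hB.isDrift hX' hX2'
  set V : ℝ≥0 → Ω → G := fun r ω => B r ω (X r ω)
  set V' : ℝ≥0 → Ω → G := fun r ω => B r ω (X' r ω)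
  set f : ℝ≥0 → ℝ≥0∞ := fun r => ∫⁻ ω, ‖X r ω - X' r ω‖ₑ ^ 2 ∂P
  have hmt : leb.restrict (Iic t) ≤ leb.restrict (Iic T) :=
    Measure.restrict_mono (Iic_subset_Iic.2 ht) le_rfl
  have hN := measurable_enorm_sub hX hX'
  have hf : Measurable f := ((hN.comp measurable_swap).pow_const 2).lintegral_prod_left'
  have h1 : ∫⁻ ω, ‖driftConv S V t ω - driftConv S V' t ω‖ₑ ^ 2 ∂P ≤
      c ^ 2 * (A * ∫⁻ r in Iic t, a r * f r ∂leb) := by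
    refine (hD.lintegral_sq_sub_le hD' hS hc ht).trans (mul_le_mul_right ?_ _)
    refine (lintegral_sq_lintegral_le (ham.mono_measure hmt) hN
      fun r hr ω => hB.enorm_sub_le hr ω _ _).trans ?_
    exact mul_le_mul_left (lintegral_mono' hmt le_rfl) _
  have h2 : ∫⁻ ω, ‖Y ω - Y' ω‖ₑ ^ 2 ∂P ≤
      4 * (c ^ 2 * ∫⁻ r in Iic t, (b r ^ 2 : ℝ≥0) * f r ∂leb) := by
    refine (lintegral_sq_stochConv_sub_le hM (fun s hs => hc s (hs.trans ht)) hY hY').trans ?_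
    refine mul_le_mul_right (mul_le_mul_right ?_ _) _
    exact lambdaNormSq_le_lintegral (hbm.mono_measure hmt) hN
      fun r hr ω => hF.lintegral_sub_le hr _ _
  have hm : AEStronglyMeasurable (fun ω => driftConv S V t ω - driftConv S V' t ω) P :=
    (((hD.stronglyMeasurable_driftConv hS t).mono (ℱ.le t)).sub
      ((hD'.stronglyMeasurable_driftConv hS t).mono (ℱ.le t))).aestronglyMeasurable
  -- Both images start from the same `ξ`, so the initial terms cancel.
  have e : ∫⁻ ω, ‖Z t ω - Z' t ω‖ₑ ^ 2 ∂P =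
      ∫⁻ ω, ‖(driftConv S V t ω - driftConv S V' t ω) + (Y ω - Y' ω)‖ₑ ^ 2 ∂P := by
    refine lintegral_congr_ae ?_
    filter_upwards [hZY, hZY'] with ω h h'
    rw [h, h']
    congr 2
    abel
  have hr : ∫⁻ r in Iic t, (2 * c ^ 2 * A * a r + 8 * c ^ 2 * (b r ^ 2 : ℝ≥0)) * f r ∂leb =
      2 * c ^ 2 * A * ∫⁻ r in Iic t, a r * f r ∂leb +
        8 * c ^ 2 * ∫⁻ r in Iic t, (b r ^ 2 : ℝ≥0) * f r ∂leb := by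
    simp_rw [add_mul, mul_assoc (_ : ℝ≥0∞) (_ : ℝ≥0∞) (f _)]
    have hm' : AEMeasurable (fun r => 2 * c ^ 2 * A * (a r * f r)) (leb.restrict (Iic t)) :=
      ((ham.mono_measure hmt).mul hf.aemeasurable).const_mul _
    rw [lintegral_add_left' hm',
      lintegral_const_mul' _ _ (by finiteness), lintegral_const_mul' _ _ (by finiteness)]
  rw [e, hr]
  refine (lintegral_enorm_add_sq_le hm).trans ?_
  refine (add_le_add (mul_le_mul_right h1 2) (mul_le_mul_right h2 2)).trans (le_of_eq ?_)
  ring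

end Equation

/-! ### Convergence of curves in L². -/

section L2

variable {G : Type uG} [NormedAddCommGroup G]
variable {Ω : Type uO} {m : MeasurableSpace Ω} {P : Measure Ω}

theorem lintegral_sq_sub_le_of_bounds {X X' : Ω → G} {C C' : ℝ≥0∞}
    (hX : AEStronglyMeasurable X P) (h : ∫⁻ ω, ‖X ω‖ₑ ^ 2 ∂P ≤ C)
    (h' : ∫⁻ ω, ‖X' ω‖ₑ ^ 2 ∂P ≤ C') : ∫⁻ ω, ‖X ω - X' ω‖ₑ ^ 2 ∂P ≤ 2 * C + 2 * C' :=
  (lintegral_enorm_sub_sq_le hX).trans (by gcongr)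

theorem ae_eq_of_lintegral_sq_sub_eq_zero {X X' : Ω → G} (hX : AEStronglyMeasurable X P)
    (hX' : AEStronglyMeasurable X' P) (h : ∫⁻ ω, ‖X ω - X' ω‖ₑ ^ 2 ∂P = 0) : X =ᵐ[P] X' := by
  have hm : AEMeasurable (fun ω => ‖X ω - X' ω‖ₑ ^ 2) P := (hX.sub hX').enorm.pow_const 2
  rw [lintegral_eq_zero_iff' hm] at h
  filter_upwards [h] with ω hω
  simpa [sub_eq_zero] using hω

theorem tendsto_mul_inv_pow {C : ℝ≥0∞} (hC : C ≠ ∞) :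
    Tendsto (fun n : ℕ => C * (4⁻¹ : ℝ≥0∞) ^ n) atTop (𝓝 0) := by
  have h := ENNReal.Tendsto.const_mul (a := C)
    (ENNReal.tendsto_pow_atTop_nhds_zero_of_lt_one (r := 4⁻¹) (by simp)) (.inr hC)
  simpa using h

theorem lintegral_sq_sub_eq_edist_sq {f g : Lp G 2 P} {X Y : Ω → G} (hX : X =ᵐ[P] f)
    (hY : Y =ᵐ[P] g) : ∫⁻ ω, ‖X ω - Y ω‖ₑ ^ 2 ∂P = edist f g ^ 2 := by
  rw [Lp.edist_def, eLpNorm_two_sq]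
  refine lintegral_congr_ae ?_
  filter_upwards [hX, hY] with ω h1 h2
  rw [h1, h2, Pi.sub_apply]

theorem div_two_pow_sq (x : ℝ≥0∞) (n : ℕ) : (x / 2 ^ n) ^ 2 = x ^ 2 * 4⁻¹ ^ n := by
  have h : (2⁻¹ : ℝ≥0∞) ^ 2 = 4⁻¹ := by rw [← ENNReal.inv_pow]; norm_num
  rw [div_eq_mul_inv, mul_pow, ENNReal.inv_pow, ← pow_mul, mul_comm n 2, pow_mul, h]

/-- A sequence of continuous curves with locally uniformly geometrically decreasing increments
converges locally uniformly. -/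
theorem exists_tendsto_of_edist_le {E : Type*} [PseudoEMetricSpace E] [CompleteSpace E]
    {I : ℕ → ℝ≥0 → E} (hI : ∀ n, Continuous (I n))
    (h : ∀ T : ℝ≥0, ∃ K : ℝ≥0∞, K ≠ ∞ ∧ ∀ n, ∀ t ≤ T, edist (I n t) (I (n + 1) t) ≤ K / 2 ^ n) :
    ∃ J : ℝ≥0 → E, Continuous J ∧ (∀ t, Tendsto (fun n => I n t) atTop (𝓝 (J t))) ∧
      ∀ T : ℝ≥0, ∃ K : ℝ≥0∞, K ≠ ∞ ∧ ∀ n, ∀ t ≤ T, edist (I n t) (J t) ≤ 2 * K / 2 ^ n := by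
  choose K hK hIK using h
  choose J hJ using fun t => cauchySeq_tendsto_of_complete
    (cauchySeq_of_edist_le_geometric_two (K t) (hK t) fun n => hIK t n t le_rfl)
  have hd : ∀ T n, ∀ t ≤ T, edist (I n t) (J t) ≤ 2 * K T / 2 ^ n := fun T n t ht =>
    edist_le_of_edist_le_geometric_two_of_tendsto (K T) (fun n => hIK T n t ht) (hJ t) n
  refine ⟨J, ?_, hJ, fun T => ⟨K T, hK T, hd T⟩⟩
  have hlu : TendstoLocallyUniformly I J atTop := by
    refine EMetric.tendstoLocallyUniformly_iff.2 fun ε hε t₀ => ?_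
    refine ⟨Iic (t₀ + 1), Iic_mem_nhds (lt_add_one t₀), ?_⟩
    have hlim : Tendsto (fun n : ℕ => 2 * K (t₀ + 1) / 2 ^ n) atTop (𝓝 0) := by
      have h1 := ENNReal.Tendsto.const_mul (a := 2 * K (t₀ + 1))
        (ENNReal.tendsto_pow_atTop_nhds_zero_of_lt_one (r := 2⁻¹) (by simp))
        (.inr (by have := hK (t₀ + 1); finiteness))
      simpa [div_eq_mul_inv, ENNReal.inv_pow] using h1
    filter_upwards [hlim.eventually_lt_const hε] with n hn t ht
    rw [edist_comm]
    exact (hd _ n t ht).trans_lt hn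
  exact hlu.continuous (.of_forall hI)

end L2

/-! ### Picard iteration: contraction, uniqueness and existence. -/

section Picard

variable {H : Type uH} [NormedAddCommGroup H] [InnerProductSpace ℝ H] [CompleteSpace H]
  [TopologicalSpace.SeparableSpace H]
variable {G : Type uG} [NormedAddCommGroup G] [InnerProductSpace ℝ G] [CompleteSpace G]
  [MeasurableSpace G] [BorelSpace G] [SecondCountableTopology G]
variable {U : Type uU} [MeasurableSpace U]
variable {Ω : Type uO} {m : MeasurableSpace Ω} {P : Measure Ω} [IsProbabilityMeasure P]
  {ℱ : Filtration ℝ≥0 m}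
  {R : Set (Set U)} {μ : Measure U} [SigmaFinite μ] {q : ℝ≥0 → U → HilbertianSeminorm H}
  {M : ℝ≥0 → Set U → H →ₗ[ℝ] (Ω →ₘ[P] ℝ)} {S : ℝ≥0 → G →L[ℝ] G} {B : ℝ≥0 → Ω → G → G}
  {F : (r : ℝ≥0) → (u : U) → G → (q r u).Space →L[ℝ] G} {a b : ℝ≥0 → ℝ≥0} {ξ : Ω → G}
  {X X' Z Z' : ℝ≥0 → Ω → G}

/-- The mild equation is a contraction for an exponentially weighted second moment. -/
theorem exists_contraction (hM : IsCylMartingaleMeasure P ℱ R μ q M) (hS : IsC0Semigroup S)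
    (hB : IsLipschitzDrift ℱ B a) (hF : IsLipschitzDiffusion μ q F b) (T : ℝ≥0) :
    ∃ w : ℝ≥0 → ℝ≥0∞, w T ≠ ∞ ∧ (∀ t, 1 ≤ w t) ∧ (∀ t ≤ T, w t ≤ w T) ∧
      ∀ X X' Z Z' : ℝ≥0 → Ω → G, IsStronglyPredictable ℱ X → IsStronglyPredictable ℱ X' →
        LocallyBoundedSecondMoment P X → LocallyBoundedSecondMoment P X' →
        IsMildImage P ℱ R μ q M S B F ξ X Z → IsMildImage P ℱ R μ q M S B F ξ X' Z' →
        ∀ s : ℝ≥0∞, s ≠ ∞ → (∀ t ≤ T, ∫⁻ ω, ‖X t ω - X' t ω‖ₑ ^ 2 ∂P ≤ s * w t) →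
        ∀ t ≤ T, ∫⁻ ω, ‖Z t ω - Z' t ω‖ₑ ^ 2 ∂P ≤ s / 4 * w t := by
  obtain ⟨k, hkm, hkT, hk⟩ := exists_kernel (ξ := ξ) hM hS hB hF T
  obtain ⟨c, hc, hw⟩ := exists_exp_weight T hkm hkT
  refine ⟨fun t => ENNReal.ofReal (Real.exp (c * t)), by finiteness, fun t => ?_, fun t ht => ?_, ?_⟩
  · rw [← ENNReal.ofReal_one]
    exact ENNReal.ofReal_le_ofReal (Real.one_le_exp (by positivity))
  · exact ENNReal.ofReal_le_ofReal (Real.exp_le_exp.2 (by gcongr))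
  intro X X' Z Z' hX hX' hX2 hX2' hZ hZ' s hs h t ht
  refine (hk X X' Z Z' hX hX' hX2 hX2' hZ hZ' t ht).trans ?_
  calc _ ≤ ∫⁻ r in Iic t, s * (k r * ENNReal.ofReal (Real.exp (c * r))) ∂leb := by
        refine setLIntegral_mono' measurableSet_Iic fun r hr => ?_
        rw [mul_left_comm]
        exact mul_le_mul_right (h r ((mem_Iic.1 hr).trans ht)) _
    _ = s * ∫⁻ r in Iic t, k r * ENNReal.ofReal (Real.exp (c * r)) ∂leb :=
        lintegral_const_mul' _ _ hs
    _ ≤ s * (ENNReal.ofReal (Real.exp (c * t)) / 4) := mul_le_mul_right (hw t ht) _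
    _ = _ := by simp only [div_eq_mul_inv]; ring

omit [TopologicalSpace.SeparableSpace H] [SigmaFinite μ] in
theorem isMildSolution_of_isMildImage (hS : IsC0Semigroup S) (hB : IsLipschitzDrift ℱ B a)
    (hX : IsStronglyPredictable ℱ X) (hX2 : LocallyBoundedSecondMoment P X)
    (h : IsMildImage P ℱ R μ q M S B F ξ X X) : IsMildSolution P ℱ R μ q M S B F ξ X :=
  ⟨hX, fun t => ⟨(hB.isDrift hX hX2).ae_integrableOn hS t, h t⟩⟩

/-- Uniqueness of mild solutions. -/
theorem IsMildSolution.ae_eq (hM : IsCylMartingaleMeasure P ℱ R μ q M) (hS : IsC0Semigroup S)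
    (hB : IsLipschitzDrift ℱ B a) (hF : IsLipschitzDiffusion μ q F b)
    (hX : IsMildSolution P ℱ R μ q M S B F ξ X) (hX2 : LocallyBoundedSecondMoment P X)
    (hX' : IsMildSolution P ℱ R μ q M S B F ξ X') (hX2' : LocallyBoundedSecondMoment P X')
    (T : ℝ≥0) : X T =ᵐ[P] X' T := by
  obtain ⟨w, hwT, hw1, -, hw⟩ := exists_contraction (ξ := ξ) hM hS hB hF T
  obtain ⟨C, hC, hXC⟩ := hX2.exists_bound T
  obtain ⟨C', hC', hXC'⟩ := hX2'.exists_bound T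
  have hm := fun t => aestronglyMeasurable_of_predictable (P := P) hX.1 t
  -- Both solutions are their own images, so the contraction can be applied repeatedly to the same
  -- pair; `1 ≤ w` starts the induction from the unweighted bound.
  have key : ∀ n : ℕ, ∀ t ≤ T, ∫⁻ ω, ‖X t ω - X' t ω‖ₑ ^ 2 ∂P ≤
      (2 * C + 2 * C') * (4⁻¹ : ℝ≥0∞) ^ n * w t := fun n => by
    induction n with
    | zero =>
      intro t ht
      refine (lintegral_sq_sub_le_of_bounds (hm t) (hXC t ht) (hXC' t ht)).trans ?_
      rw [pow_zero, mul_one]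
      exact le_mul_of_one_le_right' (hw1 t)
    | succ n ih =>
      have h := hw X X' X X' hX.1 hX'.1 hX2 hX2' hX.isMildImage hX'.isMildImage _
        (by finiteness) ih
      simpa only [pow_succ, div_eq_mul_inv, mul_assoc] using h
  refine ae_eq_of_lintegral_sq_sub_eq_zero (hm T) (aestronglyMeasurable_of_predictable hX'.1 T) ?_
  have hlim := tendsto_mul_inv_pow (C := (2 * C + 2 * C') * w T) (by finiteness)
  refine le_antisymm (ge_of_tendsto' hlim fun n => ?_) zero_le
  rw [mul_right_comm]
  exact key n T le_rfl

/-- One step of the Picard iteration. -/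
theorem exists_picard_step (hM : IsCylMartingaleMeasure P ℱ R μ q M) (hS : IsC0Semigroup S)
    (hB : IsLipschitzDrift ℱ B a) (hF : IsLipschitzDiffusion μ q F b) (hξ : Measurable[ℱ 0] ξ)
    (hξ2 : MemLp ξ 2 P) (hX : IsStronglyPredictable ℱ X) (hX2 : LocallyBoundedSecondMoment P X) :
    ∃ (I : ℝ≥0 → Lp G 2 P) (Z : ℝ≥0 → Ω → G), Continuous I ∧
      (∀ t, AEStronglyMeasurable[ℱ t] (I t) P) ∧ IsStronglyPredictable ℱ Z ∧
      LocallyBoundedSecondMoment P Z ∧ (∀ t, Z t =ᵐ[P] I t) ∧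
      IsMildImage P ℱ R μ q M S B F ξ X Z := by
  obtain ⟨I, hI, hIm, hXI⟩ := exists_mildImage hM hS hB hF hξ hξ2 hX hX2
  obtain ⟨Z, hZ, hZI⟩ := exists_predictable_version hI hIm
  exact ⟨I, Z, hI, hIm, hZ, locallyBoundedSecondMoment_of_continuous hI hZI, hZI, hXI.congr hZI⟩

/-- The factor 1/4 on second moments is a factor 1/2 on L² distances, so the iterates are
geometrically Cauchy. Completeness is used for curves in L², and a predictable representative is
chosen again only for the limit. -/
theorem exists_mildSolution (hM : IsCylMartingaleMeasure P ℱ R μ q M) (hS : IsC0Semigroup S)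
    (hB : IsLipschitzDrift ℱ B a) (hF : IsLipschitzDiffusion μ q F b) (hξ : Measurable[ℱ 0] ξ)
    (hξ2 : MemLp ξ 2 P) :
    ∃ X, IsMildSolution P ℱ R μ q M S B F ξ X ∧ LocallyBoundedSecondMoment P X := by
  -- For every admissible process, `I` is the L² curve of its image and `Z` a predictable version of
  -- that curve.
  choose I Z hI hIm hZ hZ2 hZI hXZ using fun X : {X : ℝ≥0 → Ω → G //
    IsStronglyPredictable ℱ X ∧ LocallyBoundedSecondMoment P X} =>
    exists_picard_step hM hS hB hF hξ hξ2 X.2.1 X.2.2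
  let X : ℕ → {X : ℝ≥0 → Ω → G // IsStronglyPredictable ℱ X ∧ LocallyBoundedSecondMoment P X} :=
    fun n => Nat.rec ⟨fun _ _ => 0, stronglyMeasurable_const, fun T => by simp⟩
      (fun _ Y => ⟨Z Y, hZ Y, hZ2 Y⟩) n
  have hX : ∀ n, (X (n + 1)).1 = Z (X n) := fun n => rfl
  have hm := fun n t => aestronglyMeasurable_of_predictable (P := P) (X n).2.1 t
  have hstep : ∀ n, IsMildImage P ℱ R μ q M S B F ξ (X n).1 (X (n + 1)).1 := fun n => hXZ (X n)
  have hgeo : ∀ T : ℝ≥0, ∃ K : ℝ≥0∞, K ≠ ∞ ∧ ∀ n, ∀ t ≤ T,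
      edist (I (X n) t) (I (X (n + 1)) t) ≤ K / 2 ^ n := fun T => by
    obtain ⟨w, hwT, hw1, hwm, hw⟩ := exists_contraction (ξ := ξ) hM hS hB hF T
    obtain ⟨C, hC, hXC⟩ := (X 1).2.2.exists_bound T
    obtain ⟨C', hC', hXC'⟩ := (X 2).2.2.exists_bound T
    -- The index is shifted by one because `I (X n)` represents the image of `X n`, that is `X (n +
    -- 1)`.
    have key : ∀ n : ℕ, ∀ t ≤ T, ∫⁻ ω, ‖(X (n + 1)).1 t ω - (X (n + 2)).1 t ω‖ₑ ^ 2 ∂P ≤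
        (2 * C + 2 * C') * (4⁻¹ : ℝ≥0∞) ^ n * w t := fun n => by
      induction n with
      | zero =>
        intro t ht
        refine (lintegral_sq_sub_le_of_bounds (hm 1 t) (hXC t ht) (hXC' t ht)).trans ?_
        rw [pow_zero, mul_one]
        exact le_mul_of_one_le_right' (hw1 t)
      | succ n ih =>
        have h := hw _ _ _ _ (X (n + 1)).2.1 (X (n + 2)).2.1 (X (n + 1)).2.2 (X (n + 2)).2.2
          (hstep (n + 1)) (hstep (n + 2)) _ (by finiteness) ih
        simpa only [pow_succ, div_eq_mul_inv, mul_assoc] using h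
    -- Adding 1 gives `D ≤ (D + 1)²`, so a bound on distances follows without taking a square root
    -- of `D`.
    refine ⟨(2 * C + 2 * C') * w T + 1, by finiteness, fun n t ht => ?_⟩
    set D := (2 * C + 2 * C') * w T
    have h1 : edist (I (X n) t) (I (X (n + 1)) t) ^ 2 ≤ ((D + 1) / 2 ^ n) ^ 2 := by
      rw [← lintegral_sq_sub_eq_edist_sq (hZI (X n) t) (hZI (X (n + 1)) t)]
      calc _ ≤ (2 * C + 2 * C') * (4⁻¹ : ℝ≥0∞) ^ n * w T :=
            (key n t ht).trans (mul_le_mul_right (hwm t ht) _)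
        _ = D * 4⁻¹ ^ n := by ring
        _ ≤ (D + 1) ^ 2 * 4⁻¹ ^ n := by
            gcongr
            calc D ≤ (D + 1) * 1 := by rw [mul_one]; exact le_self_add
              _ ≤ (D + 1) * (D + 1) := by gcongr; exact le_add_self
              _ = _ := (sq _).symm
        _ = _ := (div_two_pow_sq _ _).symm
    by_contra! hlt
    exact (ENNReal.pow_lt_pow_left two_ne_zero hlt).not_ge h1
  obtain ⟨J, hJ, hJlim, hJd⟩ := exists_tendsto_of_edist_le (fun n => hI (X n)) hgeo
  have hJm : ∀ t, AEStronglyMeasurable[ℱ t] (J t) P := fun t =>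
    (isClosed_aestronglyMeasurable (ℱ.le t)).mem_of_tendsto (hJlim t)
      (.of_forall fun n => hIm (X n) t)
  obtain ⟨V, hV, hVJ⟩ := exists_predictable_version hJ hJm
  have hV2 := locallyBoundedSecondMoment_of_continuous hJ hVJ
  let V' : {X : ℝ≥0 → Ω → G // IsStronglyPredictable ℱ X ∧ LocallyBoundedSecondMoment P X} :=
    ⟨V, hV, hV2⟩
  -- The iterate `X (n + 2)` is close to `V` by convergence, and close to the image of `V` by
  -- contraction from `X (n + 1)`; letting `n` grow identifies the two.
  have hfix : ∀ T, V T =ᵐ[P] Z V' T := fun T => by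
    obtain ⟨w, hwT, hw1, hwm, hw⟩ := exists_contraction (ξ := ξ) hM hS hB hF T
    obtain ⟨K, hK, hd⟩ := hJd T
    refine ae_eq_of_lintegral_sq_sub_eq_zero (aestronglyMeasurable_of_predictable hV T)
      (aestronglyMeasurable_of_predictable (hZ V') T) ?_
    have hd2 : ∀ n, ∀ t ≤ T, ∫⁻ ω, ‖(X (n + 1)).1 t ω - V t ω‖ₑ ^ 2 ∂P ≤
        (2 * K) ^ 2 * 4⁻¹ ^ n * w t := fun n t ht => by
      rw [lintegral_sq_sub_eq_edist_sq (hZI (X n) t) (hVJ t)]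
      calc _ ≤ (2 * K / 2 ^ n) ^ 2 := pow_le_pow_left' (hd n t ht) 2
        _ = (2 * K) ^ 2 * 4⁻¹ ^ n := (div_two_pow_sq _ _)
        _ ≤ _ := le_mul_of_one_le_right' (hw1 t)
    have hd3 : ∀ n, ∫⁻ ω, ‖(X (n + 2)).1 T ω - Z V' T ω‖ₑ ^ 2 ∂P ≤
        (2 * K) ^ 2 * 4⁻¹ ^ n / 4 * w T := fun n =>
      hw _ _ _ _ (X (n + 1)).2.1 hV (X (n + 1)).2.2 hV2 (hstep (n + 1)) (hXZ V') _
        (by finiteness) (hd2 n) T le_rfl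
    have hlim := tendsto_mul_inv_pow (C := (2 * K) ^ 2 * w T) (by finiteness)
    refine le_antisymm (ge_of_tendsto' hlim fun n => ?_) zero_le
    have e : ∀ ω, V T ω - Z V' T ω =
        (V T ω - (X (n + 2)).1 T ω) + ((X (n + 2)).1 T ω - Z V' T ω) := fun ω => by abel
    simp_rw [e]
    refine (lintegral_enorm_add_sq_le
      ((aestronglyMeasurable_of_predictable hV T).sub (hm (n + 2) T))).trans ?_
    have h1 : ∫⁻ ω, ‖V T ω - (X (n + 2)).1 T ω‖ₑ ^ 2 ∂P ≤
        (2 * K) ^ 2 * 4⁻¹ ^ n / 4 * w T := by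
      simp_rw [← enorm_neg (V T _ - _), neg_sub]
      simpa only [pow_succ, div_eq_mul_inv, mul_assoc] using hd2 (n + 1) T le_rfl
    refine (add_le_add (mul_le_mul_right h1 2) (mul_le_mul_right (hd3 n) 2)).trans (le_of_eq ?_)
    -- Both errors carry the factor 1/4, exactly absorbing the two factors 2 of the squared triangle
    -- inequality.
    have h4 : (2 * 4⁻¹ + 2 * 4⁻¹ : ℝ≥0∞) = 1 := by
      rw [← add_mul]; norm_num
      exact ENNReal.mul_inv_cancel (by simp) (by simp)
    calc _ = (2 * 4⁻¹ + 2 * 4⁻¹ : ℝ≥0∞) * ((2 * K) ^ 2 * w T * 4⁻¹ ^ n) := by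
          rw [div_eq_mul_inv]; ring
      _ = _ := by rw [h4, one_mul]
  exact ⟨V, isMildSolution_of_isMildImage hS hB hV hV2 ((hXZ V').congr hfix), hV2⟩

end Picard

end CylSPDE

end

theorem mainTheorem6
    {H : Type*} [NormedAddCommGroup H] [InnerProductSpace ℝ H] [CompleteSpace H]
    [TopologicalSpace.SeparableSpace H]
    {G : Type*} [NormedAddCommGroup G] [InnerProductSpace ℝ G] [CompleteSpace G]
    [TopologicalSpace.SeparableSpace G] [MeasurableSpace G] [BorelSpace G]
    {U : Type*} [TopologicalSpace U] [MeasurableSpace U] [BorelSpace U]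
    {Ω : Type*} {m : MeasurableSpace Ω} (P : Measure Ω) [IsProbabilityMeasure P]
    (ℱ : Filtration ℝ≥0 m) (hℱ : CylSPDE.UsualConditions ℱ P)
    (R : Set (Set U)) (μ : Measure U) [SigmaFinite μ]
    (q : ℝ≥0 → U → CylSPDE.HilbertianSeminorm H)
    (M : ℝ≥0 → Set U → H →ₗ[ℝ] (Ω →ₘ[P] ℝ))
    (hM : CylSPDE.IsCylMartingaleMeasure P ℱ R μ q M)
    (A : G →ₗ.[ℝ] G) (S : ℝ≥0 → G →L[ℝ] G)
    (hS : CylSPDE.IsC0Semigroup S) (hA : CylSPDE.IsGenerator A S)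
    (B : ℝ≥0 → Ω → G → G)
    (hB : Measurable[ℱ.predictable.prod inferInstance]
      fun p : (ℝ≥0 × Ω) × G => B p.1.1 p.1.2 p.2)
    (F : (r : ℝ≥0) → (u : U) → G → (q r u).Space →L[ℝ] G)
    (hF : ∀ r u g, CylSPDE.IsHilbertSchmidt (F r u g))
    (hF_meas : ∀ (g₂ : G) (h : H), Measurable fun p : ℝ≥0 × U × G =>
      ⟪ContinuousLinearMap.adjoint (F p.1 p.2.1 p.2.2) g₂, (q p.1 p.2.1).incl h⟫_ℝ)
    (a b : ℝ≥0 → ℝ≥0)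
    (ha : ∀ T, IntegrableOn (fun r => (a r : ℝ)) (Iic T) CylSPDE.leb)
    (hb : ∀ T, IntegrableOn (fun r => (b r : ℝ) ^ 2) (Iic T) CylSPDE.leb)
    (hB_growth : ∀ r > 0, ∀ ω g, ‖B r ω g‖ ≤ a r * (1 + ‖g‖))
    (hF_growth : ∀ r > 0, ∀ g,
      ∫⁻ u, CylSPDE.hsNormSq (F r u g) ∂μ ≤ ENNReal.ofReal ((b r : ℝ) ^ 2 * (1 + ‖g‖) ^ 2))
    (hB_lip : ∀ r > 0, ∀ ω g₁ g₂, ‖B r ω g₁ - B r ω g₂‖ ≤ a r * ‖g₁ - g₂‖)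
    (hF_lip : ∀ r > 0, ∀ g₁ g₂,
      ∫⁻ u, CylSPDE.hsNormSq (F r u g₁ - F r u g₂) ∂μ
        ≤ ENNReal.ofReal ((b r : ℝ) ^ 2 * ‖g₁ - g₂‖ ^ 2))
    (ξ : Ω → G) (hξ : Measurable[ℱ 0] ξ) (hξ_sq : MemLp ξ 2 P) :
    ∃ X : ℝ≥0 → Ω → G,
      CylSPDE.IsMildSolution P ℱ R μ q M S B F ξ X ∧
      CylSPDE.LocallyBoundedSecondMoment P X ∧
      ∀ X' : ℝ≥0 → Ω → G, CylSPDE.IsMildSolution P ℱ R μ q M S B F ξ X' →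
        CylSPDE.LocallyBoundedSecondMoment P X' → ∀ t, ∀ᵐ ω ∂P, X t ω = X' t ω := by
  have := UniformSpace.secondCountable_of_separable G
  have hB' : CylSPDE.IsLipschitzDrift ℱ B a := ⟨hB, ha, hB_growth, hB_lip⟩
  have hF' : CylSPDE.IsLipschitzDiffusion μ q F b := ⟨hF, hF_meas, hb, hF_growth, hF_lip⟩
  obtain ⟨X, hX, hX2⟩ := CylSPDE.exists_mildSolution hM hS hB' hF' hξ hξ_sq
  exact ⟨X, hX, hX2, fun X' hX' hX2' t => hX.ae_eq hM hS hB' hF' hX2 hX' hX2' t⟩
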